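/- **Setting.** Let $k$ be a field and $H$ a $k$-bialgebra with comultiplication $h\mapsto h_{(1)}\otimes h_{(2)}$ and counit $\varepsilon$. A left $H$-module coalgebra is a (coassociative, counital) $k$-coalgebra $C$ with a left $H$-module structure such that $(hc)_{(1)}\otimes (hc)_{(2)}=h_{(1)}c_{(1)}\otimes h_{(2)}c_{(2)}$ and $\varepsilon(hc)=\varepsilon(h)\varepsilon(c)$. A (left-left) $H$-module/comodule is a $k$-space $M$ that is a left $H$-module and a left $H$-comodule, $m\mapsto m_{(-1)}\otimes m_{(0)}$, with no compatibility required; it is stable if $m_{(-1)}m_{(0)}=m$ for all $m$. A morphism $(C,M)\to(C',M')$ of such pairs is an $H$-linear coalgebra map $C\to C'$ together with an $H$-linear, $H$-colinear map $M\to M'$. Let $\Lambda$ be Connes' cyclic category: objects $[n]$, $n\ge 0$, morphisms generated by cofaces $\partial^n_i:[n]\to[n+1]$ $(0\le i\le n+1)$, codegeneracies $\sigma^n_j:[n+1]\to[n]$ $(0\le j\le n)$ and $\tau_n:[n]\to[n]$, subject to the cosimplicial relations and $\partial_i\tau_n=\tau_{n+1}\partial_{i+1}$ $(0\le i\le n)$,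 $\partial^n_{n+1}=\tau_{n+1}\partial^n_0$, $\tau_n\sigma_{j+1}=\sigma_j\tau_{n+1}$ $(0\le j<n)$, $\tau_n\sigma_0=\sigma_n\tau_{n+1}^2$, $\tau_n^{n+1}=\mathrm{id}$. A cocyclic (cyclic) $k$-module is a functor from $\Lambda$ ($\Lambda^{op}$) to $k$-vector spaces; cocyclic $k$-modules form an abelian category, in which $\mathrm{Ext}$ below is taken. For a cocyclic $k$-module $Y$, $HC^n(Y)$ is the degree $n$ cohomology of the total complex of the cyclic double complex with entry $Y_q$ in column $p\ge0$, row $q\ge0$, vertical maps $b=\sum_{i=0}^{q+1}(-1)^i\partial_i$ ($p$ even) and $-b'=-\sum_{i=0}^{q}(-1)^i\partial_i$ ($p$ odd), and horizontal maps $1-\lambda$ ($p$ even), $N=1+\lambda+\dots+\lambda^q$ ($p$ odd), $\lambda=(-1)^q\tau_q$. For a cyclic $k$-module $X$, $HC^n(X)$ is $HC^n$ of the cocyclic $k$-module $\mathrm{Hom}_k(X_\bullet,k)$. The cyclic dual $Y^\vee$ of a cocyclic $k$-module $Y$ is the cyclic $k$-module with $Y^\vee_n=Y_n$, faces $d_i=\sigma_i$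 $(0\le i\le n)$ and $d_{n+1}=\sigma_0\tau_{n+1}^{-1}$ from $Y_{n+1}$ to $Y_n$, degeneracies $s_j=\partial_{j+1}$ $(0\le j\le n)$ from $Y_n$ to $Y_{n+1}$, and cyclic operators $t_n=\tau_n^{-1}$. For $C$ and $M$ as above let $T_n(C,M)=C^{\otimes n+1}\otimes M$ with the diagonal $H$-action and $$\tau_n(c^0\otimes\cdots\otimes c^n\otimes m)=c^1\otimes\cdots\otimes c^n\otimes m_{(-1)}c^0\otimes m_{(0)},$$ $$\partial^n_i(c^0\otimes\cdots\otimes c^n\otimes m)=c^0\otimes\cdots\otimes c^i_{(1)}\otimes c^i_{(2)}\otimes\cdots\otimes m\quad(0\le i\le n),$$ $$\partial^n_{n+1}(c^0\otimes\cdots\otimes c^n\otimes m)=c^0_{(2)}\otimes c^1\otimes\cdots\otimes c^n\otimes m_{(-1)}c^0_{(1)}\otimes m_{(0)},$$ $$\sigma^{n}_j(c^0\otimes\cdots\otimes c^{n+1}\otimes m)=\varepsilon(c^{j+1})\,c^0\otimes\cdots\otimes c^{j}\otimes c^{j+2}\otimes\cdots\otimes c^{n+1}\otimes m\quad(0\le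 j\le n).$$ These satisfy all the relations of $\Lambda$ except $\tau_n^{n+1}=\mathrm{id}$, and $\partial^n_i$ $(i\le n)$ and $\sigma^n_j$ are $H$-linear. Let $Q_\bullet(C,M)$ be the largest quotient of $T_\bullet(C,M)$ (by a graded $k$-subspace stable under $H$ and all the operators) on which $H$ commutes with every $\tau_n$ and $\tau_n^{n+1}=\mathrm{id}$, and put $\mathcal C_\bullet(C,M)=k\otimes_H Q_\bullet(C,M)$, a cocyclic $k$-module. Define $$HC^n_{\rm Hopf}(C,C';M,M')=\mathrm{Ext}^n\big(\mathcal C_\bullet(C,M),\mathcal C_\bullet(C',M')\big).$$ Let $PCM_\bullet(C,H,M)$ be the largest quotient of $T_\bullet(C,M)$ on which $H$ commutes with every $\tau_n$. If $M$ is stable, $k\otimes_H PCM_\bullet(C,H,M)$ is a cocyclic $k$-module, and the Hopf cyclic cohomology $HC^n(C,H,M)$ of the triple $(C,H,M)$ is $HC^n$ of this cocyclic module. Finally let $(k,k)$ be the pair given by the coalgebra $k$ and the module/comodule $k$, with $H$ acting through $\varepsilon$ and coacting by $x\mapsto 1\otimes x$. **Theorem (Specialization theorem).** Let $C$ be an $H$-module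 coalgebra and $M$ a stable $H$-module/comodule. Then for every $n\ge0$ there are $k$-linear isomorphisms $$HC^n_{\rm Hopf}(k,C;k,M)\;\cong\; HC^n(C,H,M),\qquad HC^n_{\rm Hopf}(C,k;M,k)\;\cong\; HC^n\big(\mathcal C_\bullet(C,M)^\vee\big),$$ both natural with respect to morphisms of pairs $(C,M)$ with $M$ stable. -/

import Mathlib

universe u v w

set_option linter.unusedSimpArgs false

namespace BivariantHopf

open CategoryTheory Opposite

/-! ## Connes' cyclic category by generators and relations -/

/-- The generating arrows of the cyclic category: cofaces `∂ⁿᵢ : [n] → [n+1]` for `0 ≤ i ≤ n+1`,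
codegeneracies `σⁿⱼ : [n+1] → [n]` for `0 ≤ j ≤ n` and cyclic operators `τₙ : [n] → [n]`. -/
inductive Gen : ℕ → ℕ → Type
  | δ (n : ℕ) (i : Fin (n + 2)) : Gen n (n + 1)
  | σ (n : ℕ) (j : Fin (n + 1)) : Gen (n + 1) n
  | τ (n : ℕ) : Gen n n

/-- The objects `[n]`, `n ≥ 0`. -/
structure CycOb : Type where
  len : ℕ

instance : Quiver CycOb := ⟨fun a b => Gen a.len b.len⟩

/-- The free category on the generating arrows. -/
abbrev Words : Type := Paths CycOb

/-- The object `[n]` of the free category. -/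
def wob (n : ℕ) : Words := (⟨n⟩ : CycOb)

/-- The one-letter word `∂ⁿᵢ`. -/
def wδ (n : ℕ) (i : Fin (n + 2)) : wob n ⟶ wob (n + 1) :=
  (Paths.of CycOb).map (X := ⟨n⟩) (Y := ⟨n + 1⟩) (Gen.δ n i)

/-- The one-letter word `σⁿⱼ`. -/
def wσ (n : ℕ) (j : Fin (n + 1)) : wob (n + 1) ⟶ wob n :=
  (Paths.of CycOb).map (X := ⟨n + 1⟩) (Y := ⟨n⟩) (Gen.σ n j)

/-- The one-letter word `τₙ`. -/
def wτ (n : ℕ) : wob n ⟶ wob n :=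
  (Paths.of CycOb).map (X := ⟨n⟩) (Y := ⟨n⟩) (Gen.τ n)

/-- Iterated composite of an endomorphism. -/
def iter {𝒟 : Type u} [Category.{v} 𝒟] {X : 𝒟} (f : X ⟶ X) : ℕ → (X ⟶ X)
  | 0 => 𝟙 X
  | m + 1 => iter f m ≫ f

theorem map_iter {𝒟 : Type*} [Category* 𝒟] {ℰ : Type*} [Category* ℰ] (F : 𝒟 ⥤ ℰ) {X : 𝒟}
    (f : X ⟶ X) (m : ℕ) : F.map (iter f m) = iter (F.map f) m := by
  induction m with
  | zero => simp [iter]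
  | succ m ih => simp [iter, ih]

/-- The defining relations of the cyclic category (a composite `f ≫ g` means: first `f`,
then `g`, so that `f ≫ g` is the product `g f` of operators acting from the left). -/
inductive CycRel : HomRel Words
  | δ_δ (n : ℕ) (i j : Fin (n + 2)) (h : i ≤ j) :
      CycRel (wδ n j ≫ wδ (n + 1) i.castSucc) (wδ n i ≫ wδ (n + 1) j.succ)
  | σ_σ (n : ℕ) (i j : Fin (n + 1)) (h : i ≤ j) :
      CycRel (wσ (n + 1) i.castSucc ≫ wσ n j) (wσ (n + 1) j.succ ≫ wσ n i)
  | δ_σ_self (n : ℕ) (i : Fin (n + 1)) : CycRel (wδ n i.castSucc ≫ wσ n i) (𝟙 _)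
  | δ_σ_succ (n : ℕ) (i : Fin (n + 1)) : CycRel (wδ n i.succ ≫ wσ n i) (𝟙 _)
  | σ_δ_le (n : ℕ) (i : Fin (n + 2)) (j : Fin (n + 1)) (h : i ≤ j.castSucc) :
      CycRel (wσ n j ≫ wδ n i) (wδ (n + 1) i.castSucc ≫ wσ (n + 1) j.succ)
  | σ_δ_gt (n : ℕ) (i : Fin (n + 2)) (j : Fin (n + 1)) (h : j.castSucc < i) :
      CycRel (wσ n j ≫ wδ n i) (wδ (n + 1) i.succ ≫ wσ (n + 1) j.castSucc)
  | τ_δ (n : ℕ) (i : Fin (n + 1)) :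
      CycRel (wτ n ≫ wδ n i.castSucc) (wδ n i.succ ≫ wτ (n + 1))
  | δ_last (n : ℕ) : CycRel (wδ n (Fin.last (n + 1))) (wδ n 0 ≫ wτ (n + 1))
  | σ_τ (n : ℕ) (j : Fin n) :
      CycRel (wσ n j.succ ≫ wτ n) (wτ (n + 1) ≫ wσ n j.castSucc)
  | σ_τ_zero (n : ℕ) : CycRel (wσ n 0 ≫ wτ n) (wτ (n + 1) ≫ wτ (n + 1) ≫ wσ n (Fin.last n))
  | τ_pow (n : ℕ) : CycRel (iter (wτ n) (n + 1)) (𝟙 _)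

/-- Connes' cyclic category `Λ`. -/
abbrev Lam : Type := CategoryTheory.Quotient CycRel

namespace Lam

/-- The object `[n]` of `Λ`. -/
def ob (n : ℕ) : Lam := (CategoryTheory.Quotient.functor CycRel).obj (wob n)

/-- The coface `∂ⁿᵢ`. -/
def δ (n : ℕ) (i : Fin (n + 2)) : ob n ⟶ ob (n + 1) := (CategoryTheory.Quotient.functor CycRel).map (wδ n i)

/-- The codegeneracy `σⁿⱼ`. -/
def σ (n : ℕ) (j : Fin (n + 1)) : ob (n + 1) ⟶ ob n := (CategoryTheory.Quotient.functor CycRel).map (wσ n j)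

/-- The cyclic operator `τₙ`. -/
def τ (n : ℕ) : ob n ⟶ ob n := (CategoryTheory.Quotient.functor CycRel).map (wτ n)

/-- The inverse `τₙ⁻¹ = τₙⁿ` of the cyclic operator. -/
def τinv (n : ℕ) : ob n ⟶ ob n := iter (τ n) n

end Lam

/-- A cocyclic object of a category: a sequence of objects with cofaces, codegeneracies and cyclic
operators that satisfy the relations of `Λ`. -/
structure CocyclicObject (𝒟 : Type u) [Category.{v} 𝒟] where
  X : ℕ → 𝒟
  δ : ∀ n, Fin (n + 2) → (X n ⟶ X (n + 1))
  σ : ∀ n, Fin (n + 1) → (X (n + 1) ⟶ X n)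
  τ : ∀ n, X n ⟶ X n
  δ_δ : ∀ (n : ℕ) (i j : Fin (n + 2)), i ≤ j → δ n j ≫ δ (n + 1) i.castSucc = δ n i ≫ δ (n + 1) j.succ
  σ_σ : ∀ (n : ℕ) (i j : Fin (n + 1)), i ≤ j →
    σ (n + 1) i.castSucc ≫ σ n j = σ (n + 1) j.succ ≫ σ n i
  δ_σ_self : ∀ (n : ℕ) (i : Fin (n + 1)), δ n i.castSucc ≫ σ n i = 𝟙 _
  δ_σ_succ : ∀ (n : ℕ) (i : Fin (n + 1)), δ n i.succ ≫ σ n i = 𝟙 _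
  σ_δ_le : ∀ (n : ℕ) (i : Fin (n + 2)) (j : Fin (n + 1)), i ≤ j.castSucc →
    σ n j ≫ δ n i = δ (n + 1) i.castSucc ≫ σ (n + 1) j.succ
  σ_δ_gt : ∀ (n : ℕ) (i : Fin (n + 2)) (j : Fin (n + 1)), j.castSucc < i →
    σ n j ≫ δ n i = δ (n + 1) i.succ ≫ σ (n + 1) j.castSucc
  τ_δ : ∀ (n : ℕ) (i : Fin (n + 1)), τ n ≫ δ n i.castSucc = δ n i.succ ≫ τ (n + 1)
  δ_last : ∀ (n : ℕ), δ n (Fin.last (n + 1)) = δ n 0 ≫ τ (n + 1)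
  σ_τ : ∀ (n : ℕ) (j : Fin n), σ n j.succ ≫ τ n = τ (n + 1) ≫ σ n j.castSucc
  σ_τ_zero : ∀ (n : ℕ), σ n 0 ≫ τ n = τ (n + 1) ≫ τ (n + 1) ≫ σ n (Fin.last n)
  τ_pow : ∀ (n : ℕ), iter (τ n) (n + 1) = 𝟙 _

namespace CocyclicObject

variable {𝒟 : Type u} [Category.{v} 𝒟]

/-- The functor on the free category given by the structure morphisms. -/
def wordFunctor (A : CocyclicObject 𝒟) : Words ⥤ 𝒟 :=
  Paths.lift
    { obj := fun a => A.X a.len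
      map := fun {a b} (g : Gen a.len b.len) =>
        match a.len, b.len, g with
        | _, _, Gen.δ n i => A.δ n i
        | _, _, Gen.σ n j => A.σ n j
        | _, _, Gen.τ n => A.τ n }

theorem wordFunctor_δ (A : CocyclicObject 𝒟) (n : ℕ) (i : Fin (n + 2)) :
    A.wordFunctor.map (wδ n i) = A.δ n i := Paths.lift_toPath _ _

theorem wordFunctor_σ (A : CocyclicObject 𝒟) (n : ℕ) (j : Fin (n + 1)) :
    A.wordFunctor.map (wσ n j) = A.σ n j := Paths.lift_toPath _ _

theorem wordFunctor_τ (A : CocyclicObject 𝒟) (n : ℕ) :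
    A.wordFunctor.map (wτ n) = A.τ n := Paths.lift_toPath _ _

/-- The functor `Λ ⥤ 𝒟` that belongs to a cocyclic object. -/
def functor (A : CocyclicObject 𝒟) : Lam ⥤ 𝒟 :=
  CategoryTheory.Quotient.lift CycRel A.wordFunctor (by
    intro a b f g h
    cases h with
    | δ_δ n i j h =>
      simp only [Functor.map_comp, Functor.map_id, map_iter, wordFunctor_δ, wordFunctor_σ,
        wordFunctor_τ]
      exact A.δ_δ n i j h
    | σ_σ n i j h =>
      simp only [Functor.map_comp, Functor.map_id, map_iter, wordFunctor_δ, wordFunctor_σ,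
        wordFunctor_τ]
      exact A.σ_σ n i j h
    | δ_σ_self n i =>
      simp only [Functor.map_comp, Functor.map_id, map_iter, wordFunctor_δ, wordFunctor_σ,
        wordFunctor_τ]
      exact A.δ_σ_self n i
    | δ_σ_succ n i =>
      simp only [Functor.map_comp, Functor.map_id, map_iter, wordFunctor_δ, wordFunctor_σ,
        wordFunctor_τ]
      exact A.δ_σ_succ n i
    | σ_δ_le n i j h =>
      simp only [Functor.map_comp, Functor.map_id, map_iter, wordFunctor_δ, wordFunctor_σ,
        wordFunctor_τ]
      exact A.σ_δ_le n i j h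
    | σ_δ_gt n i j h =>
      simp only [Functor.map_comp, Functor.map_id, map_iter, wordFunctor_δ, wordFunctor_σ,
        wordFunctor_τ]
      exact A.σ_δ_gt n i j h
    | τ_δ n i =>
      simp only [Functor.map_comp, Functor.map_id, map_iter, wordFunctor_δ, wordFunctor_σ,
        wordFunctor_τ]
      exact A.τ_δ n i
    | δ_last n =>
      simp only [Functor.map_comp, Functor.map_id, map_iter, wordFunctor_δ, wordFunctor_σ,
        wordFunctor_τ]
      exact A.δ_last n
    | σ_τ n j =>
      simp only [Functor.map_comp, Functor.map_id, map_iter, wordFunctor_δ, wordFunctor_σ,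
        wordFunctor_τ]
      exact A.σ_τ n j
    | σ_τ_zero n =>
      simp only [Functor.map_comp, Functor.map_id, map_iter, wordFunctor_δ, wordFunctor_σ,
        wordFunctor_τ]
      exact A.σ_τ_zero n
    | τ_pow n =>
      simp only [Functor.map_comp, Functor.map_id, map_iter, wordFunctor_δ, wordFunctor_σ,
        wordFunctor_τ]
      exact A.τ_pow n)

theorem natural_comp {𝒞 : Type*} [Category* 𝒞] {F G : 𝒞 ⥤ 𝒟} {a b c : 𝒞} (p : a ⟶ b) (q : b ⟶ c)
    (fa : F.obj a ⟶ G.obj a) (fb : F.obj b ⟶ G.obj b) (fc : F.obj c ⟶ G.obj c)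
    (hp : F.map p ≫ fb = fa ≫ G.map p) (hq : F.map q ≫ fc = fb ≫ G.map q) :
    F.map (p ≫ q) ≫ fc = fa ≫ G.map (p ≫ q) := by
  rw [F.map_comp, G.map_comp, Category.assoc, hq, ← Category.assoc, hp, Category.assoc]

theorem gen_natural {A B : CocyclicObject 𝒟} (f : ∀ n, A.X n ⟶ B.X n)
    (hδ : ∀ n i, f n ≫ B.δ n i = A.δ n i ≫ f (n + 1))
    (hσ : ∀ n j, f (n + 1) ≫ B.σ n j = A.σ n j ≫ f n)
    (hτ : ∀ n, f n ≫ B.τ n = A.τ n ≫ f n) {c d : ℕ} (q : Gen c d) :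
    A.wordFunctor.map ((Paths.of CycOb).map (X := ⟨c⟩) (Y := ⟨d⟩) q) ≫ f d =
      f c ≫ B.wordFunctor.map ((Paths.of CycOb).map (X := ⟨c⟩) (Y := ⟨d⟩) q) := by
  cases q with
  | δ n i =>
    exact (congrArg (· ≫ f (c + 1)) (A.wordFunctor_δ c i)).trans
      ((hδ c i).symm.trans (congrArg (f c ≫ ·) (B.wordFunctor_δ c i).symm))
  | σ n j =>
    exact (congrArg (· ≫ f d) (A.wordFunctor_σ d j)).trans
      ((hσ d j).symm.trans (congrArg (f (d + 1) ≫ ·) (B.wordFunctor_σ d j).symm))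
  | τ n =>
    exact (congrArg (· ≫ f c) (A.wordFunctor_τ c)).trans
      ((hτ c).symm.trans (congrArg (f c ≫ ·) (B.wordFunctor_τ c).symm))

theorem word_natural {A B : CocyclicObject 𝒟} (f : ∀ n, A.X n ⟶ B.X n)
    (hδ : ∀ n i, f n ≫ B.δ n i = A.δ n i ≫ f (n + 1))
    (hσ : ∀ n j, f (n + 1) ≫ B.σ n j = A.σ n j ≫ f n)
    (hτ : ∀ n, f n ≫ B.τ n = A.τ n ≫ f n) {a b : Words} (p : a ⟶ b) :
    A.wordFunctor.map p ≫ f (CycOb.len b) = f (CycOb.len a) ≫ B.wordFunctor.map p := by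
  induction p using Paths.induction with
  | id =>
    exact ((congrArg (· ≫ _) (A.wordFunctor.map_id _)).trans (Category.id_comp _)).trans
      ((congrArg (_ ≫ ·) (B.wordFunctor.map_id _)).trans (Category.comp_id _)).symm
  | comp p q ih =>
    rename_i u c d
    refine natural_comp (F := A.wordFunctor) (G := B.wordFunctor) p _ (f u.len) (f c.len)
      (f d.len) ih ?_
    exact gen_natural f hδ hσ hτ (c := c.len) (d := d.len) q

/-- A family of morphisms that commutes with all structure morphisms is a natural
transformation of the associated functors on `Λ`. -/
def homOfFamily {A B : CocyclicObject 𝒟} (f : ∀ n, A.X n ⟶ B.X n)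
    (hδ : ∀ n i, f n ≫ B.δ n i = A.δ n i ≫ f (n + 1))
    (hσ : ∀ n j, f (n + 1) ≫ B.σ n j = A.σ n j ≫ f n)
    (hτ : ∀ n, f n ≫ B.τ n = A.τ n ≫ f n) : A.functor ⟶ B.functor where
  app a := f (CycOb.len a.as)
  naturality := by
    intro a b g
    induction g using Quot.inductionOn with
    | h p => exact word_natural f hδ hσ hτ p

end CocyclicObject

namespace Lam

/-- The tautological cocyclic object of `Λ`. -/
def tautological : CocyclicObject Lam where
  X := ob
  δ := δ
  σ := σ
  τ := τ
  δ_δ n i j h := CategoryTheory.Quotient.sound CycRel (CycRel.δ_δ n i j h)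
  σ_σ n i j h := CategoryTheory.Quotient.sound CycRel (CycRel.σ_σ n i j h)
  δ_σ_self n i := CategoryTheory.Quotient.sound CycRel (CycRel.δ_σ_self n i)
  δ_σ_succ n i := CategoryTheory.Quotient.sound CycRel (CycRel.δ_σ_succ n i)
  σ_δ_le n i j h := CategoryTheory.Quotient.sound CycRel (CycRel.σ_δ_le n i j h)
  σ_δ_gt n i j h := CategoryTheory.Quotient.sound CycRel (CycRel.σ_δ_gt n i j h)
  τ_δ n i := CategoryTheory.Quotient.sound CycRel (CycRel.τ_δ n i)
  δ_last n := CategoryTheory.Quotient.sound CycRel (CycRel.δ_last n)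
  σ_τ n j := CategoryTheory.Quotient.sound CycRel (CycRel.σ_τ n j)
  σ_τ_zero n := CategoryTheory.Quotient.sound CycRel (CycRel.σ_τ_zero n)
  τ_pow n := by
    have h := CategoryTheory.Quotient.sound CycRel (CycRel.τ_pow n)
    rw [map_iter] at h
    exact h.trans (CategoryTheory.Functor.map_id _ _)

end Lam

namespace CocyclicObject

variable {𝒟 : Type u} [Category.{v} 𝒟]

/-- The image of a cocyclic object under a functor. -/
def image {ℰ : Type*} [Category* ℰ] (A : CocyclicObject 𝒟) (F : 𝒟 ⥤ ℰ) : CocyclicObject ℰ where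
  X n := F.obj (A.X n)
  δ n i := F.map (A.δ n i)
  σ n j := F.map (A.σ n j)
  τ n := F.map (A.τ n)
  δ_δ n i j h := by simp only [← F.map_comp, A.δ_δ n i j h]
  σ_σ n i j h := by simp only [← F.map_comp, A.σ_σ n i j h]
  δ_σ_self n i := by simp only [← F.map_comp, A.δ_σ_self n i, F.map_id]
  δ_σ_succ n i := by simp only [← F.map_comp, A.δ_σ_succ n i, F.map_id]
  σ_δ_le n i j h := by simp only [← F.map_comp, A.σ_δ_le n i j h]
  σ_δ_gt n i j h := by simp only [← F.map_comp, A.σ_δ_gt n i j h]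
  τ_δ n i := by simp only [← F.map_comp, A.τ_δ n i]
  δ_last n := by simp only [← F.map_comp, A.δ_last n]
  σ_τ n j := by simp only [← F.map_comp, A.σ_τ n j]
  σ_τ_zero n := by simp only [← F.map_comp, A.σ_τ_zero n]
  τ_pow n := by simp only [← map_iter, A.τ_pow n, F.map_id]

theorem iter_comm {X : 𝒟} (f : X ⟶ X) (m : ℕ) : f ≫ iter f m = iter f m ≫ f := by
  induction m with
  | zero => simp [iter]
  | succ m ih => simp only [iter]; rw [← Category.assoc, ih]

/-- The inverse of the cyclic operator. -/
def τinv (A : CocyclicObject 𝒟) (n : ℕ) : A.X n ⟶ A.X n := iter (A.τ n) n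

theorem τinv_τ (A : CocyclicObject 𝒟) (n : ℕ) : A.τinv n ≫ A.τ n = 𝟙 _ := A.τ_pow n

theorem τ_τinv (A : CocyclicObject 𝒟) (n : ℕ) : A.τ n ≫ A.τinv n = 𝟙 _ :=
  (iter_comm _ _).trans (A.τ_pow n)

theorem δ_τinv (A : CocyclicObject 𝒟) (n : ℕ) (i : Fin (n + 1)) :
    A.δ n i.castSucc ≫ A.τinv (n + 1) = A.τinv n ≫ A.δ n i.succ := by
  calc A.δ n i.castSucc ≫ A.τinv (n + 1)
      = A.τinv n ≫ (A.τ n ≫ A.δ n i.castSucc) ≫ A.τinv (n + 1) := by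
        simp only [← Category.assoc, τinv_τ, Category.id_comp]
    _ = A.τinv n ≫ A.δ n i.succ := by
        rw [A.τ_δ]; simp only [Category.assoc, τ_τinv, Category.comp_id]

theorem δ_last_τinv (A : CocyclicObject 𝒟) (n : ℕ) :
    A.δ n (Fin.last (n + 1)) ≫ A.τinv (n + 1) = A.δ n 0 := by
  rw [A.δ_last, Category.assoc, τ_τinv, Category.comp_id]

theorem σ_τinv (A : CocyclicObject 𝒟) (n : ℕ) (j : Fin n) :
    A.σ n j.castSucc ≫ A.τinv n = A.τinv (n + 1) ≫ A.σ n j.succ := by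
  calc A.σ n j.castSucc ≫ A.τinv n
      = A.τinv (n + 1) ≫ (A.τ (n + 1) ≫ A.σ n j.castSucc) ≫ A.τinv n := by
        simp only [← Category.assoc, τinv_τ, Category.id_comp]
    _ = A.τinv (n + 1) ≫ A.σ n j.succ := by
        rw [← A.σ_τ]; simp only [Category.assoc, τ_τinv, Category.comp_id]

theorem σ_last_τinv (A : CocyclicObject 𝒟) (n : ℕ) :
    A.σ n (Fin.last n) ≫ A.τinv n = A.τinv (n + 1) ≫ A.τinv (n + 1) ≫ A.σ n 0 := by
  calc A.σ n (Fin.last n) ≫ A.τinv n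
      = A.τinv (n + 1) ≫ A.τinv (n + 1) ≫
          (A.τ (n + 1) ≫ A.τ (n + 1) ≫ A.σ n (Fin.last n)) ≫ A.τinv n := by
        simp only [← Category.assoc]
        rw [Category.assoc (A.τinv (n + 1)) (A.τinv (n + 1)) (A.τ (n + 1)), τinv_τ,
          Category.comp_id, τinv_τ, Category.id_comp]
    _ = _ := by
        rw [← A.σ_τ_zero]; simp only [Category.assoc, τ_τinv, Category.comp_id]

/-- The face `dⁿᵢ : [n+1] → [n]`, `0 ≤ i ≤ n+1`, of the cyclic dual: it is `σⁿᵢ` for `i ≤ n`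
and `σⁿ₀ τₙ₊₁⁻¹` for `i = n+1`. -/
def dualFace (A : CocyclicObject 𝒟) (n : ℕ) (i : Fin (n + 2)) : A.X (n + 1) ⟶ A.X n :=
  Fin.lastCases (motive := fun _ => A.X (n + 1) ⟶ A.X n) (A.τinv (n + 1) ≫ A.σ n 0)
    (fun j => A.σ n j) i

theorem dualFace_castSucc (A : CocyclicObject 𝒟) (n : ℕ) (j : Fin (n + 1)) :
    A.dualFace n j.castSucc = A.σ n j := by simp [dualFace]

theorem dualFace_last (A : CocyclicObject 𝒟) (n : ℕ) :
    A.dualFace n (Fin.last (n + 1)) = A.τinv (n + 1) ≫ A.σ n 0 := by simp [dualFace]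

theorem dualFace_zero (A : CocyclicObject 𝒟) (n : ℕ) : A.dualFace n 0 = A.σ n 0 :=
  A.dualFace_castSucc n 0

theorem iter_op {X : 𝒟} (f : X ⟶ X) (m : ℕ) : iter f.op m = (iter f m).op := by
  induction m with
  | zero => rfl
  | succ m ih => rw [iter, ih, iter, ← op_comp, iter_comm]

theorem iter_inverse {X : 𝒟} (f g : X ⟶ X) (h : g ≫ f = 𝟙 X) (m : ℕ) :
    iter g m ≫ iter f m = 𝟙 X := by
  induction m with
  | zero => simp [iter]
  | succ m ih =>
    rw [iter, iter, ← iter_comm f m, Category.assoc, ← Category.assoc g, h, Category.id_comp, ih]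

/-- The cyclic dual of a cocyclic object: its cofaces in the opposite category (that is, the faces
of a cyclic object) are `dualFace`, its degeneracies `sⁿⱼ` are the `∂ⁿⱼ₊₁` with `0 ≤ j ≤ n`, and its
cyclic operators are the `τₙ⁻¹`. -/
def dual (A : CocyclicObject 𝒟) : CocyclicObject 𝒟ᵒᵖ where
  X n := op (A.X n)
  δ n i := (A.dualFace n i).op
  σ n j := (A.δ n j.succ).op
  τ n := (A.τinv n).op
  δ_δ n i j h := by
    rw [← op_comp, ← op_comp]; congr 1
    induction j using Fin.lastCases with
    | last =>
      rw [Fin.succ_last, dualFace_last, dualFace_last, dualFace_castSucc]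
      induction i using Fin.lastCases with
      | last =>
        have h0 := A.σ_σ n 0 0 le_rfl
        rw [dualFace_last, ← Category.assoc, A.σ_last_τinv (n + 1)]
        simp only [Category.assoc]
        rw [show (0 : Fin (n + 2)) = (0 : Fin (n + 1)).castSucc from rfl, h0,
          ← Category.assoc (A.σ (n + 1) _) (A.τinv (n + 1)), A.σ_τinv (n + 1) 0]
        simp only [Category.assoc]
      | cast i =>
        have h0 := A.σ_σ n 0 i (Fin.zero_le _)
        rw [dualFace_castSucc, ← Category.assoc, A.σ_τinv (n + 1) i]
        simp only [Category.assoc]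
        rw [← h0]; rfl
    | cast j =>
      induction i using Fin.lastCases with
      | last =>
      have h2 : n + 1 ≤ (j : ℕ) := h
      have := j.isLt
      omega
      | cast i =>
        rw [← Fin.castSucc_succ]
        simp only [dualFace_castSucc]
        exact A.σ_σ n i j (by simpa using h)
  σ_σ n i j h := by
    rw [← op_comp, ← op_comp]; congr 1
    exact A.δ_δ n i.succ j.succ (by simpa using h)
  δ_σ_self n i := by
    rw [← op_comp, dualFace_castSucc, A.δ_σ_succ]; rfl
  δ_σ_succ n i := by
    rw [← op_comp]
    have : A.δ n i.succ ≫ A.dualFace n i.succ = 𝟙 _ := by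
      induction i using Fin.lastCases with
      | last =>
        rw [Fin.succ_last, dualFace_last, ← Category.assoc, δ_last_τinv]
        exact A.δ_σ_self n 0
      | cast i =>
        rw [← Fin.castSucc_succ, dualFace_castSucc]
        exact A.δ_σ_self n i.succ
    rw [this]; rfl
  σ_δ_le n i j h := by
    rw [← op_comp, ← op_comp]; congr 1
    induction i using Fin.lastCases with
    | last =>
      have h2 : n + 1 ≤ (j : ℕ) := h
      have := j.isLt
      omega
    | cast i =>
      simp only [dualFace_castSucc]
      exact A.σ_δ_gt n j.succ i (Nat.lt_succ_of_le h)
  σ_δ_gt n i j h := by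
    rw [← op_comp, ← op_comp]; congr 1
    induction i using Fin.lastCases with
    | last =>
      rw [Fin.succ_last, dualFace_last, dualFace_last, Fin.succ_castSucc, ← Category.assoc,
        δ_τinv]
      simp only [Category.assoc]
      rw [A.σ_δ_gt n j.succ 0 (by simp [Fin.lt_def])]; rfl
    | cast i =>
      rw [← Fin.castSucc_succ, Fin.succ_castSucc]
      simp only [dualFace_castSucc]
      exact A.σ_δ_le n j.succ i (Nat.succ_le_of_lt h)
  τ_δ n i := by
    rw [← op_comp, ← op_comp]; congr 1
    rw [dualFace_castSucc]
    induction i using Fin.lastCases with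
    | last => rw [Fin.succ_last, dualFace_last, A.σ_last_τinv]
    | cast i => rw [← Fin.castSucc_succ, dualFace_castSucc, A.σ_τinv]
  δ_last n := by
    rw [← op_comp]; congr 1
    rw [dualFace_last, dualFace_zero]
  σ_τ n j := by
    rw [← op_comp, ← op_comp]; congr 1
    rw [Fin.succ_castSucc, δ_τinv]
  σ_τ_zero n := by
    rw [← op_comp, ← op_comp, ← op_comp]; congr 1
    rw [Fin.succ_last]
    erw [δ_last_τinv]
    exact (A.δ_τinv n 0).symm
  τ_pow n := by
    rw [iter_op]
    have h1 := iter_inverse (A.τ n) (A.τinv n) (A.τinv_τ n) (n + 1)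
    rw [A.τ_pow, Category.comp_id] at h1
    rw [h1]; rfl

end CocyclicObject

/-! ## Cyclic cohomology: the cyclic double complex -/

section SignSums

theorem alternating_double_sum {k V : Type*} [CommRing k] [AddCommGroup V] [Module k V] (m : ℕ)
    (g : Fin (m + 1) → Fin m → V)
    (hg : ∀ i j : Fin m, i ≤ j → g i.castSucc j = g j.succ i) :
    ∑ i : Fin (m + 1), ∑ j : Fin m, (-1 : k) ^ (i : ℕ) • (-1 : k) ^ (j : ℕ) • g i j = 0 := by
  rw [← Fintype.sum_prod_type']
  refine Finset.sum_involution
    (fun p _ => if h : p.1 ≤ p.2.castSucc then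
        (p.2.succ, ⟨p.1, lt_of_le_of_lt (Fin.le_def.1 h) p.2.isLt⟩)
      else (p.2.castSucc, p.1.pred (fun h0 => h (by rw [h0]; exact Fin.zero_le _)))) ?_ ?_ ?_ ?_
  · rintro ⟨i, j⟩ -
    by_cases h : i ≤ j.castSucc
    · have hi : (i : ℕ) ≤ j := h
      have e := hg ⟨i, lt_of_le_of_lt hi j.isLt⟩ j hi
      have e' : g i j = g j.succ ⟨i, lt_of_le_of_lt hi j.isLt⟩ := e
      simp only [h, dif_pos, e', Fin.val_succ, smul_smul, ← pow_add, ← add_smul]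
      rw [show (j : ℕ) + 1 + i = (i + j) + 1 by ring, pow_succ]
      simp
    · have hi : (j : ℕ) < i := not_le.1 h
      have hi0 : i ≠ 0 := fun h0 => h (by rw [h0]; exact Fin.zero_le _)
      have e := hg j (i.pred hi0) (by
        rw [Fin.le_def, Fin.val_pred]; omega)
      rw [Fin.succ_pred] at e
      simp only [h, dif_neg, not_false_iff, e, Fin.val_castSucc, Fin.val_pred, smul_smul,
        ← pow_add, ← add_smul]
      obtain ⟨t, ht⟩ : ∃ t, (i : ℕ) = t + 1 := ⟨i - 1, by omega⟩
      rw [show (i : ℕ) + j = (j + (i - 1)) + 1 by omega, pow_succ]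
      simp
  · rintro ⟨i, j⟩ - -
    by_cases h : i ≤ j.castSucc
    · have hi : (i : ℕ) ≤ j := h
      simp only [h, dif_pos, ne_eq, Prod.mk.injEq, not_and]
      intro h1
      exact absurd (congrArg Fin.val h1) (by simp; omega)
    · have hi : (j : ℕ) < i := not_le.1 h
      simp only [h, dif_neg, not_false_iff, ne_eq, Prod.mk.injEq, not_and]
      intro h1
      exact absurd (congrArg Fin.val h1) (by simp; omega)
  · intro a _
    exact Finset.mem_univ _
  · rintro ⟨i, j⟩ -
    by_cases h : i ≤ j.castSucc
    · have hi : (i : ℕ) ≤ j := h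
      have h2 : ¬ (j.succ ≤ (⟨i, lt_of_le_of_lt hi j.isLt⟩ : Fin m).castSucc) := by
        rw [Fin.le_def]; simp; omega
      simp only [h, dif_pos, h2, dif_neg, not_false_iff]
      rfl
    · have hi : (j : ℕ) < i := not_le.1 h
      have hi0 : i ≠ 0 := fun h0 => h (by rw [h0]; exact Fin.zero_le _)
      have h2 : j.castSucc ≤ (i.pred hi0).castSucc := by
        rw [Fin.le_def]; simp; omega
      simp only [h, dif_pos, h2, dif_neg, not_false_iff, Fin.succ_pred]
      rfl

theorem geom_rotation {R : Type*} [Ring R] (E : R) (m : ℕ) (hE : E ^ (m + 1) = 1) :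
    (∑ a ∈ Finset.range (m + 1), E ^ a) * E = ∑ a ∈ Finset.range (m + 1), E ^ a := by
  have := geom_sum_mul E (m + 1)
  rw [hE, sub_self, mul_sub, mul_one, sub_eq_zero] at this
  exact this

theorem linear_comp_sum {k V V' V'' ι : Type*} [CommRing k] [AddCommGroup V] [Module k V]
    [AddCommGroup V'] [Module k V'] [AddCommGroup V''] [Module k V''] (s : Finset ι)
    (f : ι → V →ₗ[k] V') (g : V' →ₗ[k] V'') : g ∘ₗ (∑ i ∈ s, f i) = ∑ i ∈ s, g ∘ₗ f i :=
  LinearMap.ext fun x => by simp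

theorem linear_sum_comp {k V V' V'' ι : Type*} [CommRing k] [AddCommGroup V] [Module k V]
    [AddCommGroup V'] [Module k V'] [AddCommGroup V''] [Module k V''] (s : Finset ι)
    (f : V →ₗ[k] V') (g : ι → V' →ₗ[k] V'') : (∑ i ∈ s, g i) ∘ₗ f = ∑ i ∈ s, g i ∘ₗ f :=
  LinearMap.ext fun x => by simp

theorem norm_rotation {k V V' : Type*} [CommRing k] [AddCommGroup V] [Module k V]
    [AddCommGroup V'] [Module k V'] (n : ℕ) (L : Module.End k V) (L' : Module.End k V')
    (D : ℕ → V →ₗ[k] V') (hD : ∀ j ≤ n, D j ∘ₗ L = L' ∘ₗ D (j + 1))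
    (hL : L ^ (n + 1) = 1) (hL' : L' ^ (n + 2) = 1) :
    (∑ j ∈ Finset.range (n + 2), D j) ∘ₗ (∑ i ∈ Finset.range (n + 1), L ^ i) =
      (∑ a ∈ Finset.range (n + 2), L' ^ a) ∘ₗ (∑ l ∈ Finset.range (n + 1), D l) := by
  have key : ∀ j ≤ n + 1, (L' ^ j) ∘ₗ D j = D 0 ∘ₗ (L ^ j) := by
    intro j
    induction j with
    | zero => intro _; rfl
    | succ j ih =>
      intro hj
      have h1 := hD j (by omega)
      have h2 := ih (by omega)
      rw [pow_succ, pow_succ, Module.End.mul_eq_comp, Module.End.mul_eq_comp,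
        LinearMap.comp_assoc, ← h1, ← LinearMap.comp_assoc, h2, LinearMap.comp_assoc]
  have hN1 : ∀ j, (∑ a ∈ Finset.range (n + 2), L' ^ a) * L' ^ j =
      ∑ a ∈ Finset.range (n + 2), L' ^ a := by
    intro j
    induction j with
    | zero => simp
    | succ j ih => rw [pow_succ, ← mul_assoc, ih, geom_rotation L' (n + 1) hL']
  have hN0 : ∀ j, L ^ j * (∑ a ∈ Finset.range (n + 1), L ^ a) =
      ∑ a ∈ Finset.range (n + 1), L ^ a := by
    intro j
    have h1 : Commute (L ^ j) (∑ a ∈ Finset.range (n + 1), L ^ a) :=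
      Commute.sum_right _ _ _ fun a _ => (Commute.refl L).pow_pow j a
    rw [h1.eq]
    clear h1
    induction j with
    | zero => simp
    | succ j ih => rw [pow_succ, ← mul_assoc, ih, geom_rotation L n hL]
  have hr : (∑ a ∈ Finset.range (n + 2), L' ^ a) ∘ₗ (∑ l ∈ Finset.range (n + 1), D l) =
      (∑ a ∈ Finset.range (n + 2), L' ^ a) ∘ₗ D 0 ∘ₗ (∑ a ∈ Finset.range (n + 1), L ^ a) := by
    rw [linear_comp_sum, linear_comp_sum, linear_comp_sum]
    refine Finset.sum_congr rfl fun l hl => ?_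
    rw [← key l (by have := Finset.mem_range.1 hl; omega), ← LinearMap.comp_assoc,
      ← Module.End.mul_eq_comp, hN1]
  have hl : ∀ j ∈ Finset.range (n + 2), D j ∘ₗ (∑ i ∈ Finset.range (n + 1), L ^ i) =
      (L' ^ (n + 1 - j) * L') ∘ₗ D 0 ∘ₗ (∑ a ∈ Finset.range (n + 1), L ^ a) := by
    intro j hj
    have hj' : j ≤ n + 1 := by have := Finset.mem_range.1 hj; omega
    have h1 : (L' ^ (n + 1 - j) * L') * L' ^ j = 1 := by
      rw [← pow_succ, ← pow_add, show n + 1 - j + 1 + j = n + 2 by omega, hL']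
    calc D j ∘ₗ (∑ i ∈ Finset.range (n + 1), L ^ i)
        = ((L' ^ (n + 1 - j) * L') * L' ^ j) ∘ₗ D j ∘ₗ (∑ i ∈ Finset.range (n + 1), L ^ i) := by
          rw [h1]; rfl
      _ = (L' ^ (n + 1 - j) * L') ∘ₗ ((L' ^ j) ∘ₗ D j) ∘ₗ
            (∑ i ∈ Finset.range (n + 1), L ^ i) := rfl
      _ = _ := by
          rw [key j hj', LinearMap.comp_assoc, ← Module.End.mul_eq_comp (L ^ j), hN0]
  rw [hr, linear_sum_comp, Finset.sum_congr rfl hl, ← linear_sum_comp]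
  congr 1
  rw [← Finset.sum_mul]
  have h2 := Finset.sum_range_reflect (fun a => L' ^ a) (n + 2)
  rw [show n + 2 - 1 = n + 1 from rfl] at h2
  rw [h2, geom_rotation L' (n + 1) hL']

end SignSums

section Complex

variable {k : Type u} [Field k] (A : CocyclicObject (ModuleCat.{u} k))

/-- `b = ∑_{i=0}^{n+1} (-1)ⁱ ∂ᵢ`. -/
def bMap (n : ℕ) : A.X n →ₗ[k] A.X (n + 1) :=
  ∑ i : Fin (n + 2), (-1 : k) ^ (i : ℕ) • (A.δ n i).hom

/-- `b' = ∑_{i=0}^{n} (-1)ⁱ ∂ᵢ`. -/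
def bMap' (n : ℕ) : A.X n →ₗ[k] A.X (n + 1) :=
  ∑ i : Fin (n + 1), (-1 : k) ^ (i : ℕ) • (A.δ n i.castSucc).hom

/-- The signed cyclic operator `λₙ = (-1)ⁿ τₙ`. -/
def lamMap (n : ℕ) : Module.End k (A.X n) := (-1 : k) ^ n • (A.τ n).hom

/-- The norm operator `N = 1 + λₙ + ⋯ + λₙⁿ`. -/
def normMap (n : ℕ) : Module.End k (A.X n) := ∑ i ∈ Finset.range (n + 1), lamMap A n ^ i

/-- The vertical differential of the `p`-th column: `b` if `p` is even, `-b'` if `p` is odd. -/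
def vert (p q : ℕ) : A.X q →ₗ[k] A.X (q + 1) := if Even p then bMap A q else -bMap' A q

/-- The horizontal differential from column `p` to column `p + 1` in row `q`: `1 - λ` if `p` is
even, `N` if `p` is odd. -/
def horiz (p q : ℕ) : A.X q →ₗ[k] A.X q := if Even p then 1 - lamMap A q else normMap A q

/-- The degree `n` part `⨁_{p + q = n} A_q` of the total complex of the cyclic double complex;
the entry with index `q` lies in column `n - q`. -/
abbrev Tot (n : ℕ) : Type u := ∀ q : Fin (n + 1), A.X q

/-- The total differential. -/
def totD (n : ℕ) : Tot A n →ₗ[k] Tot A (n + 1) :=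
  LinearMap.pi fun q =>
    match q with
    | ⟨0, _⟩ => horiz A n 0 ∘ₗ LinearMap.proj (0 : Fin (n + 1))
    | ⟨r + 1, h⟩ =>
        vert A (n - r) r ∘ₗ LinearMap.proj (⟨r, Nat.lt_of_succ_lt_succ h⟩ : Fin (n + 1)) +
          if h' : r + 1 < n + 1 then
            horiz A (n - (r + 1)) (r + 1) ∘ₗ LinearMap.proj (⟨r + 1, h'⟩ : Fin (n + 1))
          else 0

theorem iter_hom {X : ModuleCat.{u} k} (f : X ⟶ X) (m : ℕ) :
    (iter f m).hom = (f.hom : Module.End k X) ^ m := by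
  induction m with
  | zero => rfl
  | succ m ih => rw [iter, ModuleCat.hom_comp, ih, pow_succ', Module.End.mul_eq_comp]

theorem lamMap_pow (n : ℕ) : lamMap A n ^ (n + 1) = 1 := by
  have h := congrArg ModuleCat.Hom.hom (A.τ_pow n)
  rw [iter_hom] at h
  rw [lamMap, smul_pow, h, ← pow_mul, (Nat.even_mul_succ_self n).neg_one_pow, one_smul]
  rfl

theorem bMap_bMap (n : ℕ) : bMap A (n + 1) ∘ₗ bMap A n = 0 := by
  rw [bMap, bMap, linear_sum_comp]
  simp only [linear_comp_sum, LinearMap.smul_comp, LinearMap.comp_smul]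
  have hg : ∀ i j : Fin (n + 2), i ≤ j → (A.δ (n + 1) i.castSucc).hom ∘ₗ (A.δ n j).hom =
      (A.δ (n + 1) j.succ).hom ∘ₗ (A.δ n i).hom := fun i j h => by
    rw [← ModuleCat.hom_comp, ← ModuleCat.hom_comp, A.δ_δ n i j h]
  refine (Finset.sum_congr rfl fun i _ => Finset.sum_congr rfl fun j _ => smul_comm _ _ _).trans ?_
  exact alternating_double_sum (k := k) (n + 2)
    (fun (i : Fin (n + 1 + 2)) (j : Fin (n + 2)) => (A.δ (n + 1) i).hom ∘ₗ (A.δ n j).hom) hg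

theorem bMap'_bMap' (n : ℕ) : bMap' A (n + 1) ∘ₗ bMap' A n = 0 := by
  rw [bMap', bMap', linear_sum_comp]
  simp only [linear_comp_sum, LinearMap.smul_comp, LinearMap.comp_smul]
  have hg : ∀ i j : Fin (n + 1), i ≤ j →
      (A.δ (n + 1) i.castSucc.castSucc).hom ∘ₗ (A.δ n j.castSucc).hom =
      (A.δ (n + 1) j.succ.castSucc).hom ∘ₗ (A.δ n i.castSucc).hom := fun i j h => by
    rw [← ModuleCat.hom_comp, ← ModuleCat.hom_comp, A.δ_δ n i.castSucc j.castSucc h]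
    rfl
  refine (Finset.sum_congr rfl fun i _ => Finset.sum_congr rfl fun j _ => smul_comm _ _ _).trans ?_
  exact alternating_double_sum (k := k) (n + 1)
    (fun (i : Fin (n + 1 + 1)) (j : Fin (n + 1)) =>
      (A.δ (n + 1) i.castSucc).hom ∘ₗ (A.δ n j.castSucc).hom) hg

/-- The signed cofaces, indexed by natural numbers and extended by zero. -/
def signedFace (n j : ℕ) : A.X n →ₗ[k] A.X (n + 1) :=
  if h : j < n + 2 then (-1 : k) ^ j • (A.δ n ⟨j, h⟩).hom else 0

theorem bMap_eq (n : ℕ) : bMap A n = ∑ j ∈ Finset.range (n + 2), signedFace A n j := by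
  rw [Finset.sum_range, bMap]
  refine Finset.sum_congr rfl fun i _ => ?_
  simp [signedFace]

theorem bMap'_eq (n : ℕ) : bMap' A n = ∑ j ∈ Finset.range (n + 1), signedFace A n j := by
  rw [Finset.sum_range, bMap']
  refine Finset.sum_congr rfl fun i _ => ?_
  have : (i : ℕ) < n + 2 := by omega
  simp only [signedFace, this, dif_pos]
  rfl

theorem signedFace_lam (n j : ℕ) (hj : j ≤ n) :
    signedFace A n j ∘ₗ lamMap A n = lamMap A (n + 1) ∘ₗ signedFace A n (j + 1) := by
  have h := congrArg ModuleCat.Hom.hom (A.τ_δ n ⟨j, by omega⟩)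
  simp only [ModuleCat.hom_comp] at h
  have h1 : j < n + 2 := by omega
  have h2 : j + 1 < n + 2 := by omega
  simp only [signedFace, h1, h2, dif_pos, lamMap]
  rw [LinearMap.smul_comp, LinearMap.comp_smul, LinearMap.smul_comp, LinearMap.comp_smul]
  change _ • _ • ((A.δ n (Fin.castSucc ⟨j, by omega⟩)).hom ∘ₗ (A.τ n).hom) = _ • _ •
    ((A.τ (n + 1)).hom ∘ₗ (A.δ n (Fin.succ ⟨j, by omega⟩)).hom)
  rw [h, smul_smul, smul_smul, ← pow_add, ← pow_add]
  congr 1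
  rw [show n + 1 + (j + 1) = (j + n) + 2 by ring, pow_add _ (j + n) 2]
  simp

theorem signedFace_last (n : ℕ) :
    signedFace A n (n + 1) = lamMap A (n + 1) ∘ₗ signedFace A n 0 := by
  have h := congrArg ModuleCat.Hom.hom (A.δ_last n)
  simp only [ModuleCat.hom_comp] at h
  have h2 : n + 1 < n + 2 := by omega
  simp only [signedFace, h2, dif_pos, lamMap, Nat.zero_lt_succ, pow_zero, one_smul,
    LinearMap.smul_comp]
  congr 1

theorem lam_b (n : ℕ) :
    (1 - lamMap A (n + 1)) ∘ₗ bMap A n = bMap' A n ∘ₗ (1 - lamMap A n) := by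
  have h1 : lamMap A (n + 1) ∘ₗ bMap A n = signedFace A n (n + 1) + bMap' A n ∘ₗ lamMap A n := by
    rw [bMap_eq, bMap'_eq, Finset.sum_range_succ', LinearMap.comp_add, linear_comp_sum,
      linear_sum_comp, ← signedFace_last]
    refine (add_comm _ _).trans (congrArg _ (Finset.sum_congr rfl fun j hj => ?_))
    rw [signedFace_lam A n j (by have := Finset.mem_range.1 hj; omega)]
  have h2 : bMap A n = bMap' A n + signedFace A n (n + 1) := by
    rw [bMap_eq, bMap'_eq, Finset.sum_range_succ]
  rw [LinearMap.sub_comp, LinearMap.comp_sub, h1, Module.End.one_eq_id, LinearMap.id_comp,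
    Module.End.one_eq_id, LinearMap.comp_id]
  nth_rewrite 1 [h2]
  abel

theorem norm_b' (n : ℕ) : normMap A (n + 1) ∘ₗ bMap' A n = bMap A n ∘ₗ normMap A n := by
  rw [bMap_eq, bMap'_eq]
  exact (norm_rotation n _ _ (signedFace A n) (fun j hj => signedFace_lam A n j hj)
    (lamMap_pow A n) (lamMap_pow A (n + 1))).symm

theorem horiz_horiz (p q : ℕ) : horiz A (p + 1) q ∘ₗ horiz A p q = 0 := by
  have h1 := geom_sum_mul_neg (lamMap A q) (q + 1)
  have h2 := mul_neg_geom_sum (lamMap A q) (q + 1)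
  rw [lamMap_pow, sub_self] at h1 h2
  by_cases hp : Even p
  · simp only [horiz, hp, if_true, Nat.even_add_one, not_true, if_false]
    exact h1
  · simp only [horiz, hp, if_false, Nat.even_add_one, not_false_iff, if_true]
    exact h2

theorem vert_vert (p q : ℕ) : vert A p (q + 1) ∘ₗ vert A p q = 0 := by
  by_cases hp : Even p
  · simp only [vert, hp, if_true, bMap_bMap]
  · simp only [vert, hp, if_false, LinearMap.neg_comp, LinearMap.comp_neg, bMap'_bMap', neg_zero]

theorem vert_horiz (p q : ℕ) :
    vert A (p + 1) q ∘ₗ horiz A p q + horiz A p (q + 1) ∘ₗ vert A p q = 0 := by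
  by_cases hp : Even p
  · simp only [vert, horiz, hp, if_true, Nat.even_add_one, not_true, if_false, LinearMap.neg_comp,
      lam_b, neg_add_cancel]
  · simp only [vert, horiz, hp, if_false, Nat.even_add_one, not_false_iff, if_true,
      LinearMap.comp_neg, norm_b', add_neg_cancel]

theorem totD_zero (n : ℕ) (y : Tot A n) : totD A n y 0 = horiz A n 0 (y 0) := rfl

theorem totD_succ (n r : ℕ) (h : r + 1 < n + 1) (y : Tot A n) :
    totD A n y ⟨r + 1, by omega⟩ = vert A (n - r) r (y ⟨r, by omega⟩) +
      horiz A (n - (r + 1)) (r + 1) (y ⟨r + 1, h⟩) := by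
  change (vert A (n - r) r ∘ₗ LinearMap.proj (⟨r, by omega⟩ : Fin (n + 1)) +
    dite _ _ _ : (∀ q : Fin (n + 1), A.X q) →ₗ[k] A.X (r + 1)) y = _
  rw [dif_pos h]
  rfl

theorem totD_last (n : ℕ) (y : Tot A n) :
    totD A n y ⟨n + 1, by omega⟩ = vert A 0 n (y ⟨n, by omega⟩) := by
  change (vert A (n - n) n ∘ₗ LinearMap.proj (⟨n, by omega⟩ : Fin (n + 1)) +
    dite _ _ _ : (∀ q : Fin (n + 1), A.X q) →ₗ[k] A.X (n + 1)) y = _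
  rw [dif_neg (lt_irrefl _), add_zero, Nat.sub_self]
  rfl

theorem totD_totD (n : ℕ) : totD A (n + 1) ∘ₗ totD A n = 0 := by
  have hh : ∀ p q x, horiz A (p + 1) q (horiz A p q x) = 0 := fun p q x =>
    LinearMap.congr_fun (horiz_horiz A p q) x
  have vv : ∀ p q x, vert A p (q + 1) (vert A p q x) = 0 := fun p q x =>
    LinearMap.congr_fun (vert_vert A p q) x
  have vh : ∀ p q x, vert A (p + 1) q (horiz A p q x) + horiz A p (q + 1) (vert A p q x) = 0 :=
    fun p q x => LinearMap.congr_fun (vert_horiz A p q) x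
  refine LinearMap.ext fun y => funext fun q => ?_
  obtain ⟨q, hq⟩ := q
  rw [LinearMap.comp_apply]
  cases q with
  | zero =>
    refine (totD_zero A (n + 1) _).trans ?_
    rw [totD_zero]
    exact hh n 0 _
  | succ r =>
    rcases Nat.lt_or_ge (r + 1) (n + 2) with h1 | h1
    · rw [totD_succ A (n + 1) r h1]
      have hA : vert A (n + 1 - r) r (totD A n y ⟨r, by omega⟩) =
          vert A (n - r + 1) r (horiz A (n - r) r (y ⟨r, by omega⟩)) := by
        cases r with
        | zero => rfl
        | succ r =>
          rw [totD_succ A n r (by omega), map_add,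
            show n - r = n + 1 - (r + 1) by omega, vv, zero_add,
            show n + 1 - (r + 1) = n - (r + 1) + 1 by omega]
      have hB : horiz A (n + 1 - (r + 1)) (r + 1) (totD A n y ⟨r + 1, h1⟩) =
          horiz A (n - r) (r + 1) (vert A (n - r) r (y ⟨r, by omega⟩)) := by
        rcases Nat.lt_or_ge (r + 1) (n + 1) with h2 | h2
        · rw [totD_succ A n r h2, map_add, show n + 1 - (r + 1) = n - (r + 1) + 1 by omega, hh,
            add_zero, show n - (r + 1) + 1 = n - r by omega]
        · obtain rfl : r = n := by omega
          rw [totD_last, show r + 1 - (r + 1) = r - r by omega, Nat.sub_self]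
      rw [hA, hB]
      exact vh (n - r) r _
    · obtain rfl : r = n + 1 := by omega
      rw [totD_last, totD_last]
      exact vv 0 n _

end Complex

/-! ## Cocyclic and cyclic `k`-modules and their cyclic cohomology -/

/-- The category of cocyclic `k`-modules. -/
abbrev CocyclicMod (k : Type u) [Field k] : Type (u + 1) := Lam ⥤ ModuleCat.{u} k

/-- The category of cyclic `k`-modules. -/
abbrev CyclicMod (k : Type u) [Field k] : Type (u + 1) := Lamᵒᵖ ⥤ ModuleCat.{u} k

instance (k : Type u) [Field k] : HasExt.{u + 1} (CocyclicMod k) := HasExt.standard _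

section Cohomology

variable {k : Type u} [Field k]

/-- The operators of a cocyclic `k`-module. -/
def CocyclicMod.operators (Y : CocyclicMod k) : CocyclicObject (ModuleCat.{u} k) :=
  Lam.tautological.image Y

/-- The total complex of the cyclic double complex of a cocyclic `k`-module. -/
def totComplex (Y : CocyclicMod k) : CochainComplex (ModuleCat.{u} k) ℕ :=
  CochainComplex.of (fun n => ModuleCat.of k (Tot Y.operators n))
    (fun n => ModuleCat.ofHom (totD Y.operators n))
    (fun n => by rw [← ModuleCat.ofHom_comp, totD_totD]; rfl)

/-- The component of a morphism of cocyclic `k`-modules in degree `q`. -/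
def component {Y Z : CocyclicMod k} (f : Y ⟶ Z) (q : ℕ) :
    Y.operators.X q →ₗ[k] Z.operators.X q := (f.app (Lam.ob q)).hom

/-- The map of total complexes in degree `n`, entry by entry. -/
def totMap {Y Z : CocyclicMod k} (f : Y ⟶ Z) (n : ℕ) :
    Tot Y.operators n →ₗ[k] Tot Z.operators n :=
  LinearMap.pi fun q => component f q ∘ₗ LinearMap.proj (q : Fin (n + 1))

theorem component_δ {Y Z : CocyclicMod k} (f : Y ⟶ Z) (q : ℕ) (i : Fin (q + 2))
    (y : Y.operators.X q) : component f (q + 1) ((Y.operators.δ q i).hom y) =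
      (Z.operators.δ q i).hom (component f q y) :=
  LinearMap.congr_fun (congrArg ModuleCat.Hom.hom (f.naturality (Lam.δ q i))) y

theorem component_τ {Y Z : CocyclicMod k} (f : Y ⟶ Z) (q : ℕ)
    (y : Y.operators.X q) : component f q ((Y.operators.τ q).hom y) =
      (Z.operators.τ q).hom (component f q y) :=
  LinearMap.congr_fun (congrArg ModuleCat.Hom.hom (f.naturality (Lam.τ q))) y

theorem app_bMap {Y Z : CocyclicMod k} (f : Y ⟶ Z) (q : ℕ) (y : Y.operators.X q) :
    component f (q + 1) (bMap Y.operators q y) =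
      bMap Z.operators q (component f q y) := by
  rw [bMap, bMap, LinearMap.sum_apply, LinearMap.sum_apply]
  refine (map_sum _ _ _).trans (Finset.sum_congr rfl fun i _ => ?_)
  exact (map_smul (component f (q + 1)) _ _).trans
    (congrArg _ (component_δ f q i y))

theorem app_bMap' {Y Z : CocyclicMod k} (f : Y ⟶ Z) (q : ℕ) (y : Y.operators.X q) :
    component f (q + 1) (bMap' Y.operators q y) =
      bMap' Z.operators q (component f q y) := by
  rw [bMap', bMap', LinearMap.sum_apply, LinearMap.sum_apply]
  refine (map_sum _ _ _).trans (Finset.sum_congr rfl fun i _ => ?_)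
  exact (map_smul (component f (q + 1)) _ _).trans
    (congrArg _ (component_δ f q i.castSucc y))

theorem app_lamMap {Y Z : CocyclicMod k} (f : Y ⟶ Z) (q : ℕ) (y : Y.operators.X q) :
    component f q (lamMap Y.operators q y) =
      lamMap Z.operators q (component f q y) :=
  (map_smul (component f q) _ _).trans (congrArg _ (component_τ f q y))

theorem app_lamMap_pow {Y Z : CocyclicMod k} (f : Y ⟶ Z) (q i : ℕ) (y : Y.operators.X q) :
    component f q ((lamMap Y.operators q ^ i) y) =
      (lamMap Z.operators q ^ i) (component f q y) := by
  induction i with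
  | zero => rfl
  | succ i ih =>
    rw [pow_succ', pow_succ', Module.End.mul_apply, Module.End.mul_apply, ← ih]
    exact app_lamMap f q _

theorem app_normMap {Y Z : CocyclicMod k} (f : Y ⟶ Z) (q : ℕ) (y : Y.operators.X q) :
    component f q (normMap Y.operators q y) =
      normMap Z.operators q (component f q y) := by
  rw [normMap, normMap, LinearMap.sum_apply, LinearMap.sum_apply]
  exact (map_sum _ _ _).trans (Finset.sum_congr rfl fun i _ => app_lamMap_pow f q i y)

theorem app_vert {Y Z : CocyclicMod k} (f : Y ⟶ Z) (p q : ℕ) (y : Y.operators.X q) :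
    component f (q + 1) (vert Y.operators p q y) =
      vert Z.operators p q (component f q y) := by
  by_cases hp : Even p
  · simp only [vert, hp, if_true]
    exact app_bMap f q y
  · simp only [vert, hp, if_false]
    exact (map_neg (component f (q + 1)) _).trans (congrArg _ (app_bMap' f q y))

theorem app_horiz {Y Z : CocyclicMod k} (f : Y ⟶ Z) (p q : ℕ) (y : Y.operators.X q) :
    component f q (horiz Y.operators p q y) =
      horiz Z.operators p q (component f q y) := by
  by_cases hp : Even p
  · simp only [horiz, hp, if_true]
    exact (map_sub (component f q) _ _).trans (congrArg _ (app_lamMap f q y))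
  · simp only [horiz, hp, if_false]
    exact app_normMap f q y

theorem totMap_totD {Y Z : CocyclicMod k} (f : Y ⟶ Z) (n : ℕ) :
    totD Z.operators n ∘ₗ totMap f n = totMap f (n + 1) ∘ₗ totD Y.operators n := by
  refine LinearMap.ext fun y => funext fun q => ?_
  obtain ⟨q, hq⟩ := q
  rw [LinearMap.comp_apply, LinearMap.comp_apply]
  change _ = component f q (totD Y.operators n y ⟨q, hq⟩)
  cases q with
  | zero => exact (app_horiz f n 0 (y 0)).symm
  | succ r =>
    rcases Nat.lt_or_ge (r + 1) (n + 1) with h | h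
    · rw [totD_succ _ n r h, totD_succ _ n r h]
      refine Eq.symm ((map_add (component f (r + 1)) _ _).trans ?_)
      exact congrArg₂ _ (app_vert f (n - r) r _) (app_horiz f (n - (r + 1)) (r + 1) _)
    · obtain rfl : r = n := by omega
      rw [totD_last, totD_last]
      exact (app_vert f 0 r _).symm

/-- The total complex of the cyclic double complex as a functor. -/
def totFunctor (k : Type u) [Field k] : CocyclicMod k ⥤ CochainComplex (ModuleCat.{u} k) ℕ where
  obj Y := totComplex Y
  map {Y Z} f := CochainComplex.ofHom (X := totComplex Y) (Y := totComplex Z)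
    (fun n => ModuleCat.ofHom (totMap f n)) (fun n => by
      simp only [totComplex, CochainComplex.of_d]
      rw [← ModuleCat.ofHom_comp, ← ModuleCat.ofHom_comp, totMap_totD])
  map_id Y := by
    refine HomologicalComplex.hom_ext _ _ fun n => ?_
    refine ModuleCat.hom_ext (LinearMap.ext fun y => funext fun q => ?_)
    rfl
  map_comp f g := by
    refine HomologicalComplex.hom_ext _ _ fun n => ?_
    refine ModuleCat.hom_ext (LinearMap.ext fun y => funext fun q => ?_)
    rfl

/-- The cyclic cohomology `HCⁿ(Y)` of a cocyclic `k`-module. -/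
noncomputable def HC (k : Type u) [Field k] (n : ℕ) : CocyclicMod k ⥤ ModuleCat.{u} k :=
  totFunctor k ⋙ HomologicalComplex.homologyFunctor (ModuleCat.{u} k) (ComplexShape.up ℕ) n

/-- The cocyclic `k`-module `[n] ↦ Hom_k(X_n, k)` of a cyclic `k`-module `X`. -/
def linearDual (k : Type u) [Field k] : (CyclicMod k)ᵒᵖ ⥤ CocyclicMod k :=
  (Functor.leftOpRightOpEquiv Lam (ModuleCat.{u} k)).functor ⋙
    (Functor.whiskeringRight Lam (ModuleCat.{u} k)ᵒᵖ (ModuleCat.{u} k)).obj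
      ((linearYoneda k (ModuleCat.{u} k)).obj (ModuleCat.of k k))

/-- The cyclic cohomology `HCⁿ(X)` of a cyclic `k`-module: the cohomology of the `k`-linear dual
of its cyclic double complex. -/
noncomputable def HCcyc (k : Type u) [Field k] (n : ℕ) : (CyclicMod k)ᵒᵖ ⥤ ModuleCat.{u} k :=
  linearDual k ⋙ HC k n

/-- Connes' duality functor `Λᵒᵖ ⥤ Λ`. -/
def duality : Lamᵒᵖ ⥤ Lam := (Lam.tautological.dual.functor).leftOp

/-- The cyclic dual `Y ↦ Y^∨` of cocyclic `k`-modules: the same modules, with faces `σⁿᵢ`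
(and `σⁿ₀ τₙ₊₁⁻¹`), degeneracies `∂ⁿⱼ₊₁` and cyclic operators `τₙ⁻¹`. -/
def cyclicDual (k : Type u) [Field k] : CocyclicMod k ⥤ CyclicMod k :=
  (Functor.whiskeringLeft Lamᵒᵖ Lam (ModuleCat.{u} k)).obj duality

end Cohomology

/-! ## Module coalgebras and module/comodules over a bialgebra -/

open scoped TensorProduct

section Structures

variable (k : Type u) [Field k] (H : Type v) [Ring H] [Bialgebra k H]

/-- The representation `H → End_k(V)` of an `H`-module `V`. -/
def rep (V : Type w) [AddCommGroup V] [Module k V] [Module H V] [IsScalarTower k H V] :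
    H →ₐ[k] Module.End k V := Algebra.lsmul k k V

variable {k H}

/-- The diagonal action `h (v ⊗ w) = h₍₁₎ v ⊗ h₍₂₎ w` on a tensor product. -/
def tensorRep {V W : Type*} [AddCommGroup V] [Module k V] [AddCommGroup W] [Module k W]
    (ρ : H →ₐ[k] Module.End k V) (ρ' : H →ₐ[k] Module.End k W) :
    H →ₐ[k] Module.End k (V ⊗[k] W) :=
  (Module.endTensorEndAlgHom (R := k) (S := k) (A := k)).comp
    ((Algebra.TensorProduct.map ρ ρ').comp (Bialgebra.comulAlgHom k H))

variable (k H)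

/-- Left `H`-module coalgebras: `H` acts such that comultiplication and counit are `H`-linear. -/
class ModuleCoalgebra (C : Type w) [AddCommGroup C] [Module k C] [Coalgebra k C] [Module H C]
    [IsScalarTower k H C] : Prop where
  comul_smul : ∀ (h : H) (c : C), Coalgebra.comul (R := k) (h • c) =
    tensorRep (rep k H C) (rep k H C) h (Coalgebra.comul (R := k) c)
  counit_smul : ∀ (h : H) (c : C), Coalgebra.counit (R := k) (h • c) =
    Coalgebra.counit (R := k) h * Coalgebra.counit (R := k) c

/-- Left `H`-comodules, with coaction `m ↦ m₍₋₁₎ ⊗ m₍₀₎`. -/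
class LeftComodule (M : Type w) [AddCommGroup M] [Module k M] where
  coact : M →ₗ[k] H ⊗[k] M
  coassoc : ∀ m : M, TensorProduct.assoc k H H M ((Coalgebra.comul (R := k)).rTensor M (coact m)) =
    coact.lTensor H (coact m)
  counit_coact : ∀ m : M,
    TensorProduct.lid k M ((Coalgebra.counit (R := k)).rTensor M (coact m)) = m

/-- The action map `H ⊗ V → V`. -/
def actMap (V : Type w) [AddCommGroup V] [Module k V] [Module H V] [IsScalarTower k H V] :
    H ⊗[k] V →ₗ[k] V := TensorProduct.lift (rep k H V).toLinearMap

/-- Stability of an `H`-module/comodule: `m₍₋₁₎ m₍₀₎ = m`. -/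
def IsStable (M : Type w) [AddCommGroup M] [Module k M] [Module H M] [IsScalarTower k H M]
    [LeftComodule k H M] : Prop :=
  ∀ m : M, actMap k H M (LeftComodule.coact (H := H) m) = m

/-- A pair `(C, M)` of a left `H`-module coalgebra and a left-left `H`-module/comodule. -/
structure HopfPair where
  C : Type u
  M : Type u
  [addC : AddCommGroup C]
  [modC : Module k C]
  [coalgC : Coalgebra k C]
  [actC : Module H C]
  [towerC : IsScalarTower k H C]
  [moduleCoalgebra : ModuleCoalgebra k H C]
  [addM : AddCommGroup M]
  [modM : Module k M]
  [actM : Module H M]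
  [towerM : IsScalarTower k H M]
  [comodule : LeftComodule k H M]

attribute [instance] HopfPair.addC HopfPair.modC HopfPair.coalgC HopfPair.actC HopfPair.towerC
  HopfPair.moduleCoalgebra HopfPair.addM HopfPair.modM HopfPair.actM HopfPair.towerM
  HopfPair.comodule

variable {k H}

/-- Morphisms of pairs: an `H`-linear coalgebra map together with an `H`-linear comodule map. -/
structure HopfPair.Hom (P Q : HopfPair k H) where
  onC : P.C →ₗ[k] Q.C
  onM : P.M →ₗ[k] Q.M
  comul_onC : ∀ c, Coalgebra.comul (R := k) (onC c) =
    TensorProduct.map onC onC (Coalgebra.comul (R := k) c)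
  counit_onC : ∀ c, Coalgebra.counit (R := k) (onC c) = Coalgebra.counit (R := k) c
  onC_smul : ∀ (h : H) c, onC (h • c) = h • onC c
  onM_smul : ∀ (h : H) m, onM (h • m) = h • onM m
  coact_onM : ∀ m, LeftComodule.coact (H := H) (onM m) =
    onM.lTensor H (LeftComodule.coact (H := H) m)

theorem endTensor_tmul {V W : Type*} [AddCommGroup V] [Module k V] [AddCommGroup W]
    [Module k W] (f : Module.End k V) (g : Module.End k W) (x : V) (y : W) :
    Module.endTensorEndAlgHom (R := k) (S := k) (A := k) (f ⊗ₜ[k] g) (x ⊗ₜ[k] y) =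
      f x ⊗ₜ[k] g y := rfl

theorem tensorRep_comm {V W V' W' : Type*} [AddCommGroup V] [Module k V] [AddCommGroup W]
    [Module k W] [AddCommGroup V'] [Module k V'] [AddCommGroup W'] [Module k W']
    (ρV : H →ₐ[k] Module.End k V) (ρW : H →ₐ[k] Module.End k W)
    (ρV' : H →ₐ[k] Module.End k V') (ρW' : H →ₐ[k] Module.End k W')
    (f : V →ₗ[k] V') (g : W →ₗ[k] W') (hf : ∀ h x, f (ρV h x) = ρV' h (f x))
    (hg : ∀ h x, g (ρW h x) = ρW' h (g x)) (h : H) (x : V ⊗[k] W) :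
    TensorProduct.map f g (tensorRep ρV ρW h x) =
      tensorRep ρV' ρW' h (TensorProduct.map f g x) := by
  simp only [tensorRep, AlgHom.comp_apply, Bialgebra.comulAlgHom_apply]
  induction Coalgebra.comul (R := k) h using TensorProduct.induction_on with
  | zero => simp
  | add a b ha hb => simp only [map_add, LinearMap.add_apply, ha, hb]
  | tmul a b =>
    induction x using TensorProduct.induction_on with
    | zero => simp
    | add x y hx hy => simp only [map_add, hx, hy]
    | tmul x y => simp [hf, hg, endTensor_tmul]

theorem tensorRep_lid {W : Type*} [AddCommGroup W] [Module k W] {V : Type*} [AddCommGroup V]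
    [Module k V] (ρV : H →ₐ[k] Module.End k V) (ρW : H →ₐ[k] Module.End k W) (ε : V →ₗ[k] k)
    (hε : ∀ h v, ε (ρV h v) = Coalgebra.counit (R := k) h * ε v) (h : H) (x : V ⊗[k] W) :
    TensorProduct.lid k W (ε.rTensor W (tensorRep ρV ρW h x)) =
      ρW h (TensorProduct.lid k W (ε.rTensor W x)) := by
  have key : ∀ z : H ⊗[k] H, TensorProduct.lid k W (ε.rTensor W
      (Module.endTensorEndAlgHom (R := k) (S := k) (A := k) (Algebra.TensorProduct.map ρV ρW z) x)) =
      ρW (TensorProduct.lid k H ((Coalgebra.counit (R := k)).rTensor H z))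
        (TensorProduct.lid k W (ε.rTensor W x)) := by
    intro z
    induction z using TensorProduct.induction_on with
    | zero => simp
    | add a b ha hb => simp only [map_add, LinearMap.add_apply, ha, hb]
    | tmul a b =>
      induction x using TensorProduct.induction_on with
      | zero => simp
      | add x y hx hy => simp only [map_add, hx, hy]
      | tmul x y => simp [hε, endTensor_tmul, smul_smul, mul_comm]
  have h1 := key (Coalgebra.comul (R := k) h)
  rw [Coalgebra.rTensor_counit_comul] at h1
  simpa [tensorRep] using h1

theorem tensorRep_assoc {V₁ V₂ V₃ : Type*} [AddCommGroup V₁] [Module k V₁] [AddCommGroup V₂]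
    [Module k V₂] [AddCommGroup V₃] [Module k V₃] (ρ₁ : H →ₐ[k] Module.End k V₁)
    (ρ₂ : H →ₐ[k] Module.End k V₂) (ρ₃ : H →ₐ[k] Module.End k V₃) (h : H)
    (x : (V₁ ⊗[k] V₂) ⊗[k] V₃) :
    TensorProduct.assoc k V₁ V₂ V₃ (tensorRep (tensorRep ρ₁ ρ₂) ρ₃ h x) =
      tensorRep ρ₁ (tensorRep ρ₂ ρ₃) h (TensorProduct.assoc k V₁ V₂ V₃ x) := by
  induction x using TensorProduct.induction_on with
  | zero => simp
  | add x y hx hy => simp only [map_add, hx, hy]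
  | tmul x x₃ =>
    induction x using TensorProduct.induction_on with
    | zero => simp
    | add x y hx hy => simp only [TensorProduct.add_tmul, map_add, hx, hy]
    | tmul x₁ x₂ =>
      set G : H ⊗[k] (H ⊗[k] H) →ₗ[k] V₁ ⊗[k] (V₂ ⊗[k] V₃) :=
        TensorProduct.map (ρ₁.toLinearMap.flip x₁)
          (TensorProduct.map (ρ₂.toLinearMap.flip x₂) (ρ₃.toLinearMap.flip x₃)) with hG
      have hl : ∀ z : H ⊗[k] H, TensorProduct.assoc k V₁ V₂ V₃
          (Module.endTensorEndAlgHom (R := k) (S := k) (A := k)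
            (Algebra.TensorProduct.map (tensorRep ρ₁ ρ₂) ρ₃ z) ((x₁ ⊗ₜ x₂) ⊗ₜ x₃)) =
          G (TensorProduct.assoc k H H H ((Coalgebra.comul (R := k)).rTensor H z)) := by
        intro z
        induction z using TensorProduct.induction_on with
        | zero => simp
        | add a b ha hb => simp only [map_add, LinearMap.add_apply, ha, hb]
        | tmul a c =>
          simp only [Algebra.TensorProduct.map_tmul, endTensor_tmul, LinearMap.rTensor_tmul]
          simp only [tensorRep, AlgHom.comp_apply, Bialgebra.comulAlgHom_apply]
          induction Coalgebra.comul (R := k) a using TensorProduct.induction_on with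
          | zero => simp
          | add a b ha hb =>
            simp only [map_add, LinearMap.add_apply, TensorProduct.add_tmul, ha, hb]
          | tmul a b => simp [endTensor_tmul, hG]
      have hr : ∀ z : H ⊗[k] H,
          (Module.endTensorEndAlgHom (R := k) (S := k) (A := k)
            (Algebra.TensorProduct.map ρ₁ (tensorRep ρ₂ ρ₃) z) (x₁ ⊗ₜ (x₂ ⊗ₜ x₃))) =
          G ((Coalgebra.comul (R := k)).lTensor H z) := by
        intro z
        induction z using TensorProduct.induction_on with
        | zero => simp
        | add a b ha hb => simp only [map_add, LinearMap.add_apply, ha, hb]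
        | tmul a c =>
          simp only [Algebra.TensorProduct.map_tmul, endTensor_tmul, LinearMap.lTensor_tmul]
          simp only [tensorRep, AlgHom.comp_apply, Bialgebra.comulAlgHom_apply]
          induction Coalgebra.comul (R := k) c using TensorProduct.induction_on with
          | zero => simp
          | add a b ha hb =>
            simp only [map_add, LinearMap.add_apply, TensorProduct.tmul_add, ha, hb]
          | tmul b c => simp [endTensor_tmul, hG]
      have h1 := hl (Coalgebra.comul (R := k) h)
      have h2 := hr (Coalgebra.comul (R := k) h)
      rw [Coalgebra.coassoc_apply] at h1
      exact h1.trans h2.symm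

end Structures

/-! ## Pseudo-para-cocyclic `H`-modules and their quotients -/

section PseudoParaCocyclic

/-- A pseudo-para-cocyclic `H`-module: a graded `H`-module with cofaces, codegeneracies and (not
necessarily invertible, not necessarily `H`-linear) cyclic operators that satisfy the relations
of the cyclic category except for `τₙⁿ⁺¹ = id`; the operators `∂ⁿᵢ` with `0 ≤ i ≤ n` and `σⁿⱼ` are
`H`-linear. -/
structure PPCModule (k : Type u) [Field k] (H : Type v) [Ring H] [Bialgebra k H] where
  X : ℕ → Type u
  [add : ∀ n, AddCommGroup (X n)]
  [mod : ∀ n, Module k (X n)]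
  act : ∀ n, H →ₐ[k] Module.End k (X n)
  δ : ∀ n, Fin (n + 2) → (X n →ₗ[k] X (n + 1))
  σ : ∀ n, Fin (n + 1) → (X (n + 1) →ₗ[k] X n)
  τ : ∀ n, X n →ₗ[k] X n
  δ_δ : ∀ (n : ℕ) (i j : Fin (n + 2)), i ≤ j → ∀ x,
    δ (n + 1) i.castSucc (δ n j x) = δ (n + 1) j.succ (δ n i x)
  σ_σ : ∀ (n : ℕ) (i j : Fin (n + 1)), i ≤ j → ∀ x,
    σ n j (σ (n + 1) i.castSucc x) = σ n i (σ (n + 1) j.succ x)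
  δ_σ_self : ∀ (n : ℕ) (i : Fin (n + 1)), ∀ x, σ n i (δ n i.castSucc x) = x
  δ_σ_succ : ∀ (n : ℕ) (i : Fin (n + 1)), ∀ x, σ n i (δ n i.succ x) = x
  σ_δ_le : ∀ (n : ℕ) (i : Fin (n + 2)) (j : Fin (n + 1)), i ≤ j.castSucc → ∀ x,
    δ n i (σ n j x) = σ (n + 1) j.succ (δ (n + 1) i.castSucc x)
  σ_δ_gt : ∀ (n : ℕ) (i : Fin (n + 2)) (j : Fin (n + 1)), j.castSucc < i → ∀ x,
    δ n i (σ n j x) = σ (n + 1) j.castSucc (δ (n + 1) i.succ x)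
  τ_δ : ∀ (n : ℕ) (i : Fin (n + 1)), ∀ x, δ n i.castSucc (τ n x) = τ (n + 1) (δ n i.succ x)
  δ_last : ∀ (n : ℕ), ∀ x, δ n (Fin.last (n + 1)) x = τ (n + 1) (δ n 0 x)
  σ_τ : ∀ (n : ℕ) (j : Fin n), ∀ x, τ n (σ n j.succ x) = σ n j.castSucc (τ (n + 1) x)
  σ_τ_zero : ∀ (n : ℕ), ∀ x, τ n (σ n 0 x) = σ n (Fin.last n) (τ (n + 1) (τ (n + 1) x))
  act_δ : ∀ (n : ℕ) (i : Fin (n + 1)) (h : H), ∀ x,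
    δ n i.castSucc (act n h x) = act (n + 1) h (δ n i.castSucc x)
  act_σ : ∀ (n : ℕ) (j : Fin (n + 1)) (h : H), ∀ x, σ n j (act (n + 1) h x) = act n h (σ n j x)

attribute [instance] PPCModule.add PPCModule.mod

variable {k : Type u} [Field k] {H : Type v} [Ring H] [Bialgebra k H]

/-- Morphisms of pseudo-para-cocyclic `H`-modules. -/
structure PPCModule.Hom (X Y : PPCModule k H) where
  f : ∀ n, X.X n →ₗ[k] Y.X n
  act : ∀ n h x, f n (X.act n h x) = Y.act n h (f n x)
  δ : ∀ n i x, f (n + 1) (X.δ n i x) = Y.δ n i (f n x)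
  σ : ∀ n j x, f n (X.σ n j x) = Y.σ n j (f (n + 1) x)
  τ : ∀ n x, f n (X.τ n x) = Y.τ n (f n x)

namespace PPCModule

/-- Membership in the graded submodule generated by a family `R` of homogeneous elements under
all operators and the action of `H`. -/
inductive Generated (X : PPCModule k H) (R : ∀ n, X.X n → Prop) : ∀ n, X.X n → Prop
  | of (n : ℕ) (x : X.X n) : R n x → Generated X R n x
  | zero (n : ℕ) : Generated X R n 0
  | add (n : ℕ) (x y : X.X n) : Generated X R n x → Generated X R n y → Generated X R n (x + y)
  | smul (n : ℕ) (a : k) (x : X.X n) : Generated X R n x → Generated X R n (a • x)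
  | act (n : ℕ) (h : H) (x : X.X n) : Generated X R n x → Generated X R n (X.act n h x)
  | δ (n : ℕ) (i : Fin (n + 2)) (x : X.X n) : Generated X R n x → Generated X R (n + 1) (X.δ n i x)
  | σ (n : ℕ) (j : Fin (n + 1)) (x : X.X (n + 1)) :
      Generated X R (n + 1) x → Generated X R n (X.σ n j x)
  | τ (n : ℕ) (x : X.X n) : Generated X R n x → Generated X R n (X.τ n x)

/-- The graded submodule generated by `R` in degree `n`. -/
def generated (X : PPCModule k H) (R : ∀ n, X.X n → Prop) (n : ℕ) : Submodule k (X.X n) where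
  carrier := {x | Generated X R n x}
  zero_mem' := Generated.zero n
  add_mem' := fun {x y} hx hy => Generated.add n x y hx hy
  smul_mem' := fun a x hx => Generated.smul n a x hx

/-- The quotient by the graded submodule generated by `R`: the largest quotient in which all
elements of `R` vanish. -/
def quot (X : PPCModule k H) (R : ∀ n, X.X n → Prop) : PPCModule k H where
  X n := X.X n ⧸ X.generated R n
  act n :=
    { toFun := fun h => (X.generated R n).mapQ _ (X.act n h) (fun x hx => Generated.act n h x hx)
      map_one' := by
        refine Submodule.linearMap_qext _ (LinearMap.ext fun x => ?_)
        simp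
      map_mul' := fun a b => by
        refine Submodule.linearMap_qext _ (LinearMap.ext fun x => ?_)
        simp
        rfl
      map_zero' := by
        refine Submodule.linearMap_qext _ (LinearMap.ext fun x => ?_)
        simp
      map_add' := fun a b => by
        refine Submodule.linearMap_qext _ (LinearMap.ext fun x => ?_)
        simp
        rfl
      commutes' := fun a => by
        refine Submodule.linearMap_qext _ (LinearMap.ext fun x => ?_)
        simp [Module.algebraMap_end_apply] }
  δ n i := (X.generated R n).mapQ _ (X.δ n i) (fun x hx => Generated.δ n i x hx)
  σ n j := (X.generated R (n + 1)).mapQ _ (X.σ n j) (fun x hx => Generated.σ n j x hx)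
  τ n := (X.generated R n).mapQ _ (X.τ n) (fun x hx => Generated.τ n x hx)
  δ_δ n i j h := by
    rintro ⟨x⟩
    exact congrArg _ (X.δ_δ n i j h x)
  σ_σ n i j h := by
    rintro ⟨x⟩
    exact congrArg _ (X.σ_σ n i j h x)
  δ_σ_self n i := by
    rintro ⟨x⟩
    exact congrArg _ (X.δ_σ_self n i x)
  δ_σ_succ n i := by
    rintro ⟨x⟩
    exact congrArg _ (X.δ_σ_succ n i x)
  σ_δ_le n i j h := by
    rintro ⟨x⟩
    exact congrArg _ (X.σ_δ_le n i j h x)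
  σ_δ_gt n i j h := by
    rintro ⟨x⟩
    exact congrArg _ (X.σ_δ_gt n i j h x)
  τ_δ n i := by
    rintro ⟨x⟩
    exact congrArg _ (X.τ_δ n i x)
  δ_last n := by
    rintro ⟨x⟩
    exact congrArg _ (X.δ_last n x)
  σ_τ n j := by
    rintro ⟨x⟩
    exact congrArg _ (X.σ_τ n j x)
  σ_τ_zero n := by
    rintro ⟨x⟩
    exact congrArg _ (X.σ_τ_zero n x)
  act_δ n i h := by
    rintro ⟨x⟩
    exact congrArg _ (X.act_δ n i h x)
  act_σ n j h := by
    rintro ⟨x⟩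
    exact congrArg _ (X.act_σ n j h x)

/-- The class in the quotient. -/
def cls (X : PPCModule k H) (R : ∀ n, X.X n → Prop) (n : ℕ) (x : X.X n) : (X.quot R).X n :=
  Submodule.Quotient.mk x

theorem cls_eq (X : PPCModule k H) (R : ∀ n, X.X n → Prop) (n : ℕ) (x y : X.X n)
    (h : Generated X R n (x - y)) : X.cls R n x = X.cls R n y :=
  (Submodule.Quotient.eq _).2 h

theorem generated_map {X Y : PPCModule k H} (f : Hom X Y) (R : ∀ n, X.X n → Prop)
    (S : ∀ n, Y.X n → Prop) (hRS : ∀ n x, R n x → S n (f.f n x)) {n : ℕ} {x : X.X n}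
    (hx : Generated X R n x) : Generated Y S n (f.f n x) := by
  induction hx with
  | of n x h => exact Generated.of n _ (hRS n x h)
  | zero n => rw [map_zero]; exact Generated.zero n
  | add n x y _ _ hx hy => rw [map_add]; exact Generated.add n _ _ hx hy
  | smul n a x _ hx => rw [map_smul]; exact Generated.smul n a _ hx
  | act n h x _ hx => rw [f.act]; exact Generated.act n h _ hx
  | δ n i x _ hx => rw [f.δ]; exact Generated.δ n i _ hx
  | σ n j x _ hx => rw [f.σ]; exact Generated.σ n j _ hx
  | τ n x _ hx => rw [f.τ]; exact Generated.τ n _ hx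

/-- The map induced on quotients. -/
def quotMap {X Y : PPCModule k H} (f : Hom X Y) (R : ∀ n, X.X n → Prop)
    (S : ∀ n, Y.X n → Prop) (hRS : ∀ n x, R n x → S n (f.f n x)) : Hom (X.quot R) (Y.quot S) where
  f n := (X.generated R n).mapQ (Y.generated S n) (f.f n)
    (fun _ hx => generated_map f R S hRS hx)
  act n h := by
    rintro ⟨x⟩
    exact congrArg _ (f.act n h x)
  δ n i := by
    rintro ⟨x⟩
    exact congrArg _ (f.δ n i x)
  σ n j := by
    rintro ⟨x⟩
    exact congrArg _ (f.σ n j x)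
  τ n := by
    rintro ⟨x⟩
    exact congrArg _ (f.τ n x)

/-- The elements `[h, τₙ] x`. -/
def ParaRel (X : PPCModule k H) (n : ℕ) (x : X.X n) : Prop :=
  ∃ (h : H) (y : X.X n), x = X.act n h (X.τ n y) - X.τ n (X.act n h y)

/-- The elements `[h, τₙ] x` and `τₙⁿ⁺¹ x - x`. -/
def CycHRel (X : PPCModule k H) (n : ℕ) (x : X.X n) : Prop :=
  X.ParaRel n x ∨ ∃ y : X.X n, x = (X.τ n)^[n + 1] y - y

/-- The elements `h x - ε(h) x`. -/
def CoinvRel (X : PPCModule k H) (n : ℕ) (x : X.X n) : Prop :=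
  ∃ (h : H) (y : X.X n), x = X.act n h y - Coalgebra.counit (R := k) h • y

/-- The largest quotient that is a para-cocyclic `H`-module. -/
def paraQuot (X : PPCModule k H) : PPCModule k H := X.quot X.ParaRel

/-- The largest quotient that is a cocyclic `H`-module. -/
def cycQuot (X : PPCModule k H) : PPCModule k H := X.quot X.CycHRel

/-- The largest quotient with trivial action of `H`. If `H` commutes with the cyclic operators,
it is the degreewise `k ⊗_H X`, see `generated_coinvRel`. -/
def coinv (X : PPCModule k H) : PPCModule k H := X.quot X.CoinvRel

/-- The cyclic operators are `H`-linear. -/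
def IsParaCocyclic (X : PPCModule k H) : Prop :=
  ∀ n (h : H) x, X.act n h (X.τ n x) = X.τ n (X.act n h x)

/-- The cyclic operators satisfy `τₙⁿ⁺¹ = id`. -/
def IsPeriodic (X : PPCModule k H) : Prop := ∀ n x, (X.τ n)^[n + 1] x = x

theorem Hom.iterate_τ {X Y : PPCModule k H} (f : Hom X Y) (n m : ℕ) (x : X.X n) :
    f.f n ((X.τ n)^[m] x) = (Y.τ n)^[m] (f.f n x) := by
  induction m with
  | zero => rfl
  | succ m ih => rw [Function.iterate_succ_apply', Function.iterate_succ_apply', f.τ, ih]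

theorem cls_iterate_τ (X : PPCModule k H) (R : ∀ n, X.X n → Prop) (n m : ℕ) (x : X.X n) :
    ((X.quot R).τ n)^[m] (X.cls R n x) = X.cls R n ((X.τ n)^[m] x) := by
  induction m with
  | zero => rfl
  | succ m ih =>
    rw [Function.iterate_succ_apply', Function.iterate_succ_apply', ih]
    rfl

theorem paraQuot_isParaCocyclic (X : PPCModule k H) : X.paraQuot.IsParaCocyclic := by
  intro n h x
  obtain ⟨x, rfl⟩ := Submodule.Quotient.mk_surjective _ x
  exact X.cls_eq _ n _ _ (Generated.of n _ ⟨h, x, rfl⟩)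

theorem cycQuot_isParaCocyclic (X : PPCModule k H) : X.cycQuot.IsParaCocyclic := by
  intro n h x
  obtain ⟨x, rfl⟩ := Submodule.Quotient.mk_surjective _ x
  exact X.cls_eq _ n _ _ (Generated.of n _ (Or.inl ⟨h, x, rfl⟩))

theorem cycQuot_isPeriodic (X : PPCModule k H) : X.cycQuot.IsPeriodic := by
  intro n x
  obtain ⟨x, rfl⟩ := Submodule.Quotient.mk_surjective _ x
  exact (X.cls_iterate_τ _ n (n + 1) x).trans
    (X.cls_eq _ n _ _ (Generated.of n _ (Or.inr ⟨x, rfl⟩)))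

theorem quot_isPeriodic (X : PPCModule k H) (R : ∀ n, X.X n → Prop) (h : X.IsPeriodic) :
    (X.quot R).IsPeriodic := by
  intro n x
  obtain ⟨x, rfl⟩ := Submodule.Quotient.mk_surjective _ x
  exact (X.cls_iterate_τ R n (n + 1) x).trans (congrArg _ (h n x))

theorem act_δ_all {X : PPCModule k H} (hX : X.IsParaCocyclic) (n : ℕ) (i : Fin (n + 2)) (h : H)
    (x : X.X n) : X.δ n i (X.act n h x) = X.act (n + 1) h (X.δ n i x) := by
  induction i using Fin.lastCases with
  | last =>
    rw [X.δ_last, X.δ_last, hX]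
    exact congrArg _ (X.act_δ n 0 h x)
  | cast i => exact X.act_δ n i h x

/-- If `H` commutes with the cyclic operators, then `coinv` is the quotient by the `k`-span of the
elements `h x - ε(h) x`, that is, `k ⊗_H X` in each degree. -/
theorem generated_coinvRel {X : PPCModule k H} (hX : X.IsParaCocyclic) (n : ℕ) :
    X.generated X.CoinvRel n = Submodule.span k {x | X.CoinvRel n x} := by
  apply le_antisymm
  · intro x hx
    change Generated X X.CoinvRel n x at hx
    have step : ∀ (m n : ℕ) (f : X.X m →ₗ[k] X.X n),
        (∀ (h : H) y, f (X.act m h y) = X.act n h (f y)) →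
        ∀ x ∈ Submodule.span k {x | X.CoinvRel m x},
          f x ∈ Submodule.span k {x | X.CoinvRel n x} := by
      intro m n f hf x hx
      refine (Submodule.span_le (p := (Submodule.span k {x | X.CoinvRel n x}).comap f)).2 ?_ hx
      rintro _ ⟨h, y, rfl⟩
      refine Submodule.subset_span ⟨h, f y, ?_⟩
      rw [map_sub, hf, map_smul]
    induction hx with
    | of n x h => exact Submodule.subset_span h
    | zero n => exact Submodule.zero_mem _
    | add n x y _ _ hx hy => exact Submodule.add_mem _ hx hy
    | smul n a x _ hx => exact Submodule.smul_mem _ a hx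
    | act n h x _ hx =>
      have h1 : X.act n h x = (X.act n h x - Coalgebra.counit (R := k) h • x) +
          Coalgebra.counit (R := k) h • x := by abel
      rw [h1]
      exact Submodule.add_mem _ (Submodule.subset_span ⟨h, x, rfl⟩) (Submodule.smul_mem _ _ hx)
    | δ n i x _ hx => exact step n (n + 1) (X.δ n i) (fun h y => act_δ_all hX n i h y) x hx
    | σ n j x _ hx => exact step (n + 1) n (X.σ n j) (fun h y => X.act_σ n j h y) x hx
    | τ n x _ hx => exact step n n (X.τ n) (fun h y => (hX n h y).symm) x hx
  · exact Submodule.span_le.2 fun x hx => Generated.of n x hx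

/-- The induced map of largest para-cocyclic quotients. -/
def paraQuotMap {X Y : PPCModule k H} (f : Hom X Y) : Hom X.paraQuot Y.paraQuot :=
  quotMap f _ _ (by
    rintro n _ ⟨h, y, rfl⟩
    exact ⟨h, f.f n y, by rw [map_sub, f.act, f.τ, f.τ, f.act]⟩)

/-- The induced map of largest cocyclic quotients. -/
def cycQuotMap {X Y : PPCModule k H} (f : Hom X Y) : Hom X.cycQuot Y.cycQuot :=
  quotMap f _ _ (by
    rintro n _ (⟨h, y, rfl⟩ | ⟨y, rfl⟩)
    · exact Or.inl ⟨h, f.f n y, by rw [map_sub, f.act, f.τ, f.τ, f.act]⟩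
    · exact Or.inr ⟨f.f n y, by rw [map_sub, f.iterate_τ]⟩)

/-- The induced map of coinvariants. -/
def coinvMap {X Y : PPCModule k H} (f : Hom X Y) : Hom X.coinv Y.coinv :=
  quotMap f _ _ (by
    rintro n _ ⟨h, y, rfl⟩
    exact ⟨h, f.f n y, by rw [map_sub, f.act, map_smul]⟩)

/-- The cocyclic `k`-module underlying a pseudo-para-cocyclic `H`-module with `τₙⁿ⁺¹ = id`. -/
def toCocyclicObject (X : PPCModule k H) (h : X.IsPeriodic) :
    CocyclicObject (ModuleCat.{u} k) where
  X n := ModuleCat.of k (X.X n)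
  δ n i := ModuleCat.ofHom (X.δ n i)
  σ n j := ModuleCat.ofHom (X.σ n j)
  τ n := ModuleCat.ofHom (X.τ n)
  δ_δ n i j h := ModuleCat.hom_ext (LinearMap.ext (X.δ_δ n i j h))
  σ_σ n i j h := ModuleCat.hom_ext (LinearMap.ext (X.σ_σ n i j h))
  δ_σ_self n i := ModuleCat.hom_ext (LinearMap.ext (X.δ_σ_self n i))
  δ_σ_succ n i := ModuleCat.hom_ext (LinearMap.ext (X.δ_σ_succ n i))
  σ_δ_le n i j h := ModuleCat.hom_ext (LinearMap.ext (X.σ_δ_le n i j h))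
  σ_δ_gt n i j h := ModuleCat.hom_ext (LinearMap.ext (X.σ_δ_gt n i j h))
  τ_δ n i := ModuleCat.hom_ext (LinearMap.ext (X.τ_δ n i))
  δ_last n := ModuleCat.hom_ext (LinearMap.ext (X.δ_last n))
  σ_τ n j := ModuleCat.hom_ext (LinearMap.ext (X.σ_τ n j))
  σ_τ_zero n := ModuleCat.hom_ext (LinearMap.ext (X.σ_τ_zero n))
  τ_pow n := by
    refine ModuleCat.hom_ext (LinearMap.ext fun x => ?_)
    rw [iter_hom]
    exact (Module.End.pow_apply _ _ _).trans (h n x)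

/-- The functor `Λ ⥤ ModuleCat k` of a pseudo-para-cocyclic `H`-module with `τₙⁿ⁺¹ = id`. -/
def toCocyclicMod (X : PPCModule k H) (h : X.IsPeriodic) : CocyclicMod k :=
  (X.toCocyclicObject h).functor

/-- The morphism of cocyclic `k`-modules given by a morphism. -/
def toCocyclicModMap {X Y : PPCModule k H} (hX : X.IsPeriodic) (hY : Y.IsPeriodic) (f : Hom X Y) :
    X.toCocyclicMod hX ⟶ Y.toCocyclicMod hY :=
  CocyclicObject.homOfFamily (A := X.toCocyclicObject hX) (B := Y.toCocyclicObject hY)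
    (fun n => ModuleCat.ofHom (f.f n))
    (fun n i => ModuleCat.hom_ext (LinearMap.ext fun x => (f.δ n i x).symm))
    (fun n j => ModuleCat.hom_ext (LinearMap.ext fun x => (f.σ n j x).symm))
    (fun n => ModuleCat.hom_ext (LinearMap.ext fun x => (f.τ n x).symm))

end PPCModule

end PseudoParaCocyclic

/-! ## The pseudo-para-cocyclic module `T(C, M)` -/

section TensorModule

set_option linter.unusedSectionVars false

variable (k : Type u) [Field k] (H : Type v) [Ring H] [Bialgebra k H]
  (C : Type u) [AddCommGroup C] [Module k C] [Coalgebra k C] [Module H C] [IsScalarTower k H C]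
  (M : Type u) [AddCommGroup M] [Module k M] [Module H M] [IsScalarTower k H M]

/-- The iterated tensor product `C ⊗ (C ⊗ ⋯ ⊗ (C ⊗ M))` with `n` factors `C`. -/
def TW : ℕ → ModuleCat.{u} k
  | 0 => ModuleCat.of k M
  | n + 1 => ModuleCat.of k (C ⊗[k] TW n)

variable {k C M} in
/-- The elementary tensor `c ⊗ w`. -/
def cons {n : ℕ} (c : C) (w : TW k C M n) : TW k C M (n + 1) :=
  TensorProduct.tmul k (N := TW k C M n) c w

/-- Application of a linear map behind the first tensor factor: `c ⊗ w ↦ c ⊗ f(w)`. -/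
def behind {n m : ℕ} (f : TW k C M n →ₗ[k] TW k C M m) :
    TW k C M (n + 1) →ₗ[k] TW k C M (m + 1) :=
  LinearMap.lTensor (N := TW k C M n) (P := TW k C M m) C f

/-- `c⁰ ⊗ ⋯ ↦ ⋯ ⊗ cʲ₍₁₎ ⊗ cʲ₍₂₎ ⊗ ⋯`: comultiplication in the factor with index `j ≤ n`
(and `0` for `j > n`). -/
def splitAt : ℕ → ∀ n, TW k C M (n + 1) →ₗ[k] TW k C M (n + 2)
  | 0, n => (TensorProduct.assoc k C C (TW k C M n)).toLinearMap ∘ₗ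
      (Coalgebra.comul (R := k) (A := C)).rTensor (TW k C M n)
  | _ + 1, 0 => 0
  | j + 1, n + 1 => behind k C M (splitAt j n)

/-- `c⁰ ⊗ ⋯ ↦ ε(cʲ) (⋯ ⊗ cʲ⁻¹ ⊗ cʲ⁺¹ ⊗ ⋯)`: counit in the factor with index `j ≤ n`
(and `0` for `j > n`). -/
def deleteAt : ℕ → ∀ n, TW k C M (n + 1) →ₗ[k] TW k C M n
  | 0, n => (TensorProduct.lid k (TW k C M n)).toLinearMap ∘ₗ
      (Coalgebra.counit (R := k) (A := C)).rTensor (TW k C M n)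
  | _ + 1, 0 => 0
  | j + 1, n + 1 => behind k C M (deleteAt j n)

/-- The diagonal action `h (c⁰ ⊗ ⋯ ⊗ m) = h₍₁₎ c⁰ ⊗ ⋯ ⊗ h₍ₙ₊₁₎ m`. -/
def actTW : ∀ n, H →ₐ[k] Module.End k (TW k C M n)
  | 0 => rep k H M
  | n + 1 => tensorRep (W := TW k C M n) (rep k H C) (actTW n)

section Comodule

variable [LeftComodule k H M]

/-- The map `c ⊗ m ↦ m₍₋₁₎ c ⊗ m₍₀₎`. -/
def twist : C ⊗[k] M →ₗ[k] C ⊗[k] M :=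
  (actMap k H C).rTensor M ∘ₗ (TensorProduct.assoc k H C M).symm.toLinearMap ∘ₗ
    (TensorProduct.leftComm k C H M).toLinearMap ∘ₗ (LeftComodule.coact (H := H)).lTensor C

/-- The cyclic operator `c⁰ ⊗ c¹ ⊗ ⋯ ⊗ cⁿ ⊗ m ↦ c¹ ⊗ ⋯ ⊗ cⁿ ⊗ m₍₋₁₎ c⁰ ⊗ m₍₀₎`. -/
def rotate : ∀ n, TW k C M (n + 1) →ₗ[k] TW k C M (n + 1)
  | 0 => twist k H C M
  | n + 1 => behind k C M (rotate n) ∘ₗ (TensorProduct.leftComm k C C (TW k C M n)).toLinearMap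

end Comodule

variable {k H C M}

@[elab_as_elim]
theorem tw_induction {n : ℕ} {p : TW k C M (n + 1) → Prop} (x : TW k C M (n + 1)) (h0 : p 0)
    (hc : ∀ c w, p (cons c w)) (ha : ∀ x y, p x → p y → p (x + y)) : p x :=
  TensorProduct.induction_on (N := TW k C M n) x h0 hc ha

theorem cons_add {n : ℕ} (c : C) (w w' : TW k C M n) : cons c (w + w') = cons c w + cons c w' :=
  TensorProduct.tmul_add _ _ _

theorem add_cons {n : ℕ} (c c' : C) (w : TW k C M n) : cons (c + c') w = cons c w + cons c' w :=
  TensorProduct.add_tmul _ _ _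

theorem cons_zero {n : ℕ} (c : C) : cons c (0 : TW k C M n) = 0 :=
  TensorProduct.tmul_zero _ _

theorem cons_smul {n : ℕ} (a : k) (c : C) (w : TW k C M n) : cons c (a • w) = a • cons c w :=
  TensorProduct.tmul_smul _ _ _

theorem smul_cons {n : ℕ} (a : k) (c : C) (w : TW k C M n) : cons (a • c) w = a • cons c w :=
  TensorProduct.smul_tmul' _ _ _

/-- The map `a ⊗ b ↦ a ⊗ b ⊗ w`. -/
def cons₂ {n : ℕ} (w : TW k C M n) : C ⊗[k] C →ₗ[k] TW k C M (n + 2) :=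
  (TensorProduct.assoc k C C (TW k C M n)).toLinearMap ∘ₗ
    (TensorProduct.mk k (C ⊗[k] C) (TW k C M n)).flip w

theorem cons₂_tmul {n : ℕ} (w : TW k C M n) (a b : C) : cons₂ w (a ⊗ₜ b) = cons a (cons b w) := rfl

theorem behind_cons {n m : ℕ} (f : TW k C M n →ₗ[k] TW k C M m) (c : C) (w : TW k C M n) :
    behind k C M f (cons c w) = cons c (f w) := rfl

theorem splitAt_zero_cons {n : ℕ} (c : C) (w : TW k C M n) :
    splitAt k C M 0 n (cons c w) = cons₂ w (Coalgebra.comul (R := k) c) := rfl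

theorem splitAt_succ_cons {j n : ℕ} (c : C) (w : TW k C M (n + 1)) :
    splitAt k C M (j + 1) (n + 1) (cons c w) = cons c (splitAt k C M j n w) := rfl

theorem deleteAt_zero_cons {n : ℕ} (c : C) (w : TW k C M n) :
    deleteAt k C M 0 n (cons c w) = Coalgebra.counit (R := k) c • w := rfl

theorem deleteAt_succ_cons {j n : ℕ} (c : C) (w : TW k C M (n + 1)) :
    deleteAt k C M (j + 1) (n + 1) (cons c w) = cons c (deleteAt k C M j n w) := rfl

/-- Linear maps that agree on elementary tensors are equal. -/
theorem tw_ext {n : ℕ} {V : Type*} [AddCommGroup V] [Module k V] {f g : TW k C M (n + 1) →ₗ[k] V}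
    (h : ∀ c w, f (cons c w) = g (cons c w)) : f = g :=
  TensorProduct.ext' (N := TW k C M n) h

theorem tw_ext_apply {n : ℕ} {V : Type*} [AddCommGroup V] [Module k V]
    (f g : TW k C M (n + 1) →ₗ[k] V) (x : TW k C M (n + 1))
    (h : ∀ c w, f (cons c w) = g (cons c w)) : f x = g x := by
  rw [tw_ext h]

theorem cons₂_map {n m : ℕ} (f : TW k C M n →ₗ[k] TW k C M m) (w : TW k C M n) (z : C ⊗[k] C) :
    behind k C M (behind k C M f) (cons₂ w z) = cons₂ (f w) z := by
  induction z using TensorProduct.induction_on with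
  | zero => simp
  | add x y hx hy => simp only [map_add, hx, hy]
  | tmul a b => rfl

/-- The map `a ⊗ (b ⊗ c) ↦ a ⊗ b ⊗ c ⊗ w`. -/
def cons₃ {n : ℕ} (w : TW k C M n) : C ⊗[k] (C ⊗[k] C) →ₗ[k] TW k C M (n + 3) :=
  LinearMap.lTensor (P := TW k C M (n + 2)) C (cons₂ w)

theorem splitAt_zero_cons₂ {n : ℕ} (w : TW k C M n) (z : C ⊗[k] C) :
    splitAt k C M 0 (n + 1) (cons₂ w z) = cons₃ w (TensorProduct.assoc k C C C
      ((Coalgebra.comul (R := k)).rTensor C z)) := by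
  induction z using TensorProduct.induction_on with
  | zero => simp only [map_zero]
  | add x y hx hy => simp only [map_add, hx, hy]
  | tmul a b =>
    rw [cons₂_tmul, splitAt_zero_cons, LinearMap.rTensor_tmul]
    induction Coalgebra.comul (R := k) a using TensorProduct.induction_on with
    | zero => simp only [map_zero, TensorProduct.zero_tmul]
    | add x y hx hy => simp only [map_add, TensorProduct.add_tmul, hx, hy]
    | tmul x y => rfl

theorem splitAt_one_cons₂ {n : ℕ} (w : TW k C M n) (z : C ⊗[k] C) :
    splitAt k C M 1 (n + 1) (cons₂ w z) = cons₃ w ((Coalgebra.comul (R := k)).lTensor C z) := by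
  induction z using TensorProduct.induction_on with
  | zero => simp only [map_zero]
  | add x y hx hy => simp only [map_add, hx, hy]
  | tmul a b => rfl

theorem deleteAt_zero_cons₂ {n : ℕ} (w : TW k C M n) (z : C ⊗[k] C) :
    deleteAt k C M 0 (n + 1) (cons₂ w z) =
      cons (TensorProduct.lid k C ((Coalgebra.counit (R := k)).rTensor C z)) w := by
  induction z using TensorProduct.induction_on with
  | zero => simp only [map_zero]; exact (TensorProduct.zero_tmul _ _).symm
  | add x y hx hy => simp only [map_add, hx, hy, add_cons]
  | tmul a b => rw [cons₂_tmul, deleteAt_zero_cons, ← smul_cons]; simp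

theorem deleteAt_one_cons₂ {n : ℕ} (w : TW k C M n) (z : C ⊗[k] C) :
    deleteAt k C M 1 (n + 1) (cons₂ w z) =
      cons (TensorProduct.rid k C ((Coalgebra.counit (R := k)).lTensor C z)) w := by
  induction z using TensorProduct.induction_on with
  | zero => simp only [map_zero]; exact (TensorProduct.zero_tmul _ _).symm
  | add x y hx hy => simp only [map_add, hx, hy, add_cons]
  | tmul a b =>
    rw [cons₂_tmul, deleteAt_succ_cons, deleteAt_zero_cons, cons_smul, ← smul_cons]; simp

theorem splitAt_splitAt (i j n : ℕ) (hij : i ≤ j) (hj : j ≤ n) (x : TW k C M (n + 1)) :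
    splitAt k C M i (n + 1) (splitAt k C M j n x) =
      splitAt k C M (j + 1) (n + 1) (splitAt k C M i n x) := by
  induction i generalizing j n with
  | zero =>
    refine tw_induction x (by simp only [map_zero]) (fun c w => ?_)
        (fun x y hx hy => by simp only [map_add, hx, hy])
    cases j with
    | zero =>
      rw [splitAt_zero_cons, splitAt_zero_cons₂, splitAt_one_cons₂, Coalgebra.coassoc_apply]
    | succ j =>
      obtain ⟨m, rfl⟩ : ∃ m, n = m + 1 := ⟨n - 1, by omega⟩
      rw [splitAt_succ_cons, splitAt_zero_cons, splitAt_zero_cons]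
      exact (cons₂_map _ _ _).symm
  | succ i ih =>
    obtain ⟨j, rfl⟩ : ∃ m, j = m + 1 := ⟨j - 1, by omega⟩
    obtain ⟨m, rfl⟩ : ∃ m, n = m + 1 := ⟨n - 1, by omega⟩
    refine tw_induction x (by simp only [map_zero]) (fun c w => ?_)
        (fun x y hx hy => by simp only [map_add, hx, hy])
    rw [splitAt_succ_cons, splitAt_succ_cons, splitAt_succ_cons, splitAt_succ_cons,
      ih j m (by omega) (by omega)]

theorem deleteAt_deleteAt (i j n : ℕ) (hij : i ≤ j) (hj : j ≤ n) (x : TW k C M (n + 2)) :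
    deleteAt k C M j n (deleteAt k C M i (n + 1) x) =
      deleteAt k C M i n (deleteAt k C M (j + 1) (n + 1) x) := by
  induction i generalizing j n with
  | zero =>
    refine tw_induction x (by simp only [map_zero]) (fun c w => ?_)
        (fun x y hx hy => by simp only [map_add, hx, hy])
    rw [deleteAt_zero_cons, deleteAt_succ_cons, deleteAt_zero_cons, map_smul]
  | succ i ih =>
    obtain ⟨j, rfl⟩ : ∃ m, j = m + 1 := ⟨j - 1, by omega⟩
    obtain ⟨m, rfl⟩ : ∃ m, n = m + 1 := ⟨n - 1, by omega⟩
    refine tw_induction x (by simp only [map_zero]) (fun c w => ?_)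
        (fun x y hx hy => by simp only [map_add, hx, hy])
    rw [deleteAt_succ_cons, deleteAt_succ_cons, deleteAt_succ_cons, deleteAt_succ_cons,
      ih j m (by omega) (by omega)]

theorem deleteAt_splitAt_self (j n : ℕ) (hj : j ≤ n) (x : TW k C M (n + 1)) :
    deleteAt k C M j (n + 1) (splitAt k C M j n x) = x := by
  induction j generalizing n with
  | zero =>
    refine tw_induction x (by simp only [map_zero]) (fun c w => ?_)
        (fun x y hx hy => by simp only [map_add, hx, hy])
    rw [splitAt_zero_cons, deleteAt_zero_cons₂, Coalgebra.rTensor_counit_comul]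
    simp
  | succ j ih =>
    obtain ⟨m, rfl⟩ : ∃ m, n = m + 1 := ⟨n - 1, by omega⟩
    refine tw_induction x (by simp only [map_zero]) (fun c w => ?_)
        (fun x y hx hy => by simp only [map_add, hx, hy])
    rw [splitAt_succ_cons, deleteAt_succ_cons, ih m (by omega)]

theorem deleteAt_succ_splitAt (j n : ℕ) (hj : j ≤ n) (x : TW k C M (n + 1)) :
    deleteAt k C M (j + 1) (n + 1) (splitAt k C M j n x) = x := by
  induction j generalizing n with
  | zero =>
    refine tw_induction x (by simp only [map_zero]) (fun c w => ?_)
        (fun x y hx hy => by simp only [map_add, hx, hy])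
    rw [splitAt_zero_cons, deleteAt_one_cons₂, Coalgebra.lTensor_counit_comul]
    simp
  | succ j ih =>
    obtain ⟨m, rfl⟩ : ∃ m, n = m + 1 := ⟨n - 1, by omega⟩
    refine tw_induction x (by simp only [map_zero]) (fun c w => ?_)
        (fun x y hx hy => by simp only [map_add, hx, hy])
    rw [splitAt_succ_cons, deleteAt_succ_cons, ih m (by omega)]

theorem splitAt_deleteAt_lt (i j n : ℕ) (hij : i < j) (hj : j ≤ n + 1) (x : TW k C M (n + 2)) :
    splitAt k C M i n (deleteAt k C M j (n + 1) x) =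
      deleteAt k C M (j + 1) (n + 2) (splitAt k C M i (n + 1) x) := by
  induction i generalizing j n with
  | zero =>
    obtain ⟨j, rfl⟩ : ∃ m, j = m + 1 := ⟨j - 1, by omega⟩
    refine tw_induction x (by simp only [map_zero]) (fun c w => ?_)
        (fun x y hx hy => by simp only [map_add, hx, hy])
    rw [deleteAt_succ_cons, splitAt_zero_cons, splitAt_zero_cons]
    exact (cons₂_map _ _ _).symm
  | succ i ih =>
    obtain ⟨j, rfl⟩ : ∃ m, j = m + 1 := ⟨j - 1, by omega⟩
    obtain ⟨m, rfl⟩ : ∃ m, n = m + 1 := ⟨n - 1, by omega⟩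
    refine tw_induction x (by simp only [map_zero]) (fun c w => ?_)
        (fun x y hx hy => by simp only [map_add, hx, hy])
    rw [deleteAt_succ_cons, splitAt_succ_cons, splitAt_succ_cons, deleteAt_succ_cons,
      ih j m (by omega) (by omega)]

theorem splitAt_deleteAt_ge (i j n : ℕ) (hij : j ≤ i) (hi : i ≤ n) (x : TW k C M (n + 2)) :
    splitAt k C M i n (deleteAt k C M j (n + 1) x) =
      deleteAt k C M j (n + 2) (splitAt k C M (i + 1) (n + 1) x) := by
  induction j generalizing i n with
  | zero =>
    refine tw_induction x (by simp only [map_zero]) (fun c w => ?_)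
        (fun x y hx hy => by simp only [map_add, hx, hy])
    rw [deleteAt_zero_cons, splitAt_succ_cons, deleteAt_zero_cons, map_smul]
  | succ j ih =>
    obtain ⟨i, rfl⟩ : ∃ m, i = m + 1 := ⟨i - 1, by omega⟩
    obtain ⟨m, rfl⟩ : ∃ m, n = m + 1 := ⟨n - 1, by omega⟩
    refine tw_induction x (by simp only [map_zero]) (fun c w => ?_)
        (fun x y hx hy => by simp only [map_add, hx, hy])
    rw [deleteAt_succ_cons, splitAt_succ_cons, splitAt_succ_cons, deleteAt_succ_cons,
      ih i m (by omega) (by omega)]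

section Comodule

variable [LeftComodule k H M]

/-- The map `h ⊗ m ↦ h c ⊗ m`. -/
def actCons (c : C) : H ⊗[k] M →ₗ[k] TW k C M 1 :=
  TensorProduct.map ((actMap k H C) ∘ₗ (TensorProduct.mk k H C).flip c) LinearMap.id

theorem actCons_tmul (c : C) (h : H) (m : M) :
    actCons (k := k) c (h ⊗ₜ m) = cons (n := 0) (h • c) m := rfl

theorem rotate_zero_cons (c : C) (m : M) :
    rotate k H C M 0 (cons (n := 0) c m) = actCons c (LeftComodule.coact (H := H) m) := by
  change (twist k H C M) (c ⊗ₜ m) = _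
  simp only [twist, LinearMap.comp_apply, LinearMap.lTensor_tmul]
  induction LeftComodule.coact (k := k) (H := H) m using TensorProduct.induction_on with
  | zero => simp; rfl
  | add x y hx hy => simp only [TensorProduct.tmul_add, map_add, hx, hy]; rfl
  | tmul h m => rfl

theorem rotate_succ_cons {n : ℕ} (c c' : C) (w : TW k C M n) :
    rotate k H C M (n + 1) (cons c (cons c' w)) = cons c' (rotate k H C M n (cons c w)) := rfl

@[elab_as_elim]
theorem tw_induction₂ {n : ℕ} {p : TW k C M (n + 2) → Prop} (x : TW k C M (n + 2)) (h0 : p 0)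
    (hc : ∀ c c' w, p (cons c (cons c' w))) (ha : ∀ x y, p x → p y → p (x + y)) : p x := by
  refine tw_induction x h0 (fun c w => ?_) ha
  refine tw_induction (p := fun w => p (cons c w)) w ?_ (fun c' w => hc c c' w) (fun x y hx hy => ?_)
  · rw [cons_zero]; exact h0
  · rw [cons_add]; exact ha _ _ hx hy

theorem rotate_cons₂ {n : ℕ} (c : C) (w : TW k C M n) (z : C ⊗[k] C) :
    rotate k H C M (n + 2) (cons c (cons₂ w z)) = cons₂ (rotate k H C M n (cons c w)) z := by
  induction z using TensorProduct.induction_on with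
  | zero => simp only [map_zero, cons_zero]
  | add x y hx hy => simp only [map_add, cons_add, hx, hy]
  | tmul a b => rfl

theorem rotate_splitAt (j n : ℕ) (hj : j ≤ n) (x : TW k C M (n + 2)) :
    splitAt k C M j (n + 1) (rotate k H C M (n + 1) x) =
      rotate k H C M (n + 2) (splitAt k C M (j + 1) (n + 1) x) := by
  induction j generalizing n with
  | zero =>
    refine tw_induction₂ x (by simp only [map_zero]) (fun c c' w => ?_)
        (fun x y hx hy => by simp only [map_add, hx, hy])
    rw [rotate_succ_cons, splitAt_zero_cons, splitAt_succ_cons, splitAt_zero_cons, rotate_cons₂]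
  | succ j ih =>
    obtain ⟨m, rfl⟩ : ∃ m, n = m + 1 := ⟨n - 1, by omega⟩
    refine tw_induction₂ x (by simp only [map_zero]) (fun c c' w => ?_)
        (fun x y hx hy => by simp only [map_add, hx, hy])
    rw [rotate_succ_cons, splitAt_succ_cons, ih m (by omega), splitAt_succ_cons,
      splitAt_succ_cons, splitAt_succ_cons, rotate_succ_cons]

theorem rotate_deleteAt (j n : ℕ) (hj : j ≤ n) (x : TW k C M (n + 2)) :
    rotate k H C M n (deleteAt k C M (j + 1) (n + 1) x) =
      deleteAt k C M j (n + 1) (rotate k H C M (n + 1) x) := by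
  induction j generalizing n with
  | zero =>
    refine tw_induction₂ x (by simp only [map_zero]) (fun c c' w => ?_)
        (fun x y hx hy => by simp only [map_add, hx, hy])
    rw [rotate_succ_cons, deleteAt_zero_cons, deleteAt_succ_cons, deleteAt_zero_cons, cons_smul,
      map_smul]
  | succ j ih =>
    obtain ⟨m, rfl⟩ : ∃ m, n = m + 1 := ⟨n - 1, by omega⟩
    refine tw_induction₂ x (by simp only [map_zero]) (fun c c' w => ?_)
        (fun x y hx hy => by simp only [map_add, hx, hy])
    rw [rotate_succ_cons, deleteAt_succ_cons, deleteAt_succ_cons, deleteAt_succ_cons, ← ih m (by omega),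
      deleteAt_succ_cons, rotate_succ_cons]

theorem deleteAt_actCons [ModuleCoalgebra k H C] (c : C) (y : H ⊗[k] M) :
    (deleteAt k C M 0 0 (actCons c y) : M) = Coalgebra.counit (R := k) c •
      TensorProduct.lid k M ((Coalgebra.counit (R := k)).rTensor M y) := by
  induction y using TensorProduct.induction_on with
  | zero => simp only [map_zero, smul_zero]; rfl
  | add x y hx hy =>
    rw [map_add, map_add, map_add, map_add, smul_add]
    exact congrArg₂ (fun a b : M => a + b) hx hy
  | tmul h m =>
    refine (deleteAt_zero_cons (n := 0) (h • c) m).trans ?_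
    rw [ModuleCoalgebra.counit_smul, mul_comm, LinearMap.rTensor_tmul, TensorProduct.lid_tmul]
    exact mul_smul (Coalgebra.counit (R := k) c) (Coalgebra.counit (R := k) h) m

theorem deleteAt_rotate_zero [ModuleCoalgebra k H C] (c : C) (m : M) :
    deleteAt k C M 0 0 (rotate k H C M 0 (cons (n := 0) c m)) =
      deleteAt k C M 0 0 (cons (n := 0) c m) := by
  refine (congrArg _ (rotate_zero_cons c m)).trans ((deleteAt_actCons c _).trans ?_)
  rw [LeftComodule.counit_coact]
  rfl

theorem deleteAt_last_rotate [ModuleCoalgebra k H C] (n : ℕ) (x : TW k C M (n + 1)) :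
    deleteAt k C M n n (rotate k H C M n x) = deleteAt k C M 0 n x := by
  induction n with
  | zero =>
    refine tw_induction x (by simp only [map_zero]) (fun c w => ?_)
        (fun x y hx hy => by simp only [map_add, hx, hy])
    exact deleteAt_rotate_zero (H := H) (M := M) c w
  | succ n ih =>
    refine tw_induction₂ x (by simp only [map_zero]) (fun c c' w => ?_)
        (fun x y hx hy => by simp only [map_add, hx, hy])
    rw [rotate_succ_cons, deleteAt_succ_cons, ih, deleteAt_zero_cons, deleteAt_zero_cons, cons_smul]

/-- The map `h ⊗ (h' ⊗ m) ↦ h a ⊗ h' b ⊗ m`, linear in `a ⊗ b`. -/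
def actCons₂ : C ⊗[k] C →ₗ[k] H ⊗[k] (H ⊗[k] M) →ₗ[k] TW k C M 2 :=
  TensorProduct.lift (LinearMap.mk₂ k
    (fun a b => (TensorProduct.map ((actMap k H C) ∘ₗ (TensorProduct.mk k H C).flip a)
      (TensorProduct.map ((actMap k H C) ∘ₗ (TensorProduct.mk k H C).flip b) LinearMap.id) :
        H ⊗[k] (H ⊗[k] M) →ₗ[k] C ⊗[k] (C ⊗[k] M)))
    (fun a a' b => by
      simp only [map_add, LinearMap.comp_add, TensorProduct.map_add_left]
      rfl)
    (fun r a b => by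
      simp only [map_smul, LinearMap.comp_smul, TensorProduct.map_smul_left]
      rfl)
    (fun a b b' => by
      simp only [map_add, LinearMap.comp_add, TensorProduct.map_add_left, TensorProduct.map_add_right]
      rfl)
    (fun r a b => by
      simp only [map_smul, LinearMap.comp_smul, TensorProduct.map_smul_left,
        TensorProduct.map_smul_right]
      rfl))

theorem actCons₂_tmul (a b : C) (h h' : H) (m : M) :
    actCons₂ (k := k) (a ⊗ₜ[k] b) (h ⊗ₜ[k] (h' ⊗ₜ[k] m)) =
      cons (n := 1) (h • a) (cons (n := 0) (h' • b) m) := rfl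

theorem splitAt_actCons [ModuleCoalgebra k H C] (c : C) (y : H ⊗[k] M) :
    splitAt k C M 0 0 (actCons c y) = actCons₂ (Coalgebra.comul (R := k) c)
      (TensorProduct.assoc k H H M ((Coalgebra.comul (R := k)).rTensor M y)) := by
  induction y using TensorProduct.induction_on with
  | zero => simp only [map_zero]
  | add x y hx hy => simp only [map_add, hx, hy]
  | tmul h m =>
    refine (splitAt_zero_cons (n := 0) (h • c) m).trans ?_
    rw [ModuleCoalgebra.comul_smul, LinearMap.rTensor_tmul]
    simp only [tensorRep, AlgHom.comp_apply, Bialgebra.comulAlgHom_apply]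
    induction Coalgebra.comul (R := k) h using TensorProduct.induction_on with
    | zero => simp
    | add x y hx hy =>
      simp only [map_add, LinearMap.add_apply, TensorProduct.add_tmul, hx, hy]
    | tmul h h' =>
      induction Coalgebra.comul (R := k) c using TensorProduct.induction_on with
      | zero => simp
      | add x y hx hy => simp only [map_add, LinearMap.add_apply, hx, hy]
      | tmul a b => rfl

theorem rotate_rotate_cons₂ (m : M) (z : C ⊗[k] C) :
    rotate k H C M 1 (rotate k H C M 1 (cons₂ (n := 0) m z)) =
      actCons₂ z ((LeftComodule.coact (k := k) (H := H)).lTensor H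
        (LeftComodule.coact (k := k) (H := H) m)) := by
  induction z using TensorProduct.induction_on with
  | zero => simp
  | add x y hx hy => simp only [map_add, LinearMap.add_apply, hx, hy]
  | tmul a b =>
    refine (congrArg _ (rotate_succ_cons (n := 0) a b m)).trans ?_
    refine (congrArg (fun y => rotate k H C M 1 (cons (n := 1) b y)) (rotate_zero_cons a m)).trans ?_
    generalize LeftComodule.coact (k := k) (H := H) m = y
    induction y using TensorProduct.induction_on with
    | zero => simp only [map_zero, cons_zero]
    | add x y hx hy => simp only [map_add, cons_add, hx, hy]
    | tmul h m =>
      rw [LinearMap.lTensor_tmul]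
      refine (rotate_succ_cons (n := 0) b (h • a) m).trans ?_
      refine (congrArg (fun y => cons (n := 1) (h • a) y) (rotate_zero_cons b m)).trans ?_
      generalize LeftComodule.coact (k := k) (H := H) m = y
      induction y using TensorProduct.induction_on with
      | zero => simp only [map_zero, cons_zero, TensorProduct.tmul_zero]
      | add x y hx hy => simp only [map_add, cons_add, TensorProduct.tmul_add, hx, hy]
      | tmul h m => rfl

theorem splitAt_rotate_zero [ModuleCoalgebra k H C] (c : C) (m : M) :
    splitAt k C M 0 0 (rotate k H C M 0 (cons (n := 0) c m)) = rotate k H C M 1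
      (rotate k H C M 1 (splitAt k C M 0 0 (cons (n := 0) c m))) := by
  refine (congrArg _ (rotate_zero_cons c m)).trans ?_
  rw [splitAt_actCons, LeftComodule.coassoc]
  exact (rotate_rotate_cons₂ m _).symm

theorem splitAt_last_rotate [ModuleCoalgebra k H C] (n : ℕ) (x : TW k C M (n + 1)) :
    splitAt k C M n n (rotate k H C M n x) =
      rotate k H C M (n + 1) (rotate k H C M (n + 1) (splitAt k C M 0 n x)) := by
  induction n with
  | zero =>
    refine tw_induction x (by simp only [map_zero]) (fun c w => ?_)
        (fun x y hx hy => by simp only [map_add, hx, hy])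
    exact splitAt_rotate_zero (H := H) (M := M) c w
  | succ n ih =>
    refine tw_induction₂ x (by simp only [map_zero]) (fun c c' w => ?_)
        (fun x y hx hy => by simp only [map_add, hx, hy])
    rw [rotate_succ_cons, splitAt_succ_cons, ih, splitAt_zero_cons, splitAt_zero_cons]
    induction Coalgebra.comul (R := k) c using TensorProduct.induction_on with
    | zero => simp only [map_zero, cons_zero]
    | add x y hx hy => simp only [map_add, cons_add, hx, hy]
    | tmul a b => rfl

end Comodule

theorem act_splitAt [ModuleCoalgebra k H C] (j n : ℕ) (h : H) (x : TW k C M (n + 1)) :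
    splitAt k C M j n (actTW k H C M (n + 1) h x) =
      actTW k H C M (n + 2) h (splitAt k C M j n x) := by
  induction j generalizing n h with
  | zero =>
    have h1 := tensorRep_comm (W := TW k C M n) (W' := TW k C M n) (rep k H C)
      (actTW k H C M n) (tensorRep (rep k H C) (rep k H C)) (actTW k H C M n)
      (Coalgebra.comul (R := k)) LinearMap.id (fun h c => ModuleCoalgebra.comul_smul h c)
      (fun _ _ => rfl) h x
    refine (congrArg (TensorProduct.assoc k C C (TW k C M n)) h1).trans ?_
    exact tensorRep_assoc (V₃ := TW k C M n) _ _ _ h _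
  | succ j ih =>
    cases n with
    | zero => exact (map_zero (actTW k H C M 2 h)).symm
    | succ n =>
      exact tensorRep_comm (W := TW k C M (n + 1)) (W' := TW k C M (n + 2)) (rep k H C)
        (actTW k H C M (n + 1)) (rep k H C)
        (actTW k H C M (n + 2)) LinearMap.id (splitAt k C M j n) (fun _ _ => rfl)
        (fun h x => ih n h x) h x

theorem act_deleteAt [ModuleCoalgebra k H C] (j n : ℕ) (h : H) (x : TW k C M (n + 1)) :
    deleteAt k C M j n (actTW k H C M (n + 1) h x) =
      actTW k H C M n h (deleteAt k C M j n x) := by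
  induction j generalizing n h with
  | zero =>
    exact tensorRep_lid (W := TW k C M n) (rep k H C) (actTW k H C M n)
      (Coalgebra.counit (R := k)) (fun h c => ModuleCoalgebra.counit_smul h c) h x
  | succ j ih =>
    cases n with
    | zero => exact (map_zero (actTW k H C M 0 h)).symm
    | succ n =>
      exact tensorRep_comm (W := TW k C M (n + 1)) (W' := TW k C M n) (rep k H C)
        (actTW k H C M (n + 1)) (rep k H C)
        (actTW k H C M n) LinearMap.id (deleteAt k C M j n) (fun _ _ => rfl)
        (fun h x => ih n h x) h x

end TensorModule

section Rotation

set_option linter.unusedSectionVars false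

variable {k : Type u} [Field k] {H : Type v} [Ring H] [Bialgebra k H]
  {C : Type u} [AddCommGroup C] [Module k C] [Coalgebra k C] [Module H C] [IsScalarTower k H C]
  {M : Type u} [AddCommGroup M] [Module k M] [Module H M] [IsScalarTower k H M]
  [LeftComodule k H M]

variable (k C M) in
/-- `c ⊗ (c⁰ ⊗ ⋯) ↦ c⁰ ⊗ ⋯ ⊗ cᵖ⁻¹ ⊗ c ⊗ cᵖ ⊗ ⋯`. -/
def insertAt : ℕ → ∀ n, TW k C M (n + 1) →ₗ[k] TW k C M (n + 1)
  | 0, _ => LinearMap.id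
  | _ + 1, 0 => LinearMap.id
  | p + 1, n + 1 =>
    behind k C M (insertAt p n) ∘ₗ (TensorProduct.leftComm k C C (TW k C M n)).toLinearMap

theorem insertAt_succ_cons {p n : ℕ} (c c' : C) (w : TW k C M n) :
    insertAt k C M (p + 1) (n + 1) (cons c (cons c' w)) = cons c' (insertAt k C M p n (cons c w)) :=
  rfl

theorem insertAt_zero {n : ℕ} (x : TW k C M (n + 1)) : insertAt k C M 0 n x = x := rfl

variable (k H C M) in
/-- The coaction `c⁰ ⊗ ⋯ ⊗ m ↦ m₍₋₁₎ ⊗ (c⁰ ⊗ ⋯ ⊗ m₍₀₎)`. -/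
def coactTW : ∀ n, TW k C M n →ₗ[k] H ⊗[k] TW k C M n
  | 0 => LeftComodule.coact (k := k) (H := H) (M := M)
  | n + 1 => (TensorProduct.leftComm k C H (TW k C M n)).toLinearMap ∘ₗ (coactTW n).lTensor C

/-- The map `w ↦ c ⊗ w`. -/
def consMap {n : ℕ} (c : C) : TW k C M n →ₗ[k] TW k C M (n + 1) :=
  TensorProduct.mk k C (TW k C M n) c

theorem consMap_apply {n : ℕ} (c : C) (w : TW k C M n) : consMap c w = cons c w := rfl

theorem coactTW_cons {n : ℕ} (c : C) (w : TW k C M n) :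
    coactTW k H C M (n + 1) (cons c w) = (consMap c).lTensor H (coactTW k H C M n w) := by
  change TensorProduct.leftComm k C H (TW k C M n) (c ⊗ₜ[k] coactTW k H C M n w) = _
  induction coactTW k H C M n w using TensorProduct.induction_on with
  | zero => simp only [map_zero, TensorProduct.tmul_zero]; rfl
  | add x y hx hy => rw [TensorProduct.tmul_add, map_add, map_add, hx, hy]; rfl
  | tmul h w => rfl

theorem coactTW_coassoc (n : ℕ) (w : TW k C M n) :
    TensorProduct.assoc k H H (TW k C M n)
      ((Coalgebra.comul (R := k)).rTensor (TW k C M n) (coactTW k H C M n w)) =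
      (coactTW k H C M n).lTensor H (coactTW k H C M n w) := by
  induction n with
  | zero => exact LeftComodule.coassoc (k := k) (H := H) (M := M) w
  | succ n ih =>
    refine tw_induction w (by simp only [map_zero]) (fun c w => ?_)
      (fun x y hx hy => by simp only [map_add, hx, hy])
    have h1 : ∀ y : H ⊗[k] TW k C M n, TensorProduct.assoc k H H (TW k C M (n + 1))
        ((Coalgebra.comul (R := k)).rTensor (TW k C M (n + 1)) ((consMap c).lTensor H y)) =
        ((consMap c).lTensor H).lTensor H (TensorProduct.assoc k H H (TW k C M n)
          ((Coalgebra.comul (R := k)).rTensor (TW k C M n) y)) := by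
      intro y
      induction y using TensorProduct.induction_on with
      | zero => simp only [map_zero]
      | add x y hx hy => simp only [map_add, hx, hy]
      | tmul h w =>
        simp only [LinearMap.lTensor_tmul, LinearMap.rTensor_tmul]
        induction Coalgebra.comul (R := k) h using TensorProduct.induction_on with
        | zero => simp only [map_zero, TensorProduct.zero_tmul]
        | add x y hx hy => simp only [map_add, TensorProduct.add_tmul, hx, hy]
        | tmul a b => rfl
    have h2 : ∀ y : H ⊗[k] TW k C M n,
        (coactTW k H C M (n + 1)).lTensor H ((consMap c).lTensor H y) =
        ((consMap c).lTensor H).lTensor H ((coactTW k H C M n).lTensor H y) := by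
      intro y
      induction y using TensorProduct.induction_on with
      | zero => simp only [map_zero]
      | add x y hx hy => simp only [map_add, hx, hy]
      | tmul h w =>
        simp only [LinearMap.lTensor_tmul, consMap_apply, coactTW_cons]
    rw [coactTW_cons, h1, h2, ih]

theorem counit_coactTW (n : ℕ) (w : TW k C M n) :
    TensorProduct.lid k (TW k C M n)
      ((Coalgebra.counit (R := k)).rTensor (TW k C M n) (coactTW k H C M n w)) = w := by
  induction n with
  | zero => exact LeftComodule.counit_coact (k := k) (H := H) (M := M) w
  | succ n ih =>
    refine tw_induction w (by simp only [map_zero]) (fun c w => ?_)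
      (fun x y hx hy => by simp only [map_add, hx, hy])
    have h1 : ∀ y : H ⊗[k] TW k C M n, TensorProduct.lid k (TW k C M (n + 1))
        ((Coalgebra.counit (R := k)).rTensor (TW k C M (n + 1)) ((consMap c).lTensor H y)) =
        consMap c (TensorProduct.lid k (TW k C M n)
          ((Coalgebra.counit (R := k)).rTensor (TW k C M n) y)) := by
      intro y
      induction y using TensorProduct.induction_on with
      | zero => simp only [map_zero]
      | add x y hx hy => simp only [map_add, hx, hy]
      | tmul h w =>
        simp only [LinearMap.lTensor_tmul, LinearMap.rTensor_tmul, TensorProduct.lid_tmul, map_smul]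
    rw [coactTW_cons, h1, ih, consMap_apply]

/-- The map `h ⊗ w ↦ h c ⊗ w`. -/
def actFirst {n : ℕ} (c : C) : H ⊗[k] TW k C M n →ₗ[k] TW k C M (n + 1) :=
  (LinearMap.rTensor (TW k C M n) (actMap k H C ∘ₗ (TensorProduct.mk k H C).flip c) :
    H ⊗[k] TW k C M n →ₗ[k] C ⊗[k] TW k C M n)

theorem actFirst_tmul {n : ℕ} (c : C) (h : H) (w : TW k C M n) :
    actFirst (k := k) c (h ⊗ₜ[k] w) = cons (h • c) w := rfl

theorem rotate_cons (n : ℕ) (c : C) (w : TW k C M n) :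
    rotate k H C M n (cons c w) = insertAt k C M n n (actFirst c (coactTW k H C M n w)) := by
  induction n with
  | zero => exact rotate_zero_cons (H := H) (M := M) c w
  | succ n ih =>
    refine tw_induction w (by simp only [map_zero, cons_zero]) (fun c' w => ?_)
      (fun x y hx hy => by simp only [map_add, cons_add, hx, hy])
    rw [rotate_succ_cons, ih, coactTW_cons]
    induction coactTW k H C M n w using TensorProduct.induction_on with
    | zero => simp only [map_zero, cons_zero]
    | add x y hx hy => simp only [map_add, cons_add, hx, hy]
    | tmul h w => rfl

theorem rotate_insertAt (p n : ℕ) (hp : p ≤ n) (c : C) (w : TW k C M (n + 1)) :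
    rotate k H C M (n + 1) (insertAt k C M (p + 1) (n + 1) (cons c w)) =
      insertAt k C M p (n + 1) (cons c (rotate k H C M n w)) := by
  induction p generalizing n with
  | zero =>
    refine tw_induction w (by simp only [map_zero, cons_zero]) (fun c' w => ?_)
      (fun x y hx hy => by simp only [map_add, cons_add, hx, hy])
    rfl
  | succ p ih =>
    obtain ⟨m, rfl⟩ : ∃ m, n = m + 1 := ⟨n - 1, by omega⟩
    refine tw_induction₂ w (by simp only [map_zero, cons_zero]) (fun d d' w => ?_)
      (fun x y hx hy => by simp only [map_add, cons_add, hx, hy])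
    rw [insertAt_succ_cons, insertAt_succ_cons, rotate_succ_cons, ← insertAt_succ_cons,
      ih m (by omega), rotate_succ_cons, insertAt_succ_cons]

theorem iterate_rotate_insertAt (p n : ℕ) (hp : p ≤ n + 1) (c : C) (w : TW k C M (n + 1)) :
    (rotate k H C M (n + 1))^[p] (insertAt k C M p (n + 1) (cons c w)) =
      cons c ((rotate k H C M n)^[p] w) := by
  induction p generalizing w with
  | zero => rfl
  | succ p ih =>
    rw [Function.iterate_succ_apply, Function.iterate_succ_apply, rotate_insertAt p n (by omega),
      ih (by omega)]

variable (k H C M) in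
/-- The action map `h ⊗ w ↦ h w`. -/
def actMapTW (n : ℕ) : H ⊗[k] TW k C M n →ₗ[k] TW k C M n :=
  TensorProduct.lift (actTW k H C M n).toLinearMap

variable (k H C M) in
/-- The full rotation of `C ⊗ ⋯ ⊗ C ⊗ M` with `n` factors `C`. -/
def fullRotate : ∀ n, TW k C M n →ₗ[k] TW k C M n
  | 0 => LinearMap.id
  | n + 1 => rotate k H C M n ^ (n + 1)

theorem fullRotate_cons (n : ℕ) (c : C) (w : TW k C M n) :
    fullRotate k H C M (n + 1) (cons c w) =
      actFirst c ((fullRotate k H C M n).lTensor H (coactTW k H C M n w)) := by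
  change (rotate k H C M n ^ (n + 1)) (cons c w) = _
  rw [pow_succ, Module.End.mul_apply, rotate_cons]
  induction coactTW k H C M n w using TensorProduct.induction_on with
  | zero => simp only [map_zero]
  | add x y hx hy => simp only [map_add, hx, hy]
  | tmul h w =>
    rw [LinearMap.lTensor_tmul, actFirst_tmul, actFirst_tmul]
    cases n with
    | zero => rfl
    | succ n =>
      rw [Module.End.pow_apply, iterate_rotate_insertAt (n + 1) n le_rfl]
      exact congrArg _ (Module.End.pow_apply _ _ _).symm

/-- Over a stable module/comodule the full rotation is `x ↦ x₍₋₁₎ x₍₀₎`. -/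
theorem fullRotate_eq (hM : IsStable k H M) (n : ℕ) (w : TW k C M n) :
    fullRotate k H C M n w = actMapTW k H C M n (coactTW k H C M n w) := by
  induction n with
  | zero => exact (hM w).symm
  | succ n ih =>
    refine tw_induction w (by simp only [map_zero]) (fun c w => ?_)
      (fun x y hx hy => by simp only [map_add, hx, hy])
    have h0 : fullRotate k H C M n = actMapTW k H C M n ∘ₗ coactTW k H C M n := LinearMap.ext ih
    rw [fullRotate_cons, h0, LinearMap.lTensor_comp, LinearMap.comp_apply, ← coactTW_coassoc,
      coactTW_cons]
    induction coactTW k H C M n w using TensorProduct.induction_on with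
    | zero => simp only [map_zero]
    | add x y hx hy => simp only [map_add, hx, hy]
    | tmul h w =>
      rw [LinearMap.rTensor_tmul, LinearMap.lTensor_tmul]
      change _ = tensorRep (W := TW k C M n) (rep k H C) (actTW k H C M n) h (c ⊗ₜ[k] w)
      simp only [tensorRep, AlgHom.comp_apply, Bialgebra.comulAlgHom_apply]
      induction Coalgebra.comul (R := k) h using TensorProduct.induction_on with
      | zero => simp only [map_zero, TensorProduct.zero_tmul]; rfl
      | add x y hx hy =>
        rw [TensorProduct.add_tmul, map_add, map_add, map_add, hx, hy, map_add, map_add]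
        rfl
      | tmul a b => rfl

end Rotation

section CofaceOperators

set_option linter.unusedSectionVars false

variable (k : Type u) [Field k] (H : Type v) [Ring H] [Bialgebra k H]
  (C : Type u) [AddCommGroup C] [Module k C] [Coalgebra k C] [Module H C] [IsScalarTower k H C]
  (M : Type u) [AddCommGroup M] [Module k M] [Module H M] [IsScalarTower k H M]
  [LeftComodule k H M]

/-- The cofaces: `∂ᵢ` is the comultiplication of `cⁱ` for `i ≤ n`, and
`∂ₙ₊₁ (c⁰ ⊗ ⋯ ⊗ cⁿ ⊗ m) = c⁰₍₂₎ ⊗ c¹ ⊗ ⋯ ⊗ cⁿ ⊗ m₍₋₁₎ c⁰₍₁₎ ⊗ m₍₀₎`. -/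
def coface (n i : ℕ) : TW k C M (n + 1) →ₗ[k] TW k C M (n + 2) :=
  if i ≤ n then splitAt k C M i n else rotate k H C M (n + 1) ∘ₗ splitAt k C M 0 n

variable {k H C M}

theorem coface_le {n i : ℕ} (h : i ≤ n) (x : TW k C M (n + 1)) :
    coface k H C M n i x = splitAt k C M i n x := by simp only [coface, h, if_true]

theorem coface_last {n i : ℕ} (h : i = n + 1) (x : TW k C M (n + 1)) :
    coface k H C M n i x = rotate k H C M (n + 1) (splitAt k C M 0 n x) := by
  have h' : ¬ i ≤ n := by omega
  simp only [coface, h', if_false, LinearMap.comp_apply]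

end CofaceOperators

/-- The pseudo-para-cocyclic `H`-module `T(C, M)` with `Tₙ(C, M) = C^{⊗ n+1} ⊗ M`, the diagonal
action of `H`, the cofaces `coface`, the codegeneracies
`σⱼ (c⁰ ⊗ ⋯ ⊗ cⁿ⁺¹ ⊗ m) = ε(cʲ⁺¹) (c⁰ ⊗ ⋯ ⊗ cʲ ⊗ cʲ⁺² ⊗ ⋯ ⊗ cⁿ⁺¹ ⊗ m)` and the cyclic operators
`τₙ (c⁰ ⊗ ⋯ ⊗ cⁿ ⊗ m) = c¹ ⊗ ⋯ ⊗ cⁿ ⊗ m₍₋₁₎ c⁰ ⊗ m₍₀₎`. -/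
def tensorModule {k : Type u} [Field k] {H : Type v} [Ring H] [Bialgebra k H] (P : HopfPair k H) :
    PPCModule k H where
  X n := TW k P.C P.M (n + 1)
  act n := actTW k H P.C P.M (n + 1)
  δ n i := coface k H P.C P.M n i
  σ n j := deleteAt k P.C P.M (j + 1) (n + 1)
  τ n := rotate k H P.C P.M n
  δ_δ n i j h x := by
    have h' : (i : ℕ) ≤ j := h
    have hj := j.2
    simp only [Fin.val_castSucc, Fin.val_succ]
    rcases Nat.lt_or_ge n j with hn | hn
    · have hj' : (j : ℕ) = n + 1 := by omega
      rw [coface_last hj', coface_last (i := (j : ℕ) + 1) (by omega),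
        coface_le (n := n + 1) (by omega)]
      rcases Nat.lt_or_ge n i with hi | hi
      · have hi' : (i : ℕ) = n + 1 := by omega
        rw [coface_last hi', hi', splitAt_last_rotate, rotate_splitAt 0 n (by omega),
          splitAt_splitAt 0 0 n le_rfl (by omega)]
      · rw [coface_le hi, rotate_splitAt i n hi, splitAt_splitAt 0 i n (by omega) hi]
    · rw [coface_le hn, coface_le (by omega), coface_le (by omega), coface_le (by omega)]
      exact splitAt_splitAt i j n h' hn x
  σ_σ n i j h x := deleteAt_deleteAt (i + 1) (j + 1) (n + 1) (Nat.succ_le_succ h) (by omega) x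
  δ_σ_self n i x := by
    rw [Fin.val_castSucc, coface_le (by omega)]
    exact deleteAt_succ_splitAt i n (by omega) x
  δ_σ_succ n i x := by
    have hi := i.2
    rw [Fin.val_succ]
    rcases Nat.lt_or_ge i n with h | h
    · rw [coface_le (by omega)]
      exact deleteAt_splitAt_self (i + 1) n (by omega) x
    · have hi' : (i : ℕ) = n := by omega
      rw [coface_last (by omega), hi', deleteAt_last_rotate, deleteAt_splitAt_self 0 n (by omega)]
  σ_δ_le n i j h x := by
    have h' : (i : ℕ) ≤ j := h
    have hj := j.2
    simp only [Fin.val_castSucc, Fin.val_succ]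
    rw [coface_le (by omega), coface_le (by omega)]
    exact splitAt_deleteAt_lt i (j + 1) n (by omega) (by omega) x
  σ_δ_gt n i j h x := by
    have h' : (j : ℕ) < i := h
    have hi := i.2
    simp only [Fin.val_castSucc, Fin.val_succ]
    rcases Nat.lt_or_ge n i with hn | hn
    · rw [coface_last (by omega), coface_last (by omega),
        splitAt_deleteAt_lt 0 (j + 1) n (by omega) (by omega),
        rotate_deleteAt (j + 1) (n + 1) (by omega)]
    · rw [coface_le hn, coface_le (by omega)]
      exact splitAt_deleteAt_ge i (j + 1) n (by omega) hn x
  τ_δ n i x := by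
    have hi := i.2
    rw [Fin.val_castSucc, Fin.val_succ, coface_le (by omega)]
    rcases Nat.lt_or_ge i n with h | h
    · obtain ⟨m, rfl⟩ : ∃ m, n = m + 1 := ⟨n - 1, by omega⟩
      rw [coface_le (by omega)]
      exact rotate_splitAt i m (by omega) x
    · have hi' : (i : ℕ) = n := by omega
      rw [coface_last (by omega), hi', splitAt_last_rotate]
  δ_last n x := by
    rw [coface_last (by simp), coface_le (by simp)]
    rfl
  σ_τ n j x := rotate_deleteAt (j + 1) n (by omega) x
  σ_τ_zero n x := by
    refine (rotate_deleteAt 0 n (by omega) x).trans ?_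
    exact (deleteAt_last_rotate (n + 1) _).symm
  act_δ n i h x := by
    rw [Fin.val_castSucc, coface_le (by omega), coface_le (by omega)]
    exact act_splitAt i n h x
  act_σ n j h x := act_deleteAt (j + 1) (n + 1) h x

section Functoriality

set_option linter.unusedSectionVars false

variable {k : Type u} [Field k] {H : Type v} [Ring H] [Bialgebra k H] {P Q : HopfPair k H}

/-- The map `c⁰ ⊗ ⋯ ⊗ m ↦ f(c⁰) ⊗ ⋯ ⊗ f(m)`. -/
def mapTW (f : P.Hom Q) : ∀ n, TW k P.C P.M n →ₗ[k] TW k Q.C Q.M n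
  | 0 => f.onM
  | n + 1 => (TensorProduct.map f.onC (mapTW f n) :
      P.C ⊗[k] TW k P.C P.M n →ₗ[k] Q.C ⊗[k] TW k Q.C Q.M n)

theorem mapTW_cons (f : P.Hom Q) {n : ℕ} (c : P.C) (w : TW k P.C P.M n) :
    mapTW f (n + 1) (cons c w) = cons (f.onC c) (mapTW f n w) := rfl

theorem mapTW_cons₂ (f : P.Hom Q) {n : ℕ} (w : TW k P.C P.M n) (z : P.C ⊗[k] P.C) :
    mapTW f (n + 2) (cons₂ w z) = cons₂ (mapTW f n w) (TensorProduct.map f.onC f.onC z) := by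
  induction z using TensorProduct.induction_on with
  | zero => simp only [map_zero]
  | add x y hx hy => simp only [map_add, hx, hy]
  | tmul a b => rfl

theorem mapTW_splitAt (f : P.Hom Q) (j n : ℕ) (x : TW k P.C P.M (n + 1)) :
    mapTW f (n + 2) (splitAt k P.C P.M j n x) = splitAt k Q.C Q.M j n (mapTW f (n + 1) x) := by
  induction j generalizing n with
  | zero =>
    refine tw_induction x (by simp only [map_zero]) (fun c w => ?_)
      (fun x y hx hy => by simp only [map_add, hx, hy])
    rw [splitAt_zero_cons, mapTW_cons₂, mapTW_cons, splitAt_zero_cons, f.comul_onC]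
  | succ j ih =>
    cases n with
    | zero => exact map_zero (mapTW f 2)
    | succ n =>
      refine tw_induction x (by simp only [map_zero]) (fun c w => ?_)
        (fun x y hx hy => by simp only [map_add, hx, hy])
      rw [splitAt_succ_cons, mapTW_cons, mapTW_cons, splitAt_succ_cons, ih]

theorem mapTW_deleteAt (f : P.Hom Q) (j n : ℕ) (x : TW k P.C P.M (n + 1)) :
    mapTW f n (deleteAt k P.C P.M j n x) = deleteAt k Q.C Q.M j n (mapTW f (n + 1) x) := by
  induction j generalizing n with
  | zero =>
    refine tw_induction x (by simp only [map_zero]) (fun c w => ?_)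
      (fun x y hx hy => by simp only [map_add, hx, hy])
    rw [deleteAt_zero_cons, mapTW_cons, deleteAt_zero_cons, f.counit_onC, map_smul]
  | succ j ih =>
    cases n with
    | zero => exact map_zero (mapTW f 0)
    | succ n =>
      refine tw_induction x (by simp only [map_zero]) (fun c w => ?_)
        (fun x y hx hy => by simp only [map_add, hx, hy])
      rw [deleteAt_succ_cons, mapTW_cons, mapTW_cons, deleteAt_succ_cons, ih]

theorem mapTW_rotate_zero (f : P.Hom Q) (c : P.C) (m : P.M) :
    mapTW f 1 (rotate k H P.C P.M 0 (cons (n := 0) c m)) =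
      rotate k H Q.C Q.M 0 (cons (n := 0) (f.onC c) (f.onM m)) := by
  have h1 : ∀ y : H ⊗[k] P.M,
      mapTW f 1 (actCons c y) = actCons (M := Q.M) (f.onC c) (f.onM.lTensor H y) := by
    intro y
    induction y using TensorProduct.induction_on with
    | zero => simp only [map_zero]
    | add x y hx hy => simp only [map_add, hx, hy]
    | tmul h m =>
      exact congrArg (fun z => cons (n := 0) z (f.onM m)) (f.onC_smul h c)
  refine (congrArg _ (rotate_zero_cons (H := H) (M := P.M) c m)).trans ((h1 _).trans ?_)
  rw [← f.coact_onM]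
  exact (rotate_zero_cons (H := H) (M := Q.M) (f.onC c) (f.onM m)).symm

theorem mapTW_rotate (f : P.Hom Q) (n : ℕ) (x : TW k P.C P.M (n + 1)) :
    mapTW f (n + 1) (rotate k H P.C P.M n x) = rotate k H Q.C Q.M n (mapTW f (n + 1) x) := by
  induction n with
  | zero =>
    refine tw_induction x (by simp only [map_zero]) (fun c w => ?_)
      (fun x y hx hy => by simp only [map_add, hx, hy])
    exact mapTW_rotate_zero f c w
  | succ n ih =>
    refine tw_induction₂ x (by simp only [map_zero]) (fun c c' w => ?_)
      (fun x y hx hy => by simp only [map_add, hx, hy])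
    rw [rotate_succ_cons, mapTW_cons, ih, mapTW_cons, mapTW_cons, mapTW_cons, rotate_succ_cons]

theorem mapTW_act (f : P.Hom Q) (n : ℕ) (h : H) (x : TW k P.C P.M n) :
    mapTW f n (actTW k H P.C P.M n h x) = actTW k H Q.C Q.M n h (mapTW f n x) := by
  induction n generalizing h with
  | zero => exact f.onM_smul h x
  | succ n ih =>
    exact tensorRep_comm (W := TW k P.C P.M n) (W' := TW k Q.C Q.M n) (rep k H P.C)
      (actTW k H P.C P.M n) (rep k H Q.C) (actTW k H Q.C Q.M n) f.onC (mapTW f n)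
      f.onC_smul (fun h x => ih h x) h x

theorem mapTW_coface (f : P.Hom Q) (n i : ℕ) (hi : i ≤ n + 1) (x : TW k P.C P.M (n + 1)) :
    mapTW f (n + 2) (coface k H P.C P.M n i x) = coface k H Q.C Q.M n i (mapTW f (n + 1) x) := by
  rcases Nat.lt_or_ge n i with h | h
  · rw [coface_last (by omega), coface_last (by omega), mapTW_rotate, mapTW_splitAt]
  · rw [coface_le h, coface_le h, mapTW_splitAt]

/-- Functoriality of `T(C, M)`. -/
def tensorModuleMap (f : P.Hom Q) : (tensorModule P).Hom (tensorModule Q) where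
  f n := mapTW f (n + 1)
  act n h x := mapTW_act f (n + 1) h x
  δ n i x := mapTW_coface f n i (by omega) x
  σ n j x := mapTW_deleteAt f (j + 1) (n + 1) x
  τ n x := mapTW_rotate f n x

end Functoriality

/-! ## Hopf cyclic cohomology -/

section HopfCyclic

variable {k : Type u} [Field k] {H : Type v} [Ring H] [Bialgebra k H]

/-- The pair `(C, M)` is stable if `M` is. -/
def HopfPair.Stable (P : HopfPair k H) : Prop := IsStable k H P.M

open PPCModule

theorem cls_act_coinv (X : PPCModule k H) (n : ℕ) (h : H) (x : X.X n) :
    X.cls X.CoinvRel n (X.act n h x) = X.cls X.CoinvRel n (Coalgebra.counit (R := k) h • x) :=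
  X.cls_eq _ n _ _ (Generated.of n _ ⟨h, x, rfl⟩)

/-- For a stable pair, the cyclic operators of `k ⊗_H PCM` satisfy `τₙⁿ⁺¹ = id`, where `PCM` is the
largest para-cocyclic quotient of `T(C, M)`. -/
theorem coinv_paraQuot_isPeriodic (P : HopfPair k H) (hP : P.Stable) :
    (tensorModule P).paraQuot.coinv.IsPeriodic := by
  intro n x
  obtain ⟨x, rfl⟩ := Submodule.Quotient.mk_surjective _ x
  obtain ⟨x, rfl⟩ := Submodule.Quotient.mk_surjective _ x
  refine (cls_iterate_τ _ _ n (n + 1) _).trans ?_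
  refine (congrArg _ (cls_iterate_τ (tensorModule P) _ n (n + 1) x)).trans ?_
  have h1 : ((tensorModule P).τ n)^[n + 1] x =
      actMapTW k H P.C P.M (n + 1) (coactTW k H P.C P.M (n + 1) x) :=
    (Module.End.pow_apply (rotate k H P.C P.M n) (n + 1) x).symm.trans
      (fullRotate_eq hP (n + 1) x)
  rw [h1]
  have h2 : ∀ y : H ⊗[k] TW k P.C P.M (n + 1),
      (tensorModule P).paraQuot.cls (tensorModule P).paraQuot.CoinvRel n
        ((tensorModule P).cls (tensorModule P).ParaRel n (actMapTW k H P.C P.M (n + 1) y)) =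
      (tensorModule P).paraQuot.cls (tensorModule P).paraQuot.CoinvRel n
        ((tensorModule P).cls (tensorModule P).ParaRel n
          (TensorProduct.lid k (TW k P.C P.M (n + 1))
            ((Coalgebra.counit (R := k)).rTensor (TW k P.C P.M (n + 1)) y))) := by
    intro y
    induction y using TensorProduct.induction_on with
    | zero => simp only [map_zero]
    | add x y hx hy =>
      simp only [map_add]
      exact congrArg₂ (fun a b => a + b) hx hy
    | tmul h w => exact cls_act_coinv (tensorModule P).paraQuot n h (cls _ _ n w)
  refine (h2 _).trans ?_
  exact congrArg (fun y => (tensorModule P).paraQuot.cls _ n ((tensorModule P).cls _ n y))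
    (counit_coactTW (n + 1) x)

/-- The cocyclic `k`-module `C_•(C, M) = k ⊗_H Q`, where `Q` is the largest cocyclic `H`-module
quotient of `T(C, M)`. -/
def cocyclicHopf (P : HopfPair k H) : CocyclicMod k :=
  (tensorModule P).cycQuot.coinv.toCocyclicMod (quot_isPeriodic _ _ (cycQuot_isPeriodic _))

/-- Functoriality of `C_•(C, M)`. -/
def cocyclicHopfMap {P Q : HopfPair k H} (f : P.Hom Q) : cocyclicHopf P ⟶ cocyclicHopf Q :=
  toCocyclicModMap _ _ (coinvMap (cycQuotMap (tensorModuleMap f)))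

/-- The bivariant Hopf cyclic cohomology groups `HCⁿ_Hopf(C, C'; M, M') =
Extⁿ(C_•(C, M), C_•(C', M'))`, with `Ext` in the category of cocyclic `k`-modules. -/
abbrev HCHopf (P Q : HopfPair k H) (n : ℕ) : Type (u + 1) :=
  Abelian.Ext.{u + 1} (cocyclicHopf P) (cocyclicHopf Q) n

/-- The cocyclic `k`-module `k ⊗_H PCM` of the triple `(C, H, M)` with `M` stable, where `PCM` is
the largest para-cocyclic `H`-module quotient of `T(C, M)`. -/
def tripleModule (P : HopfPair k H) (hP : P.Stable) : CocyclicMod k :=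
  (tensorModule P).paraQuot.coinv.toCocyclicMod (coinv_paraQuot_isPeriodic P hP)

/-- Functoriality of the cocyclic `k`-module of a triple. -/
def tripleModuleMap {P Q : HopfPair k H} (hP : P.Stable) (hQ : Q.Stable) (f : P.Hom Q) :
    tripleModule P hP ⟶ tripleModule Q hQ :=
  toCocyclicModMap _ _ (coinvMap (paraQuotMap (tensorModuleMap f)))

/-- The Hopf cyclic cohomology of the triple `(C, H, M)`. -/
noncomputable def hopfCyclic (P : HopfPair k H) (hP : P.Stable) (n : ℕ) : ModuleCat.{u} k :=
  (HC k n).obj (tripleModule P hP)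

variable (k H)

/-- The pair `(k, k)`, with `H` acting through the counit and coacting through the unit. -/
def trivialPair : HopfPair k H :=
  letI : Module H k := Module.compHom k (Bialgebra.counitAlgHom k H).toRingHom
  haveI smul_def : ∀ (h : H) (x : k), h • x = Coalgebra.counit (R := k) h * x := fun _ _ => rfl
  haveI : IsScalarTower k H k := ⟨fun a h x => by
    rw [smul_def, smul_def, map_smul, smul_eq_mul, smul_eq_mul, mul_assoc]⟩
  haveI : ModuleCoalgebra k H k :=
    { comul_smul := fun h c => by
        have key : ∀ z : H ⊗[k] H, (Module.endTensorEndAlgHom (R := k) (S := k) (A := k)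
            (Algebra.TensorProduct.map (rep k H k) (rep k H k) z)) ((1 : k) ⊗ₜ[k] c) =
            (1 : k) ⊗ₜ[k] (Coalgebra.counit (R := k) (TensorProduct.lid k H
              ((Coalgebra.counit (R := k)).rTensor H z)) * c) := by
          intro z
          induction z using TensorProduct.induction_on with
          | zero => simp
          | add x y hx hy =>
            simp only [map_add, LinearMap.add_apply, hx, hy, add_mul, TensorProduct.tmul_add]
          | tmul a b =>
            have h1 : ((a • (1 : k) : k)) = Coalgebra.counit (R := k) a * 1 := rfl
            have h2 : ((b • c : k)) = Coalgebra.counit (R := k) b * c := rfl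
            simp only [LinearMap.rTensor_tmul, TensorProduct.lid_tmul, map_smul, smul_eq_mul]
            change (a • (1 : k)) ⊗ₜ[k] (b • c) = _
            rw [h1, h2, ← smul_eq_mul (Coalgebra.counit (R := k) a) (1 : k),
              TensorProduct.smul_tmul, smul_eq_mul, mul_assoc]
        have h3 := key (Coalgebra.comul (R := k) h)
        rw [Coalgebra.rTensor_counit_comul] at h3
        simp only [TensorProduct.lid_tmul, one_smul] at h3
        change Coalgebra.comul (R := k) (Coalgebra.counit (R := k) h * c) =
          (Module.endTensorEndAlgHom (R := k) (S := k) (A := k)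
            (Algebra.TensorProduct.map (rep k H k) (rep k H k) (Coalgebra.comul (R := k) h)))
              (Coalgebra.comul (R := k) c)
        rw [CommSemiring.comul_apply, CommSemiring.comul_apply]
        exact h3.symm
      counit_smul := fun h c => rfl }
  letI : LeftComodule k H k :=
    { coact := TensorProduct.mk k H k 1
      coassoc := fun m => by
        simp [Algebra.TensorProduct.one_def]
      counit_coact := fun m => by simp }
  { C := k, M := k }

theorem trivialPair_stable : (trivialPair k H).Stable := by
  intro m
  change (Bialgebra.counitAlgHom k H) 1 • m = m
  rw [map_one, one_smul]

end HopfCyclic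

end BivariantHopf

-- The pair (k, k) gives the constant cocyclic module k (`trivialPairIso`). The theorem thus reduces
-- to two statements about an arbitrary cocyclic module Y, namely Extⁿ(k, Y) = HCⁿ(Y) and Extⁿ(Y, k)
-- = HCⁿ(Y^∨), together with the identification, for stable M, of C_•(C, M) with the module of the
-- triple.
--
-- For the first statement, the degree n part ⨁_{q ≤ n} Y_q of the total complex is, by Yoneda, the
-- space of morphisms to Y from the projective module `freeOn k n` = ⨁_{q ≤ n} k[Λ([q], -)]. The
-- total differential is natural in Y, so it is induced by morphisms `freeD`. If the resulting
-- complex resolves k, then Ext(k, Y) is computed by the total complex of Y itself. Exactness is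
-- tested by mapping into the modules `functionsTo` of functions on Λ(-, [m]), which cogenerate
-- because linear forms over a field separate points. What remains is that the total complex of
-- `functionsTo` has only the constants as cohomology, in degree 0.
--
-- This is a calculation in Λ. Every morphism [q] → [m] is uniquely a power τᵃ followed by a
-- morphism of the simplex category (`Lam.exists_factorization`, `Lam.factorization_unique`). Hence
-- Z/(q+1) acts freely on Λ([q], [m]) and the rows of the double complex are exact in positive
-- columns (`functionsTo.exists_horiz_eq`). The invariant cochains that are left are functions on
-- Δ([q], [m]), that is, simplicial cochains of the m-simplex, and the cone over the vertex 0
-- contracts these (`functionsTo.exists_vert_eq`, `functionsTo.eq_const`). The total complex is then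
-- handled row by row in `exists_totD_eq`. Since Λ is given by generators and relations, uniqueness
-- of the factorization needs invariants: the action on vertices embeds Δ into Λ
-- (`Lam.emb_injective`), and the action on dual vertices detects the power of τ
-- (`Lam.covertex_emb`).
--
-- The second statement is dual. Products of function modules `cofreeOn k n` are injective and
-- represent the total complex of the linear dual of Y^∨. Exactness is tested by mapping out of the
-- generators `freeAt`, and self-duality of Λ turns the test complex into that of `functionsTo`, so
-- that no second calculation is needed.
--
-- Finally, for stable M the operators on k ⊗_H PCM already satisfy τⁿ⁺¹ = id, so imposing this
-- relation before taking coinvariants changes nothing (`paraToCyc_bijective`). Naturality is read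
-- off from representing cocycles.

universe w'

/-! ### Exactness of the total complex from exactness of the rows. -/

namespace BivariantHopf
open CategoryTheory Opposite

section TotExact

variable {k : Type u} [Field k] (A : CocyclicObject (ModuleCat.{u} k))

/-- The vertical differential raises the row index and the horizontal one keeps it, so the cochains
supported in rows of index at least r form a subcomplex. On row r, the lowest one, only the
horizontal differential is seen; this is the next lemma. Together they allow a cocycle to be
corrected one row at a time. -/
theorem totD_eq_zero_of_lt {n r : ℕ} (y : Tot A n) (hy : ∀ q : Fin (n + 1), (q : ℕ) < r → y q = 0)
    (q : Fin (n + 2)) (hq : (q : ℕ) < r) : totD A n y q = 0 := by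
  obtain ⟨q, h⟩ := q
  change q < r at hq
  cases q with
  | zero => exact (congrArg (horiz A n 0) (hy 0 hq)).trans (map_zero (horiz A n 0))
  | succ q =>
    rcases Nat.lt_or_ge (q + 1) (n + 1) with h1 | h1
    · rw [totD_succ A n q h1, hy ⟨q, by omega⟩ (show q < r by omega), hy ⟨q + 1, h1⟩ hq, map_zero,
        map_zero, add_zero]
    · obtain rfl : q = n := by omega
      rw [totD_last, hy ⟨q, by omega⟩ (show q < r by omega), map_zero]

theorem totD_apply_of_lt {n r : ℕ} (y : Tot A n) (hy : ∀ q : Fin (n + 1), (q : ℕ) < r → y q = 0)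
    (hr : r < n + 1) : totD A n y ⟨r, by omega⟩ = horiz A (n - r) r (y ⟨r, hr⟩) := by
  cases r with
  | zero => rfl
  | succ r => rw [totD_succ A n r hr, hy ⟨r, by omega⟩ (Nat.lt_succ_self r), map_zero, zero_add]

/-- The total complex is exact in positive degrees if the rows are exact in positive degrees and the
complex of cyclic cochains is. -/
theorem exists_totD_eq
    (hrow : ∀ (p q : ℕ) (y : A.X q), horiz A (p + 1) q y = 0 → ∃ x, horiz A p q x = y)
    (hcol : ∀ (n : ℕ) (y : A.X (n + 1)), horiz A 0 (n + 1) y = 0 → vert A 0 (n + 1) y = 0 →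
      ∃ x, horiz A 0 n x = 0 ∧ vert A 0 n x = y)
    {n : ℕ} (y : Tot A (n + 1)) (hy : totD A (n + 1) y = 0) : ∃ x, totD A n x = y := by
  classical
  have hz : ∀ x, totD A (n + 1) (y - totD A n x) = 0 := fun x => by
    rw [map_sub, hy, zero_sub, neg_eq_zero]
    exact LinearMap.congr_fun (totD_totD A n) x
  have key : ∀ r ≤ n + 1, ∃ x : Tot A n, ∀ q : Fin (n + 2), (q : ℕ) < r →
      (y - totD A n x) q = 0 := by
    intro r
    induction r with
    | zero => exact fun _ => ⟨0, fun q hq => absurd hq (Nat.not_lt_zero _)⟩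
    | succ r ih =>
      intro hr
      obtain ⟨x, hx⟩ := ih (by omega)
      -- The first entry of the corrected cocycle that may be nonzero lies in row r ≤ n, hence in
      -- the positive column n + 1 - r. There it is a horizontal cocycle, and exactness of the row
      -- provides the next correction.
      have h1 := congrFun (hz x) ⟨r, by omega⟩
      rw [totD_apply_of_lt A _ hx (by omega), show n + 1 - r = n - r + 1 by omega] at h1
      obtain ⟨w, hw⟩ := hrow _ _ _ h1
      have hs : ∀ q : Fin (n + 1), (q : ℕ) < r →
          (Pi.single (⟨r, by omega⟩ : Fin (n + 1)) w : Tot A n) q = 0 := fun q hq =>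
        Pi.single_eq_of_ne (fun h => by rw [h] at hq; exact lt_irrefl _ hq) _
      refine ⟨x + Pi.single (⟨r, by omega⟩ : Fin (n + 1)) w, fun q hq => ?_⟩
      rw [map_add, ← sub_sub, Pi.sub_apply]
      rcases Nat.lt_or_ge (q : ℕ) r with h | h
      · rw [hx q h, totD_eq_zero_of_lt A _ hs q h, sub_zero]
      · have hq' : q = ⟨r, by omega⟩ := Fin.ext (show (q : ℕ) = r by omega)
        rw [hq']
        rw [totD_apply_of_lt A _ hs (by omega), Pi.single_eq_same, hw, sub_self]
  -- Only the entry in row n + 1 and column 0 is left, where row exactness says nothing. The cocycle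
  -- condition in rows n + 1 and n + 2 makes it invariant and a vertical cocycle.
  obtain ⟨x, hx⟩ := key (n + 1) le_rfl
  have h1 := congrFun (hz x) ⟨n + 1, by omega⟩
  rw [totD_apply_of_lt A _ hx (by omega), Nat.sub_self] at h1
  have h2 := congrFun (hz x) ⟨n + 2, by omega⟩
  rw [totD_last] at h2
  obtain ⟨w, hw, hw'⟩ := hcol _ _ h1 h2
  have hs : ∀ q : Fin (n + 1), (q : ℕ) < n →
      (Pi.single (⟨n, by omega⟩ : Fin (n + 1)) w : Tot A n) q = 0 := fun q hq =>
    Pi.single_eq_of_ne (fun h => by rw [h] at hq; exact lt_irrefl _ hq) _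
  -- The last correction sits in row n, column 0. As `w` is killed by the horizontal differential,
  -- row n stays zero.
  refine ⟨x + Pi.single (⟨n, by omega⟩ : Fin (n + 1)) w, ?_⟩
  refine (sub_eq_zero.1 (funext fun q => ?_)).symm
  rw [map_add, ← sub_sub, Pi.sub_apply]
  rcases Nat.lt_or_ge (q : ℕ) (n + 1) with h | h
  · rw [hx q h]
    rcases Nat.lt_or_ge (q : ℕ) n with h | h
    · rw [totD_eq_zero_of_lt A _ hs q h, sub_zero]
      rfl
    · have hq' : q = ⟨n, by omega⟩ := Fin.ext (show (q : ℕ) = n by omega)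
      rw [hq']
      rw [totD_apply_of_lt A _ hs (by omega), Pi.single_eq_same, Nat.sub_self, hw, sub_zero]
      rfl
  · have hq' : q = ⟨n + 1, by omega⟩ := Fin.ext (show (q : ℕ) = n + 1 by omega)
    rw [hq']
    rw [totD_last, Pi.single_eq_same, hw']
    exact sub_self _

end TotExact
end BivariantHopf

namespace BivariantHopf
open CategoryTheory Opposite

/-! ## The cyclic category and the simplex category -/

namespace Lam

/-- Induction on morphisms of `Λ`, composing with generators on the right. -/
theorem hom_induction {P : ∀ {q m : ℕ}, (ob q ⟶ ob m) → Prop} (id : ∀ q, P (𝟙 (ob q)))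
    (comp_δ : ∀ {q m : ℕ} (f : ob q ⟶ ob m) (i : Fin (m + 2)), P f → P (f ≫ δ m i))
    (comp_σ : ∀ {q m : ℕ} (f : ob q ⟶ ob (m + 1)) (j : Fin (m + 1)), P f → P (f ≫ σ m j))
    (comp_τ : ∀ {q m : ℕ} (f : ob q ⟶ ob m), P f → P (f ≫ τ m))
    {q m : ℕ} (f : ob q ⟶ ob m) : P f := by
  have key : ∀ {a b : Words} (p : a ⟶ b), P (q := CycOb.len a) (m := CycOb.len b)
      ((CategoryTheory.Quotient.functor CycRel).map p) := by
    intro a b p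
    induction p using Paths.induction with
    | id => exact id _
    | comp p g ih =>
      rename_i _ c d
      obtain ⟨c⟩ := c
      obtain ⟨d⟩ := d
      have h : P ((CategoryTheory.Quotient.functor CycRel).map p ≫
          (CategoryTheory.Quotient.functor CycRel).map
            ((Paths.of CycOb).map (X := ⟨c⟩) (Y := ⟨d⟩) g)) := by
        change Gen c d at g
        cases g with
        | δ n i => exact comp_δ _ i ih
        | σ n j => exact comp_σ _ j ih
        | τ n => exact comp_τ _ ih
      exact h
  obtain ⟨p, rfl⟩ := (CategoryTheory.Quotient.functor CycRel).map_surjective (X := wob q)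
    (Y := wob m) f
  exact key p

end Lam

namespace Simp

open SimplexCategoryGenRel

section Lift

variable {𝒟 : Type u} [Category.{v} 𝒟] (X : ℕ → 𝒟) (dδ : ∀ n, Fin (n + 2) → (X n ⟶ X (n + 1)))
  (dσ : ∀ n, Fin (n + 1) → (X (n + 1) ⟶ X n))

/-- The functor on words in cofaces and codegeneracies given by a family of morphisms. -/
def liftWord : Paths FreeSimplexQuiver ⥤ 𝒟 :=
  Paths.lift
    { obj := fun n => X n.len
      map := fun f => match f with
        | FreeSimplexQuiver.Hom.δ i => dδ _ i
        | FreeSimplexQuiver.Hom.σ i => dσ _ i }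

theorem liftWord_δ {n : ℕ} (i : Fin (n + 2)) : (liftWord X dδ dσ).map
    ((Paths.of FreeSimplexQuiver).map (FreeSimplexQuiver.δ i)) = dδ n i := Paths.lift_toPath _ _

theorem liftWord_σ {n : ℕ} (i : Fin (n + 1)) : (liftWord X dδ dσ).map
    ((Paths.of FreeSimplexQuiver).map (FreeSimplexQuiver.σ i)) = dσ n i := Paths.lift_toPath _ _

variable (hδδ : ∀ (n : ℕ) (i j : Fin (n + 2)), i ≤ j →
    dδ n i ≫ dδ (n + 1) j.succ = dδ n j ≫ dδ (n + 1) i.castSucc)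
  (hσσ : ∀ (n : ℕ) (i j : Fin (n + 1)), i ≤ j →
    dσ (n + 1) i.castSucc ≫ dσ n j = dσ (n + 1) j.succ ≫ dσ n i)
  (hself : ∀ (n : ℕ) (i : Fin (n + 1)), dδ n i.castSucc ≫ dσ n i = 𝟙 _)
  (hsucc : ∀ (n : ℕ) (i : Fin (n + 1)), dδ n i.succ ≫ dσ n i = 𝟙 _)
  (hle : ∀ (n : ℕ) (i : Fin (n + 2)) (j : Fin (n + 1)), i ≤ j.castSucc →
    dδ (n + 1) i.castSucc ≫ dσ (n + 1) j.succ = dσ n j ≫ dδ n i)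
  (hgt : ∀ (n : ℕ) (i : Fin (n + 2)) (j : Fin (n + 1)), j.castSucc < i →
    dδ (n + 1) i.succ ≫ dσ (n + 1) j.castSucc = dσ n j ≫ dδ n i)

/-- The functor on the category presented by cofaces and codegeneracies given by a family of
morphisms that satisfies the cosimplicial relations. -/
def lift : SimplexCategoryGenRel ⥤ 𝒟 :=
  CategoryTheory.Quotient.lift _ (liftWord X dδ dσ) (by
    intro a b f g h
    cases h <;> simp only [Functor.map_comp, liftWord_δ, liftWord_σ]
    case δ_comp_δ H => exact hδδ _ _ _ H
    case δ_comp_σ_of_le H => exact hle _ _ _ H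
    case δ_comp_σ_self => exact hself _ _
    case δ_comp_σ_succ => exact hsucc _ _
    case δ_comp_σ_of_gt H => exact hgt _ _ _ H
    case σ_comp_σ H => exact hσσ _ _ _ H)

end Lift

/-- The shift `[n] ↦ [n+1]`, `∂ᵢ ↦ ∂ᵢ₊₁`, `σⱼ ↦ σⱼ₊₁` of the category presented by cofaces and
codegeneracies. -/
def dec : SimplexCategoryGenRel ⥤ SimplexCategoryGenRel :=
  lift (fun n => mk (n + 1)) (fun _ i => δ i.succ) (fun _ i => σ i.succ)
    (fun _ _ _ h => SimplexCategoryGenRel.δ_comp_δ (Fin.succ_le_succ_iff.2 h))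
    (fun _ _ _ h => SimplexCategoryGenRel.σ_comp_σ (Fin.succ_le_succ_iff.2 h))
    (fun _ _ => SimplexCategoryGenRel.δ_comp_σ_self)
    (fun _ _ => SimplexCategoryGenRel.δ_comp_σ_succ)
    (fun _ i j h => SimplexCategoryGenRel.δ_comp_σ_of_le (i := i.succ) (j := j.succ)
      (Fin.succ_le_succ_iff.2 h))
    (fun _ i j h => SimplexCategoryGenRel.δ_comp_σ_of_gt (i := i.succ) (j := j.succ)
      (Fin.succ_lt_succ_iff.2 h))

/-- The value of `dec` on a morphism. -/
def decMap {q m : ℕ} (φ : mk q ⟶ mk m) : mk (q + 1) ⟶ mk (m + 1) := dec.map φ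

theorem decMap_comp {q m l : ℕ} (φ : mk q ⟶ mk m) (ψ : mk m ⟶ mk l) :
    decMap (φ ≫ ψ) = decMap φ ≫ decMap ψ := dec.map_comp _ _

theorem decMap_id (q : ℕ) : decMap (𝟙 (mk q)) = 𝟙 _ := dec.map_id _

theorem decMap_δ {n : ℕ} (i : Fin (n + 2)) : decMap (δ i) = δ i.succ :=
  liftWord_δ (fun n => mk (n + 1)) (fun _ i => δ i.succ) (fun _ i => σ i.succ) i

theorem decMap_σ {n : ℕ} (i : Fin (n + 1)) : decMap (σ i) = σ i.succ :=
  liftWord_σ (fun n => mk (n + 1)) (fun _ i => δ i.succ) (fun _ i => σ i.succ) i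

/-- Induction on morphisms between the objects `[n]`, composing with generators on the right. -/
theorem induction {P : ∀ {q m : ℕ}, (mk q ⟶ mk m) → Prop} (id : ∀ q, P (𝟙 (mk q)))
    (comp_δ : ∀ {q m : ℕ} (φ : mk q ⟶ mk m) (i : Fin (m + 2)), P φ → P (φ ≫ δ i))
    (comp_σ : ∀ {q m : ℕ} (φ : mk q ⟶ mk (m + 1)) (i : Fin (m + 1)), P φ → P (φ ≫ σ i))
    {q m : ℕ} (φ : mk q ⟶ mk m) : P φ := by
  let P' : MorphismProperty SimplexCategoryGenRel := fun a b f => P (q := a.len) (m := b.len) f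
  have key : ∀ {a b : SimplexCategoryGenRel} (f : a ⟶ b), P' f := fun f =>
    SimplexCategoryGenRel.hom_induction P' (id _) (fun u i h => comp_δ u i h)
      (fun u i h => comp_σ u i h) f
  exact key φ

/-- The coface `∂₀ : [n] → [n+1]` is natural from the identity to the shift. -/
theorem δ_zero_dec {q m : ℕ} (φ : mk q ⟶ mk m) : δ 0 ≫ decMap φ = φ ≫ δ 0 := by
  induction φ using Simp.induction with
  | id => rw [decMap_id, Category.id_comp, Category.comp_id]
  | comp_δ u i h =>
    rw [decMap_comp, ← Category.assoc, h, Category.assoc, Category.assoc, decMap_δ,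
      SimplexCategoryGenRel.δ_comp_δ (Fin.zero_le i)]
    rfl
  | comp_σ u i h =>
    rw [decMap_comp, ← Category.assoc, h, Category.assoc, Category.assoc, decMap_σ,
      ← SimplexCategoryGenRel.δ_comp_σ_of_le (Fin.zero_le _)]
    rfl

/-- The cone `(a₀, …, a_q) ↦ (0, a₀, …, a_q)`. -/
def cone {q m : ℕ} (φ : mk q ⟶ mk m) : mk (q + 1) ⟶ mk m := decMap φ ≫ σ 0

/-- The vertex `0` of `[m]`. -/
def vertex : ∀ m : ℕ, mk 0 ⟶ mk m
  | 0 => 𝟙 _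
  | m + 1 => vertex m ≫ δ (Fin.last (m + 1))

/-- The definition uses last cofaces only, but any coface of positive index fixes the vertex 0: the
cosimplicial relations commute it past the last coface. -/
theorem vertex_δ (m : ℕ) (i : Fin (m + 1)) : vertex m ≫ δ i.succ = vertex (m + 1) := by
  induction m with
  | zero =>
    obtain rfl : i = 0 := by omega
    rfl
  | succ m ih =>
    induction i using Fin.lastCases with
    | last => rfl
    | cast i =>
      change (vertex m ≫ δ (Fin.last (m + 1))) ≫ δ i.castSucc.succ = _
      rw [Category.assoc, ← Fin.castSucc_succ, ← SimplexCategoryGenRel.δ_comp_δ (Fin.le_last _),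
        ← Category.assoc, ih]
      rfl

theorem vertex_σ (m : ℕ) (i : Fin (m + 1)) : vertex (m + 1) ≫ σ i = vertex m := by
  rw [← vertex_δ m i, Category.assoc, SimplexCategoryGenRel.δ_comp_σ_succ, Category.comp_id]

theorem vertex_dec {q m : ℕ} (φ : mk q ⟶ mk m) :
    vertex (q + 1) ≫ decMap φ = vertex (m + 1) := by
  induction φ using Simp.induction with
  | id => rw [decMap_id, Category.comp_id]
  | comp_δ u i h => rw [decMap_comp, ← Category.assoc, h, decMap_δ, vertex_δ]
  | comp_σ u i h => rw [decMap_comp, ← Category.assoc, h, decMap_σ, vertex_σ]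

theorem vertex_cone {q m : ℕ} (φ : mk q ⟶ mk m) : vertex (q + 1) ≫ cone φ = vertex m := by
  rw [cone, ← Category.assoc, vertex_dec, vertex_σ]

/-- This lemma and the two that follow are the identities of a contracting homotopy of the m-simplex
onto its vertex 0: the zeroth face of a cone is the base, the other faces are cones over faces, and
in degree 0 the other face is the vertex. -/
theorem δ_zero_cone {q m : ℕ} (φ : mk q ⟶ mk m) : δ 0 ≫ cone φ = φ := by
  rw [cone, ← Category.assoc, δ_zero_dec, Category.assoc]
  exact (congrArg _ (SimplexCategoryGenRel.δ_comp_σ_self (i := 0))).trans (Category.comp_id _)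

theorem δ_succ_cone {q m : ℕ} (i : Fin (q + 2)) (φ : mk (q + 1) ⟶ mk m) :
    δ i.succ ≫ cone φ = cone (δ i ≫ φ) := by
  rw [cone, cone, decMap_comp, Category.assoc, decMap_δ]

theorem δ_one_cone {m : ℕ} (φ : mk 0 ⟶ mk m) : δ 1 ≫ cone φ = vertex m := by
  rw [← vertex_cone φ]
  change _ = (𝟙 _ ≫ δ 1) ≫ _
  rw [Category.id_comp]

theorem cone_comp_δ {q m : ℕ} (φ : mk q ⟶ mk m) (i : Fin (m + 1)) :
    cone φ ≫ δ i.succ = cone (φ ≫ δ i.succ) := by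
  rw [cone, cone, decMap_comp, Category.assoc, decMap_δ, Category.assoc,
    ← SimplexCategoryGenRel.δ_comp_σ_of_gt (Fin.succ_pos i)]
  rfl

theorem cone_comp_σ {q m : ℕ} (φ : mk q ⟶ mk (m + 1)) (i : Fin (m + 1)) :
    cone φ ≫ σ i = cone (φ ≫ σ i) := by
  rw [cone, cone, decMap_comp, Category.assoc, decMap_σ, Category.assoc,
    ← SimplexCategoryGenRel.σ_comp_σ (Fin.zero_le i)]
  rfl

/-- Morphisms built from vertices by cones and by the coface `∂₀`. -/
inductive IsNormal : ∀ {q m : ℕ}, (mk q ⟶ mk m) → Prop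
  | vertex (m : ℕ) : IsNormal (vertex m)
  | cone {q m : ℕ} (φ : mk q ⟶ mk m) : IsNormal φ → IsNormal (cone φ)
  | shift {q m : ℕ} (φ : mk q ⟶ mk m) : IsNormal φ → IsNormal (φ ≫ δ 0)

/-- Normal forms are a substitute for describing morphisms as monotone sequences: a sequence either
starts with 0, and is then the vertex 0 or a cone, or avoids 0, and is then a shift by ∂₀. That
every morphism has this shape is proved by closing the shape under composition with generators. -/
theorem IsNormal.comp_δ {q m : ℕ} {φ : mk q ⟶ mk m} (h : IsNormal φ) (i : Fin (m + 2)) :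
    IsNormal (φ ≫ δ i) := by
  induction h with
  | vertex m =>
    induction i using Fin.cases with
    | zero => exact .shift _ (.vertex m)
    | succ i => rw [vertex_δ]; exact .vertex _
  | cone φ h ih =>
    induction i using Fin.cases with
    | zero => exact .shift _ (.cone φ h)
    | succ i => rw [cone_comp_δ]; exact .cone _ (ih _)
  | shift φ h ih =>
    induction i using Fin.cases with
    | zero => exact .shift _ (.shift φ h)
    | succ i =>
      rw [Category.assoc, SimplexCategoryGenRel.δ_comp_δ (Fin.zero_le i), ← Category.assoc]
      exact .shift _ (ih i)

/-- The induction on `IsNormal` needs a variable as target index, so the condition that the target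
is a successor is kept as an equation and the morphism is transported along it. -/
theorem IsNormal.comp_σ_aux {q m' : ℕ} {φ : mk q ⟶ mk m'} (h : IsNormal φ) :
    ∀ (m : ℕ) (hm : m' = m + 1) (i : Fin (m + 1)),
      IsNormal ((hm ▸ φ : mk q ⟶ mk (m + 1)) ≫ σ i) := by
  induction h with
  | vertex m' =>
    rintro m rfl i
    rw [vertex_σ]
    exact .vertex _
  | cone φ h ih =>
    rintro m rfl i
    rw [cone_comp_σ]
    exact .cone _ (ih m rfl i)
  | shift φ h ih =>
    intro m hm i
    obtain rfl := Nat.succ.inj hm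
    induction i using Fin.cases with
    | zero =>
      change IsNormal ((φ ≫ δ 0) ≫ σ 0)
      rw [Category.assoc]
      refine Eq.mpr (congrArg IsNormal ?_) h
      exact (congrArg _ (SimplexCategoryGenRel.δ_comp_σ_self (i := 0))).trans (Category.comp_id _)
    | succ i =>
      rename_i q m'
      cases m' with
      | zero => exact i.elim0
      | succ m =>
        change IsNormal ((φ ≫ δ 0) ≫ σ i.succ)
        rw [Category.assoc]
        have := SimplexCategoryGenRel.δ_comp_σ_of_le (Fin.zero_le i.castSucc)
        refine Eq.mpr (congrArg IsNormal (congrArg _ this)) ?_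
        rw [← Category.assoc]
        exact .shift _ (ih m rfl i)

theorem IsNormal.comp_σ {q m : ℕ} {φ : mk q ⟶ mk (m + 1)} (h : IsNormal φ) (i : Fin (m + 1)) :
    IsNormal (φ ≫ σ i) := h.comp_σ_aux m rfl i

theorem isNormal_id (q : ℕ) : IsNormal (𝟙 (mk q)) := by
  induction q with
  | zero => exact .vertex 0
  | succ q ih =>
    -- The identity of [q+1] is the cone over ∂₀, since ∂₁ followed by σ₀ is the identity.
    have h := IsNormal.cone _ (IsNormal.shift _ ih)
    rw [Category.id_comp, cone, decMap_δ] at h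
    exact Eq.mp (congrArg IsNormal (SimplexCategoryGenRel.δ_comp_σ_succ (i := 0))) h

theorem isNormal {q m : ℕ} (φ : mk q ⟶ mk m) : IsNormal φ := by
  induction φ using Simp.induction with
  | id => exact isNormal_id _
  | comp_δ u i h => exact IsNormal.comp_δ h i
  | comp_σ u i h => exact IsNormal.comp_σ h i

end Simp

end BivariantHopf

/-! ### The simplex category embeds into the cyclic category. -/

namespace BivariantHopf
open CategoryTheory Opposite

namespace CocyclicObject

variable {𝒟 : Type u} [Category.{v} 𝒟] (A : CocyclicObject 𝒟)

/-- The underlying cosimplicial object of a cocyclic object, on the category presented by cofaces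
and codegeneracies. -/
def simplicial : SimplexCategoryGenRel ⥤ 𝒟 :=
  Simp.lift A.X A.δ A.σ (fun n i j h => (A.δ_δ n i j h).symm) A.σ_σ A.δ_σ_self A.δ_σ_succ
    (fun n i j h => (A.σ_δ_le n i j h).symm) (fun n i j h => (A.σ_δ_gt n i j h).symm)

end CocyclicObject

namespace Lam

open SimplexCategoryGenRel (mk)

/-- The morphism of `Λ` given by a morphism of the simplex category. -/
def emb {q m : ℕ} (φ : mk q ⟶ mk m) : ob q ⟶ ob m := tautological.simplicial.map φ

theorem emb_id (q : ℕ) : emb (𝟙 (mk q)) = 𝟙 (ob q) := tautological.simplicial.map_id _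

theorem emb_comp {q m l : ℕ} (φ : mk q ⟶ mk m) (ψ : mk m ⟶ mk l) :
    emb (φ ≫ ψ) = emb φ ≫ emb ψ := tautological.simplicial.map_comp _ _

theorem emb_δ {n : ℕ} (i : Fin (n + 2)) : emb (SimplexCategoryGenRel.δ i) = δ n i :=
  Simp.liftWord_δ ob δ σ i

theorem emb_σ {n : ℕ} (i : Fin (n + 1)) : emb (SimplexCategoryGenRel.σ i) = σ n i :=
  Simp.liftWord_σ ob δ σ i

/-- The coface `∂ᵢ` on vertices. -/
def vδ (i x : ℕ) : ℕ := if x < i then x else x + 1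

/-- The codegeneracy `σⱼ` on vertices. -/
def vσ (j x : ℕ) : ℕ := if x ≤ j then x else x - 1

/-- The cyclic operator `τₙ` on vertices. -/
def vτ (n x : ℕ) : ℕ := if x = 0 then n else x - 1

/-- This is x - a modulo n + 1, written with natural numbers. The case a = n + 1 is included to give
periodicity. -/
theorem iterate_vτ (n a x : ℕ) (ha : a ≤ n + 1) (hx : x ≤ n) :
    (vτ n)^[a] x = if a ≤ x then x - a else n + 1 + x - a := by
  induction a with
  | zero => simp
  | succ a ih =>
    rw [Function.iterate_succ_apply', ih (by omega), vτ]
    split_ifs <;> omega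

/-- The cocyclic set `[n] ↦ {0, …, n}`. -/
def vertices : CocyclicObject (Type) where
  X n := {x : ℕ // x ≤ n}
  δ n i := ↾(fun x : {x : ℕ // x ≤ n} => (⟨vδ i x, by rw [vδ]; split <;> omega⟩ : {x // x ≤ n + 1}))
  σ n j := ↾(fun x : {x : ℕ // x ≤ n + 1} => (⟨vσ j x, by rw [vσ]; split <;> omega⟩ : {x // x ≤ n}))
  τ n := ↾(fun x : {x : ℕ // x ≤ n} => (⟨vτ n x, by rw [vτ]; split <;> omega⟩ : {x : ℕ // x ≤ n}))
  δ_δ n i j h := by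
    have h' : (i : ℕ) ≤ j := h
    ext x
    simp [vδ]
    split_ifs <;> omega
  σ_σ n i j h := by
    have h' : (i : ℕ) ≤ j := h
    ext x
    simp [vσ]
    split_ifs <;> omega
  δ_σ_self n i := by
    ext x
    simp [vσ, vδ]
    split_ifs <;> omega
  δ_σ_succ n i := by
    ext x
    simp [vσ, vδ]
    split_ifs <;> omega
  σ_δ_le n i j h := by
    have h' : (i : ℕ) ≤ j := h
    ext x
    simp [vσ, vδ]
    split_ifs <;> omega
  σ_δ_gt n i j h := by
    have h' : (j : ℕ) < i := h
    ext x
    simp [vσ, vδ]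
    split_ifs <;> omega
  τ_δ n i := by
    ext ⟨x, hx⟩
    have hi := i.2
    change vδ i (vτ n x) = vτ (n + 1) (vδ (i + 1) x)
    simp only [vτ, vδ]
    split_ifs <;> first | contradiction | omega
  δ_last n := by
    ext x
    have := x.2
    simp [vτ, vδ]
    omega
  σ_τ n j := by
    ext x
    have := x.2
    have := j.2
    simp [vτ, vσ]
    split_ifs <;> omega
  σ_τ_zero n := by
    ext x
    have := x.2
    simp [vτ, vσ]
    split_ifs <;> omega
  τ_pow n := by
    have key : ∀ (a : ℕ) (x : {x : ℕ // x ≤ n}), ((iter (↾(fun x : {x : ℕ // x ≤ n} =>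
        (⟨vτ n x, by rw [vτ]; split <;> omega⟩ : {x : ℕ // x ≤ n}))) a) x : ℕ) =
        (vτ n)^[a] x := by
      intro a x
      induction a with
      | zero => rfl
      | succ a ih => 
        rw [Function.iterate_succ_apply', ← ih]
        rfl
    ext x
    have := x.2
    refine (key (n + 1) x).trans ?_
    rw [iterate_vτ n (n + 1) x le_rfl x.2]
    simp
    omega

/-- The value of the map of vertex sets of a morphism at the vertex `0`. -/
def valZero {q m : ℕ} (f : ob q ⟶ ob m) : ℕ :=
  Subtype.val (p := fun x => x ≤ m) (vertices.functor.map f (⟨0, Nat.zero_le _⟩ : {x // x ≤ q}))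

theorem vertices_δ (n : ℕ) (i : Fin (n + 2)) : vertices.functor.map (δ n i) = vertices.δ n i :=
  vertices.wordFunctor_δ n i

theorem vertices_σ (n : ℕ) (i : Fin (n + 1)) : vertices.functor.map (σ n i) = vertices.σ n i :=
  vertices.wordFunctor_σ n i

theorem valZero_id (q : ℕ) : valZero (𝟙 (ob q)) = 0 := by
  rw [valZero, CategoryTheory.Functor.map_id]
  rfl

theorem valZero_comp_δ {q m : ℕ} (f : ob q ⟶ ob m) (i : Fin (m + 2)) :
    valZero (f ≫ δ m i) = vδ i (valZero f) := by
  rw [valZero, Functor.map_comp, vertices_δ]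
  rfl

theorem valZero_comp_σ {q m : ℕ} (f : ob q ⟶ ob (m + 1)) (i : Fin (m + 1)) :
    valZero (f ≫ σ m i) = vσ i (valZero f) := by
  rw [valZero, Functor.map_comp, vertices_σ]
  rfl

/-- The relations of Λ alone do not show that two morphisms differ; the functor `vertices` does.
This lemma and the next two show that the image of the vertex 0 separates vertices and cones from
shifts, even inside Λ. -/
theorem valZero_vertex (m : ℕ) : valZero (emb (Simp.vertex m)) = 0 := by
  induction m with
  | zero => exact (congrArg valZero (emb_id 0)).trans (valZero_id 0)
  | succ m ih =>
    rw [Simp.vertex, emb_comp, emb_δ, valZero_comp_δ, ih]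
    rfl

theorem valZero_cone {q m : ℕ} (φ : mk q ⟶ mk m) : valZero (emb (Simp.cone φ)) = 0 := by
  have h : valZero (emb (Simp.decMap φ)) = 0 := by
    induction φ using Simp.induction with
    | id => rw [Simp.decMap_id, emb_id, valZero_id]
    | comp_δ u i h =>
      rw [Simp.decMap_comp, emb_comp, Simp.decMap_δ, emb_δ, valZero_comp_δ, h]
      simp [vδ]
    | comp_σ u i h =>
      rw [Simp.decMap_comp, emb_comp, Simp.decMap_σ, emb_σ, valZero_comp_σ, h]
      simp [vσ]
  rw [Simp.cone, emb_comp, emb_σ, valZero_comp_σ, h]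
  rfl

theorem valZero_shift {q m : ℕ} (f : ob q ⟶ ob m) : valZero (f ≫ δ m 0) ≠ 0 := by
  rw [valZero_comp_δ]
  simp [vδ]

theorem δ_zero_emb_cone {q m : ℕ} (φ : mk q ⟶ mk m) : δ q 0 ≫ emb (Simp.cone φ) = emb φ := by
  rw [← emb_δ, ← emb_comp, Simp.δ_zero_cone]

theorem shift_cancel {q m : ℕ} {f g : ob q ⟶ ob m} (h : f ≫ δ m 0 = g ≫ δ m 0) : f = g := by
  have h0 : δ m 0 ≫ σ m 0 = 𝟙 _ := tautological.δ_σ_self m 0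
  have h1 := congrArg (· ≫ σ m 0) h
  simpa only [Category.assoc, h0, Category.comp_id] using h1

/-- Normal forms can be compared constructor by constructor. The image of the vertex 0 separates
shifts from the rest, and the source degree separates vertices from cones. Within Λ a cone is undone
by precomposition with ∂₀, and a shift by composition with σ₀, which leads to the induction
hypothesis. -/
theorem eq_of_emb_eq {q m : ℕ} {φ ψ : mk q ⟶ mk m} (hφ : Simp.IsNormal φ) (hψ : Simp.IsNormal ψ)
    (h : emb φ = emb ψ) : φ = ψ := by
  induction hφ with
  | vertex m =>
    cases hψ with
    | vertex => rfl
    | shift ψ hψ =>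
      rw [emb_comp, emb_δ] at h
      exact absurd ((congrArg valZero h).symm.trans (valZero_vertex _)) (valZero_shift _)
  | cone φ hφ ih =>
    cases hψ with
    | cone ψ hψ =>
      refine congrArg _ (ih hψ ?_)
      rw [← δ_zero_emb_cone, h, δ_zero_emb_cone]
    | shift ψ hψ =>
      rw [emb_comp _ (SimplexCategoryGenRel.δ 0), emb_δ] at h
      exact absurd ((congrArg valZero h).symm.trans (valZero_cone _)) (valZero_shift _)
  | shift φ hφ ih =>
    rw [emb_comp φ, emb_δ] at h
    cases hψ with
    | vertex => exact absurd ((congrArg valZero h).trans (valZero_vertex _)) (valZero_shift _)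
    | cone ψ hψ => exact absurd ((congrArg valZero h).trans (valZero_cone _)) (valZero_shift _)
    | shift ψ hψ =>
      rw [emb_comp ψ, emb_δ] at h
      rw [ih hψ (shift_cancel h)]

/-- The simplex category embeds into the cyclic category. -/
theorem emb_injective {q m : ℕ} : Function.Injective (emb : (mk q ⟶ mk m) → (ob q ⟶ ob m)) :=
  fun φ ψ h => eq_of_emb_eq (Simp.isNormal φ) (Simp.isNormal ψ) h

end Lam
end BivariantHopf

/-! ### Unique factorization of morphisms of the cyclic category. -/

namespace BivariantHopf
open CategoryTheory Opposite

theorem iter_add {𝒟 : Type u} [Category.{v} 𝒟] {X : 𝒟} (f : X ⟶ X) (a b : ℕ) :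
    iter f (a + b) = iter f a ≫ iter f b := by
  induction b with
  | zero => exact (Category.comp_id _).symm
  | succ b ih => rw [← add_assoc, iter, iter, ih, Category.assoc]

namespace Lam

open SimplexCategoryGenRel (mk)

/-- The power `τₙᵃ`. -/
def τpow (n a : ℕ) : ob n ⟶ ob n := iter (τ n) a

theorem τpow_zero (n : ℕ) : τpow n 0 = 𝟙 _ := rfl

theorem τpow_add (n a b : ℕ) : τpow n (a + b) = τpow n a ≫ τpow n b := iter_add _ _ _

theorem τpow_succ (n a : ℕ) : τpow n (a + 1) = τpow n a ≫ τ n := rfl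

theorem τpow_succ' (n a : ℕ) : τpow n (a + 1) = τ n ≫ τpow n a :=
  (CocyclicObject.iter_comm _ _).symm

theorem τpow_period (n : ℕ) : τpow n (n + 1) = 𝟙 _ := tautological.τ_pow n

theorem τpow_mod (n a : ℕ) : τpow n (a % (n + 1)) = τpow n a := by
  have h : ∀ b, τpow n ((n + 1) * b) = 𝟙 _ := by
    intro b
    induction b with
    | zero => rfl
    | succ b ih => rw [mul_add, mul_one, τpow_add, ih, τpow_period, Category.comp_id]
  conv_rhs => rw [← Nat.mod_add_div a (n + 1), τpow_add, h, Category.comp_id]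

/-- Powers of τ can be moved to the source side of a generator at the cost of changing its index. A
factor τ is absorbed when it meets ∂₀, which becomes the last coface; otherwise it passes through.
For codegeneracies, in the next lemma, passing σ₀ produces two factors instead. -/
theorem δ_comp_τpow (n a : ℕ) (i : Fin (n + 2)) :
    ∃ (b : ℕ) (j : Fin (n + 2)), δ n i ≫ τpow (n + 1) a = τpow n b ≫ δ n j := by
  induction a generalizing i with
  | zero => exact ⟨0, i, (Category.comp_id _).trans (Category.id_comp _).symm⟩
  | succ a ih =>
    rw [τpow_succ', ← Category.assoc]
    induction i using Fin.cases with
    | zero =>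
      rw [← show δ n (Fin.last (n + 1)) = δ n 0 ≫ τ (n + 1) from tautological.δ_last n]
      exact ih _
    | succ i =>
      obtain ⟨b, j, h⟩ := ih i.castSucc
      refine ⟨b + 1, j, ?_⟩
      rw [← show τ n ≫ δ n i.castSucc = δ n i.succ ≫ τ (n + 1) from tautological.τ_δ n i,
        Category.assoc, h, τpow_succ', Category.assoc]

theorem σ_comp_τpow (n a : ℕ) (i : Fin (n + 1)) :
    ∃ (b : ℕ) (j : Fin (n + 1)), σ n i ≫ τpow n a = τpow (n + 1) b ≫ σ n j := by
  induction a generalizing i with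
  | zero => exact ⟨0, i, (Category.comp_id _).trans (Category.id_comp _).symm⟩
  | succ a ih =>
    rw [τpow_succ', ← Category.assoc]
    cases i using Fin.cases with
    | zero =>
      obtain ⟨b, j, h⟩ := ih (Fin.last n)
      refine ⟨b + 1 + 1, j, ?_⟩
      rw [show σ n 0 ≫ τ n = τ (n + 1) ≫ τ (n + 1) ≫ σ n (Fin.last n) from
        tautological.σ_τ_zero n, Category.assoc, Category.assoc, h, τpow_succ', τpow_succ',
        Category.assoc, Category.assoc]
    | succ i =>
      obtain ⟨b, j, h⟩ := ih i.castSucc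
      refine ⟨b + 1, j, ?_⟩
      rw [show σ n i.succ ≫ τ n = τ (n + 1) ≫ σ n i.castSucc from tautological.σ_τ n i,
        Category.assoc, h, τpow_succ', Category.assoc]

theorem emb_comp_τpow {q m : ℕ} (φ : mk q ⟶ mk m) (a : ℕ) :
    ∃ (b : ℕ) (ψ : mk q ⟶ mk m), emb φ ≫ τpow m a = τpow q b ≫ emb ψ := by
  induction φ using Simp.induction generalizing a with
  | id => exact ⟨a, 𝟙 _, by rw [emb_id, Category.id_comp, Category.comp_id]⟩
  | comp_δ φ i ih =>
    obtain ⟨b, j, h⟩ := δ_comp_τpow _ a i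
    obtain ⟨c, ψ, h'⟩ := ih b
    refine ⟨c, ψ ≫ SimplexCategoryGenRel.δ j, ?_⟩
    rw [emb_comp, emb_δ, Category.assoc, h, ← Category.assoc, h', emb_comp, emb_δ, Category.assoc]
  | comp_σ φ i ih =>
    obtain ⟨b, j, h⟩ := σ_comp_τpow _ a i
    obtain ⟨c, ψ, h'⟩ := ih b
    refine ⟨c, ψ ≫ SimplexCategoryGenRel.σ j, ?_⟩
    rw [emb_comp, emb_σ, Category.assoc, h, ← Category.assoc, h', emb_comp, emb_σ, Category.assoc]

/-- Every morphism of the cyclic category is a power of the cyclic operator followed by a morphism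
of the simplex category. -/
theorem exists_factorization {q m : ℕ} (f : ob q ⟶ ob m) :
    ∃ (a : Fin (q + 1)) (φ : mk q ⟶ mk m), f = τpow q a ≫ emb φ := by
  suffices h : ∃ (a : ℕ) (φ : mk q ⟶ mk m), f = τpow q a ≫ emb φ by
    obtain ⟨a, φ, rfl⟩ := h
    exact ⟨⟨a % (q + 1), Nat.mod_lt _ q.succ_pos⟩, φ, by rw [τpow_mod]⟩
  induction f using hom_induction with
  | id q => exact ⟨0, 𝟙 _, by rw [emb_id, τpow_zero, Category.id_comp]⟩
  | comp_δ f i ih =>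
    obtain ⟨a, φ, rfl⟩ := ih
    exact ⟨a, φ ≫ SimplexCategoryGenRel.δ i, by rw [emb_comp, emb_δ, Category.assoc]⟩
  | comp_σ f i ih =>
    obtain ⟨a, φ, rfl⟩ := ih
    exact ⟨a, φ ≫ SimplexCategoryGenRel.σ i, by rw [emb_comp, emb_σ, Category.assoc]⟩
  | comp_τ f ih =>
    obtain ⟨a, φ, rfl⟩ := ih
    obtain ⟨b, ψ, h⟩ := emb_comp_τpow φ 1
    refine ⟨a + b, ψ, ?_⟩
    rw [Category.assoc, ← show τpow _ 1 = τ _ from Category.id_comp _, h, τpow_add, Category.assoc]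

/-- The map of dual vertex sets of a morphism of the cyclic category. -/
def covertex {q m : ℕ} (f : ob q ⟶ ob m) : {x : ℕ // x ≤ m} → {x : ℕ // x ≤ q} :=
  ConcreteCategory.hom (vertices.dual.functor.map f).unop

theorem covertex_comp {q m l : ℕ} (f : ob q ⟶ ob m) (g : ob m ⟶ ob l) (x : {x : ℕ // x ≤ l}) :
    covertex (f ≫ g) x = covertex f (covertex g x) := by
  rw [covertex, Functor.map_comp]
  rfl

theorem covertex_id (q : ℕ) (x : {x : ℕ // x ≤ q}) : covertex (𝟙 (ob q)) x = x := by
  rw [covertex, CategoryTheory.Functor.map_id]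
  rfl

theorem covertex_δ (n : ℕ) (i : Fin (n + 2)) : covertex (δ n i) =
    ConcreteCategory.hom (vertices.dualFace n i) := by
  have h : vertices.dual.functor.map (δ n i) = (vertices.dualFace n i).op :=
    vertices.dual.wordFunctor_δ n i
  rw [covertex, h]
  rfl

theorem covertex_σ (n : ℕ) (i : Fin (n + 1)) : covertex (σ n i) =
    ConcreteCategory.hom (vertices.δ n i.succ) := by
  have h : vertices.dual.functor.map (σ n i) = (vertices.δ n i.succ).op :=
    vertices.dual.wordFunctor_σ n i
  rw [covertex, h]
  rfl

theorem covertex_τpow (n a : ℕ) : covertex (τpow n a) =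
    ConcreteCategory.hom (iter (vertices.τinv n) a) := by
  have h : vertices.dual.functor.map (τpow n a) = (iter (vertices.τinv n) a).op := by
    rw [τpow, map_iter, ← CocyclicObject.iter_op]
    exact congrArg (fun f => iter f a) (vertices.dual.wordFunctor_τ n)
  rw [covertex, h]
  rfl

/-- The vertex `0`. -/
def vzero (n : ℕ) : {x : ℕ // x ≤ n} := ⟨0, Nat.zero_le _⟩

theorem iter_vertices_τ (n a : ℕ) (x : {x : ℕ // x ≤ n}) :
    Subtype.val (p := fun x => x ≤ n) ((ConcreteCategory.hom (iter (vertices.τ n) a)) x) =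
      (vτ n)^[a] x := by
  induction a with
  | zero => rfl
  | succ a ih =>
    rw [Function.iterate_succ_apply', ← ih]
    rfl

theorem vertices_τinv_zero (n : ℕ) : Subtype.val (p := fun x => x ≤ n + 1)
    (ConcreteCategory.hom (vertices.τinv (n + 1)) (vzero (n + 1))) = 1 := by
  refine (iter_vertices_τ (n + 1) (n + 1) (vzero (n + 1))).trans ?_
  rw [iterate_vτ (n + 1) (n + 1) _ (by omega) (vzero _).2, vzero]
  simp

/-- The dual vertex x can be thought of as the gap in front of the vertex x in the cyclic order. The
dual vertex 0 is then the gap between the last and the first vertex, which monotone maps respect. -/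
theorem covertex_emb {q m : ℕ} (φ : mk q ⟶ mk m) : covertex (emb φ) (vzero m) = vzero q := by
  induction φ using Simp.induction with
  | id => rw [emb_id, covertex_id]
  | comp_δ φ i ih =>
    rw [emb_comp, emb_δ, covertex_comp, covertex_δ]
    refine Eq.trans (congrArg _ ?_) ih
    induction i using Fin.lastCases with
    | last =>
      rw [CocyclicObject.dualFace_last]
      apply Subtype.ext
      change vσ 0 (Subtype.val (p := fun x => x ≤ _ + 1)
        (ConcreteCategory.hom (vertices.τinv (_ + 1)) (vzero (_ + 1)))) = 0
      rw [vertices_τinv_zero]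
      rfl
    | cast i =>
      rw [CocyclicObject.dualFace_castSucc]
      rfl
  | comp_σ φ i ih =>
    rw [emb_comp, emb_σ, covertex_comp, covertex_σ]
    refine Eq.trans (congrArg _ ?_) ih
    rfl

/-- Both simplicial factors fix the dual vertex 0, so τᵃ has to fix it as well; but nontrivial
rotations have no fixed point. This separates powers of τ from the simplex category. -/
theorem τpow_comp_emb_eq {q m a : ℕ} (ha : a ≤ q) {φ ψ : mk q ⟶ mk m}
    (h : τpow q a ≫ emb φ = emb ψ) : a = 0 := by
  have h1 : covertex (τpow q a) (vzero q) = vzero q := by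
    have h2 := congrArg (fun f => covertex f (vzero m)) h
    rwa [covertex_comp, covertex_emb, covertex_emb] at h2
  have h3 := CocyclicObject.iter_inverse _ _ (vertices.τinv_τ q) a
  have h4 : ConcreteCategory.hom (iter (vertices.τ q) a) (vzero q) = vzero q := by
    refine Eq.trans ?_ (ConcreteCategory.congr_hom h3 (vzero q))
    rw [covertex_τpow] at h1
    exact congrArg (ConcreteCategory.hom (iter (vertices.τ q) a)) h1.symm
  have h5 := (iter_vertices_τ q a (vzero q)).symm.trans (congrArg Subtype.val h4)
  rw [iterate_vτ q a _ (by omega) (vzero q).2] at h5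
  change (if a ≤ 0 then 0 - a else q + 1 + 0 - a) = 0 at h5
  split_ifs at h5 <;> omega

/-- Uniqueness of the factorization of morphisms of the cyclic category. -/
theorem factorization_unique {q m : ℕ} {a b : Fin (q + 1)} {φ ψ : mk q ⟶ mk m}
    (h : τpow q a ≫ emb φ = τpow q b ≫ emb ψ) : a = b ∧ φ = ψ := by
  have key : ∀ (a b : Fin (q + 1)) (φ ψ : mk q ⟶ mk m), (a : ℕ) ≤ b →
      τpow q a ≫ emb φ = τpow q b ≫ emb ψ → a = b ∧ φ = ψ := by
    intro a b φ ψ hab h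
    have h1 : τpow q (b - a) ≫ emb ψ = emb φ := by
      -- With exponents in ℕ, the inverse of τᵃ is the power with exponent q + 1 - a.
      have h2 := congrArg (τpow q (q + 1 - a) ≫ ·) h
      simp only [← Category.assoc, ← τpow_add] at h2
      rw [show q + 1 - (a : ℕ) + a = q + 1 by omega, τpow_period, Category.id_comp,
        show q + 1 - (a : ℕ) + b = (q + 1) + (b - a) by omega, τpow_add, τpow_period,
        Category.id_comp] at h2
      exact h2.symm
    have h3 := τpow_comp_emb_eq (by omega) h1
    rw [h3, τpow_zero, Category.id_comp] at h1
    exact ⟨Fin.ext (by omega), emb_injective h1.symm⟩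
  rcases le_total (a : ℕ) b with hab | hab
  · exact key a b φ ψ hab h
  · exact (key b a ψ φ hab h.symm).imp Eq.symm Eq.symm

/-- The factorization of morphisms of the cyclic category. -/
noncomputable def homEquiv (q m : ℕ) : Fin (q + 1) × (mk q ⟶ mk m) ≃ (ob q ⟶ ob m) :=
  Equiv.ofBijective (fun p => τpow q p.1 ≫ emb p.2)
    ⟨fun _ _ h => Prod.ext (factorization_unique h).1 (factorization_unique h).2,
      fun f => (exists_factorization f).elim fun a ⟨φ, h⟩ => ⟨(a, φ), h.symm⟩⟩

end Lam
end BivariantHopf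

/-! ### Self-duality of the cyclic category. -/

namespace BivariantHopf
open CategoryTheory Opposite

namespace Lam

/-- The duality of the cyclic category on morphisms. -/
def dualMap {q m : ℕ} (f : ob q ⟶ ob m) : ob m ⟶ ob q := duality.map f.op

theorem dualMap_id (q : ℕ) : dualMap (𝟙 (ob q)) = 𝟙 (ob q) := duality.map_id _

theorem dualMap_comp {q m l : ℕ} (f : ob q ⟶ ob m) (g : ob m ⟶ ob l) :
    dualMap (f ≫ g) = dualMap g ≫ dualMap f := duality.map_comp g.op f.op

theorem dualMap_δ (n : ℕ) (i : Fin (n + 2)) : dualMap (δ n i) = tautological.dualFace n i :=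
  congrArg Quiver.Hom.unop (tautological.dual.wordFunctor_δ n i)

theorem dualMap_σ (n : ℕ) (i : Fin (n + 1)) : dualMap (σ n i) = δ n i.succ :=
  congrArg Quiver.Hom.unop (tautological.dual.wordFunctor_σ n i)

theorem dualMap_τ (n : ℕ) : dualMap (τ n) = τinv n :=
  congrArg Quiver.Hom.unop (tautological.dual.wordFunctor_τ n)

theorem τinv_comp_τ (n : ℕ) : τinv n ≫ τ n = 𝟙 _ := tautological.τinv_τ n

theorem τ_comp_τinv (n : ℕ) : τ n ≫ τinv n = 𝟙 _ := tautological.τ_τinv n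

theorem dualMap_τinv (n : ℕ) : dualMap (τinv n) = τ n := by
  have h := dualMap_comp (τ n) (τinv n)
  rw [τ_comp_τinv, dualMap_id, dualMap_τ] at h
  have h' := congrArg (· ≫ τ n) h
  simpa only [Category.id_comp, Category.assoc, τinv_comp_τ, Category.comp_id] using h'.symm

/-- Connes' duality is not an involution: its square is conjugation by the cyclic operators, as the
indices shift by one. This suffices for the duality to be bijective on sets of morphisms. -/
theorem dualMap_dualMap_comp_τ {q m : ℕ} (f : ob q ⟶ ob m) :
    dualMap (dualMap f) ≫ τ m = τ q ≫ f := by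
  induction f using hom_induction with
  | id q => rw [dualMap_id, dualMap_id, Category.id_comp, Category.comp_id]
  | comp_δ f i ih =>
    have h : dualMap (dualMap (δ _ i)) ≫ τ _ = τ _ ≫ δ _ i := by
      rw [dualMap_δ]
      induction i using Fin.lastCases with
      | last =>
        rw [CocyclicObject.dualFace_last]
        change dualMap (τinv _ ≫ σ _ 0) ≫ τ _ = τ _ ≫ δ _ _
        rename_i m
        have h1 : δ m (Fin.last (m + 1)) = δ m 0 ≫ τ (m + 1) := tautological.δ_last m
        have h2 : τ m ≫ δ m 0 = δ m 1 ≫ τ (m + 1) := tautological.τ_δ m 0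
        rw [dualMap_comp, dualMap_σ, dualMap_τinv, h1, ← Category.assoc, h2]
        rfl
      | cast i =>
        rw [CocyclicObject.dualFace_castSucc]
        exact (congrArg (· ≫ τ _) (dualMap_σ _ i)).trans (tautological.τ_δ _ i).symm
    rw [dualMap_comp, dualMap_comp, Category.assoc, h, ← Category.assoc, ih, Category.assoc]
  | comp_σ f i ih =>
    have h : dualMap (dualMap (σ _ i)) ≫ τ _ = τ _ ≫ σ _ i := by
      rw [dualMap_σ, dualMap_δ]
      induction i using Fin.lastCases with
      | last =>
        rw [Fin.succ_last, CocyclicObject.dualFace_last]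
        change (τinv _ ≫ σ _ 0) ≫ τ _ = τ _ ≫ σ _ _
        rename_i m
        have h1 : σ m 0 ≫ τ m = τ (m + 1) ≫ τ (m + 1) ≫ σ m (Fin.last m) :=
          tautological.σ_τ_zero m
        rw [Category.assoc, h1, ← Category.assoc, τinv_comp_τ, Category.id_comp]
      | cast i =>
        rw [Fin.succ_castSucc, CocyclicObject.dualFace_castSucc]
        exact tautological.σ_τ _ i
    rw [dualMap_comp, dualMap_comp, Category.assoc, h, ← Category.assoc, ih, Category.assoc]
  | comp_τ f ih =>
    rw [dualMap_comp, dualMap_comp, dualMap_τ, dualMap_τinv, Category.assoc, ← Category.assoc, ih,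
      Category.assoc]

theorem dualMap_injective {q m : ℕ} :
    Function.Injective (dualMap : (ob q ⟶ ob m) → (ob m ⟶ ob q)) := by
  intro f g h
  have h1 : τ q ≫ f = τ q ≫ g := by
    rw [← dualMap_dualMap_comp_τ, h, dualMap_dualMap_comp_τ]
  have h2 := congrArg (τinv q ≫ ·) h1
  simpa only [← Category.assoc, τinv_comp_τ, Category.id_comp] using h2

theorem dualMap_surjective {q m : ℕ} :
    Function.Surjective (dualMap : (ob q ⟶ ob m) → (ob m ⟶ ob q)) := by
  intro f
  -- The conjugation by τ that the double dual introduces is compensated in advance.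
  refine ⟨dualMap (τinv m ≫ f ≫ τ q), ?_⟩
  have h := congrArg (· ≫ τinv q) (dualMap_dualMap_comp_τ (τinv m ≫ f ≫ τ q))
  simpa only [Category.assoc, τ_comp_τinv, Category.comp_id, ← Category.assoc (τ m),
    Category.id_comp] using h

/-- The duality of the cyclic category as a bijection of sets of morphisms. -/
noncomputable def dualEquiv (q m : ℕ) : (ob q ⟶ ob m) ≃ (ob m ⟶ ob q) :=
  Equiv.ofBijective dualMap ⟨dualMap_injective, dualMap_surjective⟩

end Lam
end BivariantHopf

/-! ### The double complex of functions on Λ(-, [m]). -/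

namespace BivariantHopf
open CategoryTheory Opposite

open SimplexCategoryGenRel (mk)

section Corepresentable

variable (k : Type u) [Field k]

/-- The cocyclic `k`-module of functions on the sets of morphisms to a fixed object. -/
def functionsTo (a : Lam) : CocyclicMod k where
  obj c := ModuleCat.of k ((c ⟶ a) → k)
  map f := ModuleCat.ofHom (LinearMap.funLeft k k (f ≫ ·))
  map_id _ := ModuleCat.hom_ext (LinearMap.ext fun α => funext fun x =>
    congrArg α (Category.id_comp x))
  map_comp f g := ModuleCat.hom_ext (LinearMap.ext fun α => funext fun x =>
    congrArg α (Category.assoc f g x))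

variable {k}

namespace functionsTo

open Lam

variable {m q : ℕ}

/-- The value of a cochain of `functionsTo` at a morphism. -/
abbrev val (α : (functionsTo k (ob m)).operators.X q) (f : ob q ⟶ ob m) : k :=
  (show (ob q ⟶ ob m) → k from α) f

theorem ext_val {α β : (functionsTo k (ob m)).operators.X q} (h : ∀ f, val α f = val β f) :
    α = β := funext h

theorem bMap_apply (α : (functionsTo k (ob m)).operators.X q) (f : ob (q + 1) ⟶ ob m) :
    val (bMap (functionsTo k (ob m)).operators q α) f =
      ∑ i : Fin (q + 2), (-1) ^ (i : ℕ) * val α (δ q i ≫ f) := by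
  rw [bMap, LinearMap.sum_apply]
  exact Finset.sum_apply f Finset.univ _

theorem lamMap_apply (α : (functionsTo k (ob m)).operators.X q) (f : ob q ⟶ ob m) :
    val (lamMap (functionsTo k (ob m)).operators q α) f = (-1) ^ q * val α (τ q ≫ f) := rfl

theorem lamMap_pow_apply (α : (functionsTo k (ob m)).operators.X q) (f : ob q ⟶ ob m) (i : ℕ) :
    val ((lamMap (functionsTo k (ob m)).operators q ^ i) α) f =
      (-1) ^ (q * i) * val α (τpow q i ≫ f) := by
  induction i generalizing f with
  | zero =>
    rw [mul_zero, pow_zero, pow_zero, one_mul, τpow_zero, Category.id_comp]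
    rfl
  | succ i ih =>
    rw [pow_succ', Module.End.mul_apply, lamMap_apply, ih, τpow_succ, Category.assoc, mul_add,
      mul_one, pow_add, ← mul_assoc, mul_comm ((-1) ^ q)]

theorem normMap_apply (α : (functionsTo k (ob m)).operators.X q) (f : ob q ⟶ ob m) :
    val (normMap (functionsTo k (ob m)).operators q α) f =
      ∑ i ∈ Finset.range (q + 1), (-1) ^ (q * i) * val α (τpow q i ≫ f) := by
  rw [normMap, LinearMap.sum_apply]
  exact (Finset.sum_apply f _ _).trans (Finset.sum_congr rfl fun i _ => lamMap_pow_apply α f i)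

theorem horiz_even {p : ℕ} (hp : Even p) (α : (functionsTo k (ob m)).operators.X q)
    (f : ob q ⟶ ob m) : val (horiz (functionsTo k (ob m)).operators p q α) f =
      val α f - (-1) ^ q * val α (τ q ≫ f) := by
  rw [horiz, if_pos hp]
  rfl

theorem horiz_odd {p : ℕ} (hp : ¬ Even p) (α : (functionsTo k (ob m)).operators.X q)
    (f : ob q ⟶ ob m) : val (horiz (functionsTo k (ob m)).operators p q α) f =
      ∑ i ∈ Finset.range (q + 1), (-1) ^ (q * i) * val α (τpow q i ≫ f) := by
  rw [horiz, if_neg hp, normMap_apply]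

/-- An invariant cochain is determined by its values on the morphisms of the simplex category. -/
theorem ext_of_invariant {p : ℕ} (hp : Even p) {α β : (functionsTo k (ob m)).operators.X q}
    (hα : horiz (functionsTo k (ob m)).operators p q α = 0)
    (hβ : horiz (functionsTo k (ob m)).operators p q β = 0)
    (h : ∀ φ : mk q ⟶ mk m, val α (emb φ) = val β (emb φ)) : α = β := by
  have h1 : horiz (functionsTo k (ob m)).operators p q (α - β) = 0 := by
    rw [map_sub, hα, hβ, sub_zero]
  have h2 : ∀ f, val (α - β) f = (-1) ^ q * val (α - β) (τ q ≫ f) := fun f => by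
    have h3 := congrFun h1 f
    exact sub_eq_zero.1 ((horiz_even hp (α - β) f).symm.trans h3)
  -- Invariance propagates the vanishing along the orbit of a simplex under τ, and by the
  -- factorization these orbits exhaust all morphisms.
  have h4 : ∀ (a : ℕ) (φ : mk q ⟶ mk m), val (α - β) (τpow q a ≫ emb φ) = 0 := by
    intro a φ
    induction a with
    | zero =>
      rw [τpow_zero, Category.id_comp]
      exact sub_eq_zero.2 (h φ)
    | succ a ih =>
      rw [h2] at ih
      rw [← Category.assoc, ← τpow_succ'] at ih
      exact (mul_eq_zero.1 ih).resolve_left (pow_ne_zero _ (neg_ne_zero.2 one_ne_zero))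
  refine sub_eq_zero.1 (funext fun f => ?_)
  obtain ⟨a, φ, rfl⟩ := exists_factorization f
  exact h4 a φ

/-- A cochain with prescribed values on `τᵃ ≫ φ`. -/
noncomputable def ofPairs (c : ℕ → (mk q ⟶ mk m) → k) : (functionsTo k (ob m)).operators.X q :=
  fun f : ob q ⟶ ob m => c ((homEquiv q m).symm f).1 ((homEquiv q m).symm f).2

theorem ofPairs_apply (c : ℕ → (mk q ⟶ mk m) → k) {a : ℕ} (ha : a < q + 1) (φ : mk q ⟶ mk m) :
    val (ofPairs c) (τpow q a ≫ emb φ) = c a φ := by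
  have h : (homEquiv q m).symm (τpow q a ≫ emb φ) = (⟨a, ha⟩, φ) :=
    (homEquiv q m).symm_apply_apply (⟨a, ha⟩, φ)
  change c _ _ = _
  rw [h]

theorem ofPairs_emb (c : ℕ → (mk q ⟶ mk m) → k) (φ : mk q ⟶ mk m) :
    val (ofPairs c) (emb φ) = c 0 φ := by
  rw [← ofPairs_apply c (Nat.succ_pos q) φ, τpow_zero, Category.id_comp]

theorem neg_one_pow_mul_succ (q : ℕ) : (-1 : k) ^ (q * (q + 1)) = 1 :=
  (Nat.even_mul_succ_self q).neg_one_pow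

/-- The value at `τ ≫ τᵃ ≫ φ` of a cochain with prescribed values that are cyclic up to sign. -/
theorem ofPairs_τ (c : ℕ → (mk q ⟶ mk m) → k) {a : ℕ} (ha : a < q + 1)
    (hc : ∀ φ, c (q + 1) φ = c 0 φ) (φ : mk q ⟶ mk m) :
    val (ofPairs c) (τ q ≫ τpow q a ≫ emb φ) = c (a + 1) φ := by
  rw [← Category.assoc, ← τpow_succ']
  rcases Nat.lt_or_ge (a + 1) (q + 1) with h | h
  · rw [ofPairs_apply c h]
  · obtain rfl : a = q := by omega
    rw [τpow_period, Category.id_comp, ofPairs_emb, hc]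

/-- By the unique factorization, Z/(q+1) acts freely on the morphisms [q] → [m] with the simplices
as representatives of the orbits. The cochains in row q therefore form a coinduced module, and its
periodic complex with differentials 1 - λ and N is exact. -/
theorem exists_horiz_eq (p q : ℕ) (α : (functionsTo k (ob m)).operators.X q)
    (hα : horiz (functionsTo k (ob m)).operators (p + 1) q α = 0) :
    ∃ β, horiz (functionsTo k (ob m)).operators p q β = α := by
  by_cases hp : Even p
  · have hp' : ¬ Even (p + 1) := by simpa [Nat.even_add_one] using hp
    -- The equation (1 - λ)β = α is solved along each orbit by minus the signed partial sums of α,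
    -- starting with 0. The sum over the whole orbit is the value of Nα, so its vanishing is what
    -- makes the solution close up after q + 1 steps.
    let s : ℕ → (mk q ⟶ mk m) → k := fun a φ =>
      ∑ j ∈ Finset.range a, (-1) ^ (q * j) * val α (τpow q j ≫ emb φ)
    have hs : ∀ φ, s (q + 1) φ = 0 := fun φ =>
      (horiz_odd hp' α (emb φ)).symm.trans (congrFun hα (emb φ))
    let c : ℕ → (mk q ⟶ mk m) → k := fun a φ => (-1) ^ (q * a) * -s a φ
    have hc : ∀ φ, c (q + 1) φ = c 0 φ := fun φ => by
      change _ * -s (q + 1) φ = _ * -(0 : k)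
      rw [hs, neg_zero, mul_zero, mul_zero]
    refine ⟨ofPairs c, ext_val fun f => ?_⟩
    obtain ⟨a, φ, rfl⟩ := exists_factorization f
    rw [horiz_even hp, ofPairs_τ c a.2 hc, ofPairs_apply c a.2]
    change (-1) ^ (q * a) * -s a φ - (-1) ^ q * ((-1) ^ (q * (a + 1)) * -s (a + 1) φ) = _
    have h1 : s (a + 1) φ = s a φ + (-1) ^ (q * a) * val α (τpow q a ≫ emb φ) :=
      Finset.sum_range_succ _ _
    have h2 : ((-1 : k) ^ (q * a)) * (-1) ^ (q * a) = 1 := by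
      rw [← mul_pow, neg_one_mul, neg_neg, one_pow]
    have h3 : ((-1 : k) ^ q) * (-1) ^ q = 1 := by
      rw [← mul_pow, neg_one_mul, neg_neg, one_pow]
    rw [h1, mul_add q, mul_one, pow_add]
    linear_combination (s a φ * (-1) ^ (q * (a : ℕ)) +
      val α (τpow q a ≫ emb φ) * (-1) ^ (q * (a : ℕ)) * (-1) ^ (q * (a : ℕ))) * h3 +
      val α (τpow q a ≫ emb φ) * h2
  · have hp' : Even (p + 1) := by simpa [Nat.even_add_one] using hp
    -- An invariant α is the norm of its restriction to the orbit representatives. The norm is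
    -- itself invariant, so the comparison is only needed on simplices, where a single term of the
    -- sum survives.
    let c : ℕ → (mk q ⟶ mk m) → k := fun a φ => if a = 0 then val α (emb φ) else 0
    refine ⟨ofPairs c, ext_of_invariant hp' ?_ hα fun φ => ?_⟩
    · exact LinearMap.congr_fun (horiz_horiz (functionsTo k (ob m)).operators p q) _
    · rw [horiz_odd hp, Finset.sum_eq_single 0]
      · rw [mul_zero, pow_zero, one_mul, ofPairs_apply c (Nat.succ_pos q)]
        exact if_pos rfl
      · intro a ha h
        rw [ofPairs_apply c (Finset.mem_range.1 ha)]
        exact (congrArg _ (if_neg h)).trans (mul_zero _)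
      · exact fun h => absurd (Finset.mem_range.2 (Nat.succ_pos q)) h

theorem vert_zero_apply (α : (functionsTo k (ob m)).operators.X q) (f : ob (q + 1) ⟶ ob m) :
    val (vert (functionsTo k (ob m)).operators 0 q α) f =
      ∑ i : Fin (q + 2), (-1) ^ (i : ℕ) * val α (δ q i ≫ f) := by
  rw [vert, if_pos Even.zero, bMap_apply]

/-- Invariant cochains are determined by their restrictions to the simplex category, where b becomes
the simplicial coboundary of the m-simplex. A primitive of a cocycle is its evaluation on cones,
extended to all morphisms by the sign rule for invariance. -/
theorem exists_vert_eq (n : ℕ) (α : (functionsTo k (ob m)).operators.X (n + 1))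
    (h0 : horiz (functionsTo k (ob m)).operators 0 (n + 1) α = 0)
    (h1 : vert (functionsTo k (ob m)).operators 0 (n + 1) α = 0) :
    ∃ β, horiz (functionsTo k (ob m)).operators 0 n β = 0 ∧
      vert (functionsTo k (ob m)).operators 0 n β = α := by
  let c : ℕ → (mk n ⟶ mk m) → k := fun a φ => (-1) ^ (n * a) * val α (emb (Simp.cone φ))
  have hc : ∀ φ, c (n + 1) φ = c 0 φ := fun φ => by
    change (-1) ^ (n * (n + 1)) * _ = (-1) ^ (n * 0) * _
    rw [neg_one_pow_mul_succ, mul_zero, pow_zero]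
  have hβ : horiz (functionsTo k (ob m)).operators 0 n (ofPairs c) = 0 := by
    refine ext_val fun f => ?_
    obtain ⟨a, φ, rfl⟩ := exists_factorization f
    rw [horiz_even Even.zero, ofPairs_τ c a.2 hc, ofPairs_apply c a.2]
    change (-1) ^ (n * a) * _ - (-1) ^ n * ((-1) ^ (n * (a + 1)) * _) = 0
    have h3 : ((-1 : k) ^ n) * (-1) ^ n = 1 := by
      rw [← mul_pow, neg_one_mul, neg_neg, one_pow]
    rw [mul_add n, mul_one, pow_add]
    linear_combination (-(val α (emb (Simp.cone φ)) * (-1) ^ (n * (a : ℕ)))) * h3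
  refine ⟨ofPairs c, hβ, ext_of_invariant Even.zero ?_ h0 fun φ => ?_⟩
  -- The coboundary of an invariant cochain is invariant because (1 - λ)b = b'(1 - λ).
  · have h2 := LinearMap.congr_fun (lam_b (functionsTo k (ob m)).operators n) (ofPairs c)
    have h3 : (1 - lamMap (functionsTo k (ob m)).operators n) (ofPairs c) = 0 := by
      rwa [horiz, if_pos Even.zero] at hβ
    rw [LinearMap.comp_apply, LinearMap.comp_apply, h3, map_zero] at h2
    rw [horiz, vert, if_pos Even.zero, if_pos Even.zero]
    exact h2
  -- The cocycle condition is evaluated at the cone over φ. The zeroth term is α(φ), and the others,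
  -- with opposite signs, add up to the coboundary of the primitive at φ.
  · have h2 := (vert_zero_apply α (emb (Simp.cone φ))).symm.trans (congrFun h1 _)
    rw [Fin.sum_univ_succ] at h2
    change _ = (0 : k) at h2
    rw [vert_zero_apply, δ_zero_emb_cone] at *
    have h3 : ∀ i : Fin (n + 2), val (ofPairs c) (δ n i ≫ emb φ) =
        val α (δ (n + 1) i.succ ≫ emb (Simp.cone φ)) := by
      intro i
      rw [← emb_δ, ← emb_comp, ofPairs_emb, ← emb_δ, ← emb_comp, Simp.δ_succ_cone]
      change (-1) ^ (n * 0) * _ = _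
      rw [mul_zero, pow_zero, one_mul]
    simp only [h3]
    simp only [Fin.val_zero, pow_zero, one_mul, Fin.val_succ, pow_succ, mul_neg_one, neg_mul,
      Finset.sum_neg_distrib] at h2
    exact (eq_of_sub_eq_zero ((sub_eq_add_neg _ _).trans h2)).symm

/-- For q = 0 there is no rotation, so only vertices of the m-simplex occur. The cocycle condition
at the edge from the vertex 0 to a given vertex forces equal values. -/
theorem eq_const (α : (functionsTo k (ob m)).operators.X 0)
    (h1 : vert (functionsTo k (ob m)).operators 0 0 α = 0) : ∃ c : k, ∀ f, val α f = c := by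
  refine ⟨val α (emb (Simp.vertex m)), fun f => ?_⟩
  obtain ⟨a, φ, rfl⟩ := exists_factorization f
  have ha : (a : ℕ) = 0 := by omega
  rw [ha, τpow_zero, Category.id_comp]
  have h2 := (vert_zero_apply α (emb (Simp.cone φ))).symm.trans (congrFun h1 _)
  rw [Fin.sum_univ_two, δ_zero_emb_cone, ← emb_δ, ← emb_comp, Simp.δ_one_cone] at h2
  change _ = (0 : k) at h2
  simp only [Fin.val_zero, pow_zero, one_mul, Fin.val_one, pow_one, neg_mul] at h2
  exact eq_of_sub_eq_zero ((sub_eq_add_neg _ _).trans h2)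

end functionsTo

end Corepresentable
end BivariantHopf

/-! ### Generators and cogenerators of cocyclic modules as tests for exactness. -/

namespace BivariantHopf
open CategoryTheory Opposite

open CategoryTheory.Limits

section Separation

variable {k : Type u} [Field k]

theorem exists_ob_eq (c : Lam) : ∃ m, c = Lam.ob m := ⟨c.as.len, rfl⟩

/-- The morphism to `functionsTo k c` that belongs to a linear form on the module at `c`. -/
def toFunctionsTo {Y : CocyclicMod k} {c : Lam} (χ : Y.obj c →ₗ[k] k) : Y ⟶ functionsTo k c where
  app a := ModuleCat.ofHom (LinearMap.pi fun f : a ⟶ c => χ ∘ₗ (Y.map f).hom)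
  naturality a b f := by
    refine ModuleCat.hom_ext (LinearMap.ext fun v => funext fun x => ?_)
    change χ ((Y.map x).hom ((Y.map f).hom v)) = χ ((Y.map (f ≫ x)).hom v)
    rw [Y.map_comp]
    rfl

/-- The free cocyclic `k`-module on one generator at the object `c`. -/
noncomputable def freeAt (k : Type u) [Field k] (c : Lam) : CocyclicMod k where
  obj a := ModuleCat.of k ((c ⟶ a) →₀ k)
  map f := ModuleCat.ofHom (Finsupp.lmapDomain k k (· ≫ f))
  map_id a := by
    refine ModuleCat.hom_ext (Finsupp.lhom_ext' fun x => LinearMap.ext_ring ?_)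
    change Finsupp.mapDomain _ (Finsupp.single x (1 : k)) = Finsupp.single x 1
    rw [Finsupp.mapDomain_single, Category.comp_id]
  map_comp f g := by
    refine ModuleCat.hom_ext (Finsupp.lhom_ext' fun x => LinearMap.ext_ring ?_)
    change Finsupp.mapDomain _ (Finsupp.single x (1 : k)) =
      Finsupp.mapDomain _ (Finsupp.mapDomain _ (Finsupp.single x 1))
    rw [Finsupp.mapDomain_single, Finsupp.mapDomain_single, Finsupp.mapDomain_single,
      Category.assoc]

/-- The morphism from `freeAt k c` that belongs to an element of the module at `c`. -/
noncomputable def ofFreeAt {Y : CocyclicMod k} {c : Lam} (y : Y.obj c) : freeAt k c ⟶ Y where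
  app a := ModuleCat.ofHom (Finsupp.linearCombination k fun f : c ⟶ a => (Y.map f).hom y)
  naturality a b f := by
    refine ModuleCat.hom_ext (Finsupp.lhom_ext' fun x => LinearMap.ext_ring ?_)
    change Finsupp.linearCombination k _ (Finsupp.mapDomain _ (Finsupp.single x (1 : k))) =
      (Y.map f).hom (Finsupp.linearCombination k _ (Finsupp.single x (1 : k)))
    rw [Finsupp.mapDomain_single, Finsupp.linearCombination_single,
      Finsupp.linearCombination_single, one_smul, one_smul, Y.map_comp]
    rfl

theorem ofFreeAt_single {Y : CocyclicMod k} {c a : Lam} (y : Y.obj c) (f : c ⟶ a) :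
    ((ofFreeAt y).app a).hom (Finsupp.single f (1 : k)) = (Y.map f).hom y :=
  (Finsupp.linearCombination_single k (1 : k) f).trans (one_smul _ _)

/-- A linear form on Y_m extends to a morphism to `functionsTo` that returns the form when evaluated
at the identity of [m]. Since k is a field, these forms separate the elements of Y_m. -/
theorem eq_zero_of_comp_functionsTo {X Y : CocyclicMod k} (f : X ⟶ Y)
    (h : ∀ (m : ℕ) (g : Y ⟶ functionsTo k (Lam.ob m)), f ≫ g = 0) : f = 0 := by
  refine NatTrans.ext (funext fun c => ModuleCat.hom_ext (LinearMap.ext fun v => ?_))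
  obtain ⟨m, rfl⟩ := exists_ob_eq c
  refine (Module.forall_dual_apply_eq_zero_iff k _).1 fun χ => ?_
  have h1 := congrArg (fun g : X ⟶ functionsTo k (Lam.ob m) => (g.app (Lam.ob m)).hom v)
    (h m (toFunctionsTo χ))
  have h2 : χ ((Y.map (𝟙 (Lam.ob m))).hom ((f.app (Lam.ob m)).hom v)) = 0 :=
    congrFun h1 (𝟙 (Lam.ob m))
  rwa [Y.map_id] at h2

theorem eq_zero_of_freeAt_comp {X Y : CocyclicMod k} (f : X ⟶ Y)
    (h : ∀ (m : ℕ) (g : freeAt k (Lam.ob m) ⟶ X), g ≫ f = 0) : f = 0 := by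
  refine NatTrans.ext (funext fun c => ModuleCat.hom_ext (LinearMap.ext fun v => ?_))
  obtain ⟨m, rfl⟩ := exists_ob_eq c
  have h1 : (f.app (Lam.ob m)).hom (((ofFreeAt v).app (Lam.ob m)).hom
      (Finsupp.single (𝟙 (Lam.ob m)) (1 : k))) = 0 :=
    congrArg (fun g : freeAt k (Lam.ob m) ⟶ Y => (g.app (Lam.ob m)).hom
      (Finsupp.single (𝟙 (Lam.ob m)) (1 : k))) (h m (ofFreeAt v))
  rw [ofFreeAt_single, X.map_id] at h1
  exact h1

/-- Exactness says that the composite from the kernel of the second map to the cokernel of the first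
one vanishes. A test morphism on the cokernel becomes one on the middle term that kills the first
map, so it factors through the second map and vanishes on its kernel. Injectivity of the test
objects is not needed. -/
theorem exact_of_functionsTo (S : ShortComplex (CocyclicMod k))
    (h : ∀ (m : ℕ) (g : S.X₂ ⟶ functionsTo k (Lam.ob m)), S.f ≫ g = 0 → ∃ g', S.g ≫ g' = g) :
    S.Exact := by
  rw [ShortComplex.exact_iff_kernel_ι_comp_cokernel_π_zero]
  refine eq_zero_of_comp_functionsTo _ fun m g => ?_
  obtain ⟨g', hg⟩ := h m (cokernel.π S.f ≫ g) (by rw [cokernel.condition_assoc, zero_comp])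
  rw [Category.assoc, ← hg, kernel.condition_assoc, zero_comp]

theorem exact_of_freeAt (S : ShortComplex (CocyclicMod k))
    (h : ∀ (m : ℕ) (g : freeAt k (Lam.ob m) ⟶ S.X₂), g ≫ S.g = 0 → ∃ g', g' ≫ S.f = g) :
    S.Exact := by
  rw [ShortComplex.exact_iff_kernel_ι_comp_cokernel_π_zero]
  refine eq_zero_of_freeAt_comp _ fun m g => ?_
  obtain ⟨g', hg⟩ := h m (g ≫ kernel.ι S.g) (by rw [Category.assoc, kernel.condition, comp_zero])
  rw [← Category.assoc, ← hg, Category.assoc, cokernel.condition, comp_zero]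

end Separation

/-! ### The free modules that corepresent the total complex. -/

section Free

variable (k : Type u) [Field k]

/-- The free cocyclic `k`-module on one generator in each of the degrees `0, …, n`. -/
noncomputable def freeOn (n : ℕ) : CocyclicMod k where
  obj a := ModuleCat.of k ((Σ q : Fin (n + 1), Lam.ob q ⟶ a) →₀ k)
  map f := ModuleCat.ofHom (Finsupp.lmapDomain k k fun s => ⟨s.1, s.2 ≫ f⟩)
  map_id a := by
    refine ModuleCat.hom_ext (Finsupp.lhom_ext' fun x => LinearMap.ext_ring ?_)
    change Finsupp.mapDomain _ (Finsupp.single x (1 : k)) = Finsupp.single x 1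
    rw [Finsupp.mapDomain_single, Category.comp_id]
  map_comp f g := by
    refine ModuleCat.hom_ext (Finsupp.lhom_ext' fun x => LinearMap.ext_ring ?_)
    change Finsupp.mapDomain _ (Finsupp.single x (1 : k)) =
      Finsupp.mapDomain _ (Finsupp.mapDomain _ (Finsupp.single x 1))
    rw [Finsupp.mapDomain_single, Finsupp.mapDomain_single, Finsupp.mapDomain_single,
      Category.assoc]

variable {k}

/-- The morphism from a free cocyclic module with prescribed values at the generators. -/
noncomputable def freeDesc {Y : CocyclicMod k} {n : ℕ} (y : Tot Y.operators n) :
    freeOn k n ⟶ Y where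
  app a := ModuleCat.ofHom (Finsupp.linearCombination k
    fun s : Σ q : Fin (n + 1), Lam.ob q ⟶ a => (Y.map s.2).hom (y s.1))
  naturality a b f := by
    refine ModuleCat.hom_ext (Finsupp.lhom_ext' fun x => LinearMap.ext_ring ?_)
    change Finsupp.linearCombination k _ (Finsupp.mapDomain _ (Finsupp.single x (1 : k))) =
      (Y.map f).hom (Finsupp.linearCombination k _ (Finsupp.single x (1 : k)))
    rw [Finsupp.mapDomain_single, Finsupp.linearCombination_single,
      Finsupp.linearCombination_single, one_smul, one_smul, Y.map_comp]
    rfl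

theorem freeDesc_single {Y : CocyclicMod k} {n : ℕ} (y : Tot Y.operators n) {a : Lam}
    (s : Σ q : Fin (n + 1), Lam.ob q ⟶ a) :
    ((freeDesc y).app a).hom (Finsupp.single s (1 : k)) = (Y.map s.2).hom (y s.1) :=
  (Finsupp.linearCombination_single k (1 : k) s).trans (one_smul _ _)

variable (k) in
/-- The generators of `freeOn k n`. -/
noncomputable def freeGen (n : ℕ) : Tot (freeOn k n).operators n := fun q =>
  (Finsupp.single ⟨q, 𝟙 (Lam.ob q)⟩ (1 : k) : (Σ r : Fin (n + 1), Lam.ob r ⟶ Lam.ob q) →₀ k)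

theorem totMap_freeDesc {Y : CocyclicMod k} {n : ℕ} (y : Tot Y.operators n) :
    totMap (freeDesc y) n (freeGen k n) = y :=
  funext fun q => (freeDesc_single y ⟨q, 𝟙 (Lam.ob q)⟩).trans
    (congrArg (fun f => f.hom (y q)) (Y.map_id (Lam.ob q)))

theorem free_hom_ext {Y : CocyclicMod k} {n : ℕ} {f g : freeOn k n ⟶ Y}
    (h : totMap f n (freeGen k n) = totMap g n (freeGen k n)) : f = g := by
  refine NatTrans.ext (funext fun a => ModuleCat.hom_ext
    (Finsupp.lhom_ext' fun s => LinearMap.ext_ring ?_))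
  obtain ⟨q, s⟩ := s
  have key : ∀ f : freeOn k n ⟶ Y, (f.app a).hom (Finsupp.single ⟨q, s⟩ (1 : k)) =
      (Y.map s).hom (totMap f n (freeGen k n) q) := by
    intro f
    have h1 : ((freeOn k n).map s).hom (freeGen k n q) = Finsupp.single ⟨q, s⟩ (1 : k) := by
      refine (Finsupp.mapDomain_single).trans ?_
      rw [Category.id_comp]
    rw [← h1]
    exact LinearMap.congr_fun (congrArg ModuleCat.Hom.hom (f.naturality s)) (freeGen k n q)
  exact (key f).trans ((congrArg _ (congrFun h q)).trans (key g).symm)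

/-- Morphisms from a free cocyclic module are cochains of the total complex. -/
noncomputable def freeHomEquiv (Y : CocyclicMod k) (n : ℕ) :
    (freeOn k n ⟶ Y) ≃ₗ[k] Tot Y.operators n where
  toFun f := totMap f n (freeGen k n)
  map_add' _ _ := rfl
  map_smul' _ _ := rfl
  invFun := freeDesc
  left_inv _ := free_hom_ext (totMap_freeDesc _)
  right_inv := totMap_freeDesc

theorem freeHomEquiv_comp {Y Z : CocyclicMod k} {n : ℕ} (f : freeOn k n ⟶ Y) (g : Y ⟶ Z) :
    freeHomEquiv Z n (f ≫ g) = totMap g n (freeHomEquiv Y n f) := rfl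

variable (k) in
/-- The differential between the free cocyclic modules. -/
noncomputable def freeD (n : ℕ) : freeOn k (n + 1) ⟶ freeOn k n :=
  freeDesc (totD (freeOn k n).operators n (freeGen k n))

/-- Under Yoneda the differential is the total differential of the universal cochain `freeGen`.
Naturality of `totD` moves it along any morphism to Y. -/
theorem freeHomEquiv_d {Y : CocyclicMod k} {n : ℕ} (f : freeOn k n ⟶ Y) :
    freeHomEquiv Y (n + 1) (freeD k n ≫ f) = totD Y.operators n (freeHomEquiv Y n f) :=
  (congrArg (totMap f (n + 1)) (totMap_freeDesc _)).trans
    (LinearMap.congr_fun (totMap_totD f n) (freeGen k n)).symm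

theorem freeD_freeD (n : ℕ) : freeD k (n + 1) ≫ freeD k n = 0 := by
  apply (freeHomEquiv _ _).injective
  -- Inserting an identity exhibits the second differential as a composite to which `freeHomEquiv_d`
  -- applies again, which leaves `totD` applied twice.
  rw [freeHomEquiv_d, map_zero, ← Category.comp_id (freeD k n), freeHomEquiv_d]
  exact LinearMap.congr_fun (totD_totD _ n) _

/-- Epimorphisms of cocyclic modules are surjective in each degree, so a morphism lifts as soon as
its values at the generators do. -/
instance projective_freeOn (n : ℕ) : Projective (freeOn k n) where
  factors {Y Z} f e _ := by
    have h : ∀ q : Fin (n + 1), ∃ y : Y.operators.X q, component e q y = freeHomEquiv Z n f q :=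
      fun q => (ModuleCat.epi_iff_surjective (e.app (Lam.ob q))).1 inferInstance _
    choose y hy using h
    refine ⟨freeDesc y, (freeHomEquiv Z n).injective ?_⟩
    rw [freeHomEquiv_comp]
    refine Eq.trans ?_ (funext hy)
    exact congrArg (totMap e n) (totMap_freeDesc y)

theorem functionsTo.exists_totD_eq {m n : ℕ}
    (y : Tot (functionsTo k (Lam.ob m)).operators (n + 1))
    (hy : totD (functionsTo k (Lam.ob m)).operators (n + 1) y = 0) :
    ∃ x, totD (functionsTo k (Lam.ob m)).operators n x = y :=
  BivariantHopf.exists_totD_eq _ functionsTo.exists_horiz_eq functionsTo.exists_vert_eq y hy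

/-- Maps from the free complex to `functionsTo` form its total complex, which is exact in positive
degrees. The cogenerators therefore detect exactness of the free complex. -/
theorem exact_freeD (n : ℕ) :
    (ShortComplex.mk (freeD k (n + 1)) (freeD k n) (freeD_freeD n)).Exact := by
  refine exact_of_functionsTo _ fun m g hg => ?_
  have h1 := freeHomEquiv_d g
  rw [show freeD k (n + 1) ≫ g = 0 from hg, map_zero] at h1
  obtain ⟨x, hx⟩ := functionsTo.exists_totD_eq _ h1.symm
  refine ⟨freeDesc x, (freeHomEquiv _ _).injective ?_⟩
  rw [freeHomEquiv_d, ← hx]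
  exact congrArg _ (totMap_freeDesc x)

end Free
end BivariantHopf

/-! ### The cofree modules that represent the total complex of the linear dual of the cyclic dual.
-/

namespace BivariantHopf
open CategoryTheory Opposite

open CategoryTheory.Limits

section Cofree

variable (k : Type u) [Field k]

/-- The cocyclic `k`-module of `k`-linear forms on the cyclic dual of a cocyclic `k`-module. -/
noncomputable def dualMod : (CocyclicMod k)ᵒᵖ ⥤ CocyclicMod k := (cyclicDual k).op ⋙ linearDual k

/-- The cofree cocyclic `k`-module with one cogenerator in each of the degrees `0, …, n`. -/
def cofreeOn (n : ℕ) : CocyclicMod k where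
  obj a := ModuleCat.of k ((Σ q : Fin (n + 1), a ⟶ Lam.ob q) → k)
  map f := ModuleCat.ofHom (LinearMap.funLeft k k fun s => ⟨s.1, f ≫ s.2⟩)
  map_id _ := ModuleCat.hom_ext (LinearMap.ext fun α => funext fun x =>
    congrArg α (Sigma.ext rfl (heq_of_eq (Category.id_comp x.2))))
  map_comp f g := ModuleCat.hom_ext (LinearMap.ext fun α => funext fun x =>
    congrArg α (Sigma.ext rfl (heq_of_eq (Category.assoc f g x.2))))

variable {k}

/-- The linear form given by a component of a cochain of `dualMod`. -/
abbrev form {Y : CocyclicMod k} {q : ℕ} (y : ((dualMod k).obj (op Y)).operators.X q) :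
    Y.obj (Lam.ob q) →ₗ[k] k :=
  ModuleCat.Hom.hom (show Y.obj (Lam.ob q) ⟶ ModuleCat.of k k from y)

theorem form_ext {Y : CocyclicMod k} {q : ℕ} {y z : ((dualMod k).obj (op Y)).operators.X q}
    (h : form y = form z) : y = z := ModuleCat.hom_ext h

/-- The morphism to a cofree cocyclic module with prescribed linear forms. -/
noncomputable def cofreeLift {Y : CocyclicMod k} {n : ℕ}
    (y : Tot ((dualMod k).obj (op Y)).operators n) : Y ⟶ cofreeOn k n where
  app a := ModuleCat.ofHom (LinearMap.pi fun s : Σ q : Fin (n + 1), a ⟶ Lam.ob q =>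
    form (y s.1) ∘ₗ (Y.map s.2).hom)
  naturality a b f := by
    refine ModuleCat.hom_ext (LinearMap.ext fun v => funext fun s => ?_)
    change form (y s.1) ((Y.map s.2).hom ((Y.map f).hom v)) =
      form (y s.1) ((Y.map (f ≫ s.2)).hom v)
    rw [Y.map_comp]
    rfl

variable (k) in
/-- The cogenerators of `cofreeOn k n`. -/
def cofreeGen (n : ℕ) : Tot ((dualMod k).obj (op (cofreeOn k n))).operators n := fun q =>
  (ModuleCat.ofHom (LinearMap.proj (⟨q, 𝟙 (Lam.ob q)⟩ : Σ r : Fin (n + 1), Lam.ob q ⟶ Lam.ob r)) :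
    (cofreeOn k n).obj (Lam.ob q) ⟶ ModuleCat.of k k)

theorem totMap_cofreeLift {Y : CocyclicMod k} {n : ℕ}
    (y : Tot ((dualMod k).obj (op Y)).operators n) :
    totMap ((dualMod k).map (cofreeLift y).op) n (cofreeGen k n) = y :=
  funext fun q => form_ext (LinearMap.ext fun v =>
    congrArg (fun f => form (y q) (f.hom v)) (Y.map_id (Lam.ob q)))

theorem cofree_hom_ext {Y : CocyclicMod k} {n : ℕ} {f g : Y ⟶ cofreeOn k n}
    (h : totMap ((dualMod k).map f.op) n (cofreeGen k n) =
      totMap ((dualMod k).map g.op) n (cofreeGen k n)) : f = g := by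
  refine NatTrans.ext (funext fun a => ModuleCat.hom_ext (LinearMap.ext fun v => funext fun s => ?_))
  obtain ⟨q, s⟩ := s
  have key : ∀ f : Y ⟶ cofreeOn k n,
      (show (Σ q : Fin (n + 1), a ⟶ Lam.ob q) → k from (f.app a).hom v) ⟨q, s⟩ =
      form (totMap ((dualMod k).map f.op) n (cofreeGen k n) q) ((Y.map s).hom v) := by
    intro f
    have h1 := LinearMap.congr_fun (congrArg ModuleCat.Hom.hom (f.naturality s)) v
    refine Eq.trans ?_ (congrFun h1 ⟨q, 𝟙 (Lam.ob q)⟩).symm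
    exact congrArg ((f.app a).hom v : (Σ q : Fin (n + 1), a ⟶ Lam.ob q) → k)
      (Sigma.ext rfl (heq_of_eq (Category.comp_id s).symm))
  exact (key f).trans ((congrArg (fun y => form (y q) ((Y.map s).hom v)) h).trans (key g).symm)

/-- Morphisms to a cofree cocyclic module are cochains of the total complex of the dual. -/
noncomputable def cofreeHomEquiv (Y : CocyclicMod k) (n : ℕ) :
    (Y ⟶ cofreeOn k n) ≃ₗ[k] Tot ((dualMod k).obj (op Y)).operators n where
  toFun f := totMap ((dualMod k).map f.op) n (cofreeGen k n)
  map_add' _ _ := rfl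
  map_smul' _ _ := rfl
  invFun := cofreeLift
  left_inv _ := cofree_hom_ext (totMap_cofreeLift _)
  right_inv := totMap_cofreeLift

theorem cofreeHomEquiv_comp {Y Z : CocyclicMod k} {n : ℕ} (f : Y ⟶ Z) (g : Z ⟶ cofreeOn k n) :
    cofreeHomEquiv Y n (f ≫ g) = totMap ((dualMod k).map f.op) n (cofreeHomEquiv Z n g) := rfl

variable (k) in
/-- The differential between the cofree cocyclic modules. -/
noncomputable def cofreeD (n : ℕ) : cofreeOn k n ⟶ cofreeOn k (n + 1) :=
  cofreeLift (totD ((dualMod k).obj (op (cofreeOn k n))).operators n (cofreeGen k n))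

/-- This is again naturality of the total differential, now applied to the universal family of forms
`cofreeGen` and contravariantly in Y. -/
theorem cofreeHomEquiv_d {Y : CocyclicMod k} {n : ℕ} (f : Y ⟶ cofreeOn k n) :
    cofreeHomEquiv Y (n + 1) (f ≫ cofreeD k n) =
      totD ((dualMod k).obj (op Y)).operators n (cofreeHomEquiv Y n f) :=
  (congrArg (totMap ((dualMod k).map f.op) (n + 1)) (totMap_cofreeLift _)).trans
    (LinearMap.congr_fun (totMap_totD ((dualMod k).map f.op) n) (cofreeGen k n)).symm

theorem cofreeD_cofreeD (n : ℕ) : cofreeD k n ≫ cofreeD k (n + 1) = 0 := by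
  apply (cofreeHomEquiv _ _).injective
  rw [cofreeHomEquiv_d, map_zero, ← Category.id_comp (cofreeD k n), cofreeHomEquiv_d]
  exact LinearMap.congr_fun (totD_totD _ n) _

instance injective_cofreeOn (n : ℕ) : Injective (cofreeOn k n) where
  factors {Y Z} g e _ := by
    have h : ∀ q : Fin (n + 1), ∃ y : ((dualMod k).obj (op Z)).operators.X q,
        component ((dualMod k).map e.op) q y = cofreeHomEquiv Y n g q := fun q => by
      -- A morphism to a cofree module amounts to a family of linear forms without any condition, so
      -- it is enough to extend each form along a degreewise injection, by a k-linear retraction.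
      obtain ⟨r, hr⟩ := LinearMap.exists_leftInverse_of_injective (component e q)
        (LinearMap.ker_eq_bot.2 ((ModuleCat.mono_iff_injective (e.app (Lam.ob q))).1 inferInstance))
      refine ⟨(ModuleCat.ofHom (form (cofreeHomEquiv Y n g q) ∘ₗ r) :
        Z.obj (Lam.ob q) ⟶ ModuleCat.of k k), form_ext ?_⟩
      exact congrArg (fun f => form (cofreeHomEquiv Y n g q) ∘ₗ f) hr
    choose y hy using h
    refine ⟨cofreeLift y, (cofreeHomEquiv Y n).injective ?_⟩
    rw [cofreeHomEquiv_comp]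
    refine Eq.trans ?_ (funext hy)
    exact congrArg (totMap ((dualMod k).map e.op) n) (totMap_cofreeLift y)

/-- A linear form on the cyclic dual of a free cocyclic module as a function on sets of
morphisms. -/
noncomputable def dualFreeAt (m : ℕ) :
    (dualMod k).obj (op (freeAt k (Lam.ob m))) ⟶ functionsTo k (Lam.ob m) where
  app a := ModuleCat.ofHom (LinearMap.pi fun f : a ⟶ Lam.ob m =>
    { toFun := fun y : (freeAt k (Lam.ob m)).obj (duality.obj (op a)) ⟶ ModuleCat.of k k =>
        y.hom (Finsupp.single (duality.map f.op) (1 : k))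
      map_add' := fun _ _ => rfl
      map_smul' := fun _ _ => rfl })
  naturality a b g := by
    refine ModuleCat.hom_ext (LinearMap.ext fun y => funext fun f => ?_)
    refine congrArg (ModuleCat.Hom.hom
      (show (freeAt k (Lam.ob m)).obj (duality.obj (op a)) ⟶ ModuleCat.of k k from y)) ?_
    refine Finsupp.mapDomain_single.trans ?_
    exact congrArg (fun h => Finsupp.single h (1 : k)) (duality.map_comp f.op g.op).symm

theorem component_dualFreeAt (m q : ℕ)
    (y : ((dualMod k).obj (op (freeAt k (Lam.ob m)))).operators.X q)
    (f : Lam.ob q ⟶ Lam.ob m) : functionsTo.val (component (dualFreeAt m) q y) f =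
      form y (Finsupp.single (Lam.dualMap f) (1 : k)) := rfl

/-- With the next lemma this makes `dualFreeAt` an isomorphism: the linear dual of the cyclic dual
of a free module consists of functions on the same sets of morphisms, up to Connes' duality.
Surjectivity of the duality on morphisms gives injectivity here, and its injectivity gives
surjectivity below. -/
theorem component_dualFreeAt_injective (m q : ℕ) :
    Function.Injective (component (dualFreeAt (k := k) m) q) := by
  intro y z h
  refine form_ext (Finsupp.lhom_ext' fun f => LinearMap.ext_ring ?_)
  obtain ⟨g, rfl⟩ := Lam.dualMap_surjective f
  exact congrFun h g

theorem component_dualFreeAt_surjective (m q : ℕ) :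
    Function.Surjective (component (dualFreeAt (k := k) m) q) := by
  intro α
  refine ⟨(ModuleCat.ofHom (Finsupp.linearCombination k
    fun f => functionsTo.val α ((Lam.dualEquiv q m).symm f)) :
    (freeAt k (Lam.ob m)).obj (Lam.ob q) ⟶ ModuleCat.of k k), functionsTo.ext_val fun f => ?_⟩
  refine (component_dualFreeAt m q _ f).trans
    ((Finsupp.linearCombination_single k (1 : k) _).trans ?_)
  rw [one_smul]
  exact congrArg (functionsTo.val α) ((Lam.dualEquiv q m).symm_apply_apply f)

/-- Exactness is transported from `functionsTo` along the degreewise bijection `dualFreeAt`; this is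
where self-duality of Λ saves a second contraction. -/
theorem dualMod_freeAt.exists_totD_eq {m n : ℕ}
    (y : Tot ((dualMod k).obj (op (freeAt k (Lam.ob m)))).operators (n + 1))
    (hy : totD ((dualMod k).obj (op (freeAt k (Lam.ob m)))).operators (n + 1) y = 0) :
    ∃ x, totD ((dualMod k).obj (op (freeAt k (Lam.ob m)))).operators n x = y := by
  have h1 := LinearMap.congr_fun (totMap_totD (dualFreeAt (k := k) m) (n + 1)) y
  rw [LinearMap.comp_apply, LinearMap.comp_apply, hy, map_zero] at h1
  obtain ⟨x, hx⟩ := functionsTo.exists_totD_eq _ h1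
  choose x' hx' using fun q : Fin (n + 1) => component_dualFreeAt_surjective m q (x q)
  have hx'' : totMap (dualFreeAt m) n x' = x := funext hx'
  have h2 := LinearMap.congr_fun (totMap_totD (dualFreeAt (k := k) m) n) x'
  rw [LinearMap.comp_apply, LinearMap.comp_apply, hx'', hx] at h2
  exact ⟨x', funext fun q => component_dualFreeAt_injective m q (congrFun h2 q).symm⟩

/-- Maps from the generators `freeAt` to the cofree complex form the total complex of the previous
lemma, and these generators detect exactness. -/
theorem exact_cofreeD (n : ℕ) :
    (ShortComplex.mk (cofreeD k n) (cofreeD k (n + 1)) (cofreeD_cofreeD n)).Exact := by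
  refine exact_of_freeAt _ fun m g hg => ?_
  have h1 := cofreeHomEquiv_d g
  rw [show g ≫ cofreeD k (n + 1) = 0 from hg, map_zero] at h1
  obtain ⟨x, hx⟩ := dualMod_freeAt.exists_totD_eq _ h1.symm
  refine ⟨cofreeLift x, (cofreeHomEquiv _ _).injective ?_⟩
  rw [cofreeHomEquiv_d, ← hx]
  exact congrArg _ (totMap_cofreeLift x)

end Cofree
end BivariantHopf

/-! ### Ext as cocycles modulo coboundaries on a resolution. -/

namespace BivariantHopf
open CategoryTheory Opposite

open CategoryTheory.Limits

section ExtOfResolution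

variable {k : Type u} [Field k] {C : Type v} [Category.{w} C] [Abelian C] [Linear k C] [HasExt.{w'} C]

section Projective

variable {X : C} (R : ProjectiveResolution X) (Y : C)

/-- The disjunction covers all degrees at once. In degree 0 there are no coboundaries and the second
alternative is void, while in positive degrees the first alternative is contained in the second. The
same form is used for cohomology of the total complex, so that the two can be matched. -/
theorem extMk_eq_zero_of_projective_iff (n : ℕ) (f : R.complex.X n ⟶ Y)
    (hf : R.complex.d (n + 1) n ≫ f = 0) : R.extMk f (n + 1) rfl hf = 0 ↔
      f = 0 ∨ ∃ (p : ℕ) (_ : p + 1 = n) (g : R.complex.X p ⟶ Y), R.complex.d n p ≫ g = f := by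
  cases n with
  | zero =>
    refine ⟨fun h => Or.inl ?_, ?_⟩
    · rw [← R.extEquivCohomologyClass.apply_eq_iff_eq,
        ProjectiveResolution.extEquivCohomologyClass_extMk,
        ProjectiveResolution.extEquivCohomologyClass_zero,
        CochainComplex.HomComplex.CohomologyClass.mk_eq_zero_iff,
        CochainComplex.HomComplex.Cocycle.toSingleMk_mem_coboundaries_iff _ _ _ _ _ 1 rfl] at h
      obtain ⟨g, hg⟩ := h
      -- A projective resolution sits in nonpositive cohomological degrees, so the term in degree 1
      -- through which a null-homotopy would pass is zero.
      have h0 : IsZero (R.cochainComplex.X 1) :=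
        R.cochainComplex.isZero_of_isStrictlyLE 0 1 (by lia)
      rw [h0.eq_of_src g 0, comp_zero] at hg
      rw [← cancel_epi (R.cochainComplexXIso (-((0 : ℕ) : ℤ)) 0 rfl).hom, ← hg, comp_zero]
    · rintro (rfl | ⟨p, hp, -⟩)
      · exact R.extMk_zero _ rfl
      · omega
  | succ n =>
    rw [R.extMk_eq_zero_iff f (n + 2) rfl hf n rfl]
    constructor
    · rintro ⟨g, hg⟩
      exact Or.inr ⟨n, rfl, g, hg⟩
    · rintro (rfl | ⟨p, hp, g, hg⟩)
      · exact ⟨0, comp_zero⟩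
      · obtain rfl : p = n := by omega
        exact ⟨g, hg⟩

/-- The class in `Ext` of a cocycle on a projective resolution. -/
noncomputable def extOfProjective (n : ℕ) :
    LinearMap.ker (Linear.leftComp k Y (R.complex.d (n + 1) n)) →ₗ[k] Abelian.Ext X Y n where
  toFun f := R.extMk f.1 (n + 1) rfl f.2
  map_add' f g := (R.add_extMk f.1 g.1 (n + 1) rfl f.2 g.2).symm
  map_smul' r f := by
    -- The scalar r acts on Ext as composition with r times the identity of Y, which reduces the
    -- claim to composition of cocycles with a morphism.
    refine Eq.trans ?_ ((R.extMk_comp_mk₀ f.1 (n + 1) rfl f.2 (r • 𝟙 Y)).symm.trans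
      (Abelian.Ext.smul_eq_comp_mk₀ _ r).symm)
    congr 1
    rw [Linear.comp_smul, Category.comp_id]
    rfl

end Projective

section Injective

variable {Y : C} (R : InjectiveResolution Y) (X : C)

theorem extMk_eq_zero_of_injective_iff (n : ℕ) (f : X ⟶ R.cocomplex.X n)
    (hf : f ≫ R.cocomplex.d n (n + 1) = 0) : R.extMk f (n + 1) rfl hf = 0 ↔
      f = 0 ∨ ∃ (p : ℕ) (_ : p + 1 = n) (g : X ⟶ R.cocomplex.X p), g ≫ R.cocomplex.d p n = f := by
  cases n with
  | zero =>
    refine ⟨fun h => Or.inl ?_, ?_⟩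
    · rw [← R.extEquivCohomologyClass.apply_eq_iff_eq,
        InjectiveResolution.extEquivCohomologyClass_extMk,
        InjectiveResolution.extEquivCohomologyClass_zero,
        CochainComplex.HomComplex.CohomologyClass.mk_eq_zero_iff,
        CochainComplex.HomComplex.Cocycle.fromSingleMk_mem_coboundaries_iff _ _ _ _ _ (-1)
          (by lia)] at h
      obtain ⟨g, hg⟩ := h
      -- Dually, an injective resolution has no term in degree -1.
      have h0 : IsZero (R.cochainComplex.X (-1)) :=
        R.cochainComplex.isZero_of_isStrictlyGE 0 (-1) (by lia)
      rw [h0.eq_of_tgt g 0, zero_comp] at hg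
      rw [← cancel_mono (R.cochainComplexXIso ((0 : ℕ) : ℤ) 0 rfl).inv, ← hg, zero_comp]
    · rintro (rfl | ⟨p, hp, -⟩)
      · exact R.extMk_zero _ rfl
      · omega
  | succ n =>
    rw [R.extMk_eq_zero_iff f (n + 2) rfl hf n rfl]
    constructor
    · rintro ⟨g, hg⟩
      exact Or.inr ⟨n, rfl, g, hg⟩
    · rintro (rfl | ⟨p, hp, g, hg⟩)
      · exact ⟨0, zero_comp⟩
      · obtain rfl : p = n := by omega
        exact ⟨g, hg⟩

/-- The class in `Ext` of a cocycle on an injective resolution. -/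
noncomputable def extOfInjective (n : ℕ) :
    LinearMap.ker (Linear.rightComp k X (R.cocomplex.d n (n + 1))) →ₗ[k] Abelian.Ext X Y n where
  toFun f := R.extMk f.1 (n + 1) rfl f.2
  map_add' f g := (R.add_extMk f.1 g.1 (n + 1) rfl f.2 g.2).symm
  map_smul' r f := by
    -- Scalars act by precomposition with a multiple of the identity of X, since composition in Ext
    -- is bilinear.
    have h := (Abelian.Ext.smul_comp (Abelian.Ext.mk₀ (𝟙 X)) (R.extMk f.1 (n + 1) rfl f.2)
      (zero_add n) r)
    rw [Abelian.Ext.mk₀_id_comp, ← Abelian.Ext.mk₀_smul] at h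
    refine Eq.trans ?_ ((R.mk₀_comp_extMk f.1 (n + 1) rfl f.2 (r • 𝟙 X)).symm.trans h)
    congr 1
    rw [Linear.smul_comp, Category.id_comp]
    rfl

end Injective

end ExtOfResolution

/-! ### Cohomology of a cochain complex of vector spaces in terms of elements. -/

section HomologyClass

variable {k : Type u} [Field k] (K : CochainComplex (ModuleCat.{u} k) ℕ)

/-- The cocycles of a cochain complex of modules as elements of the kernel object. -/
noncomputable def cocycleLift (n : ℕ) :
    ModuleCat.of k (LinearMap.ker (K.d n (n + 1)).hom) ⟶ K.cycles n :=
  K.liftCycles (ModuleCat.ofHom (LinearMap.ker (K.d n (n + 1)).hom).subtype) (n + 1)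
    (CochainComplex.next ℕ n) (ModuleCat.hom_ext (LinearMap.ext fun z => z.2))

theorem iCycles_cocycleLift (n : ℕ) (z : LinearMap.ker (K.d n (n + 1)).hom) :
    (K.iCycles n).hom ((cocycleLift K n).hom z) = z :=
  LinearMap.congr_fun (congrArg ModuleCat.Hom.hom (K.liftCycles_i (ModuleCat.ofHom
    (LinearMap.ker (K.d n (n + 1)).hom).subtype) (n + 1) (CochainComplex.next ℕ n)
      (ModuleCat.hom_ext (LinearMap.ext fun z => z.2)))) z

theorem iCycles_injective (n : ℕ) : Function.Injective (K.iCycles n).hom :=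
  (ModuleCat.mono_iff_injective _).1 inferInstance

/-- The cohomology class of a cocycle of a cochain complex of modules. -/
noncomputable def classOf (n : ℕ) : LinearMap.ker (K.d n (n + 1)).hom →ₗ[k] K.homology n :=
  (cocycleLift K n ≫ K.homologyπ n).hom

theorem classOf_surjective (n : ℕ) : Function.Surjective (classOf K n) := by
  intro x
  obtain ⟨z, rfl⟩ := (ModuleCat.epi_iff_surjective (K.homologyπ n)).1 inferInstance x
  have hz : (K.d n (n + 1)).hom ((K.iCycles n).hom z) = 0 :=
    LinearMap.congr_fun (congrArg ModuleCat.Hom.hom (K.iCycles_d n (n + 1))) z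
  exact ⟨⟨_, hz⟩, congrArg (K.homologyπ n).hom
    (iCycles_injective K n (iCycles_cocycleLift K n ⟨_, hz⟩))⟩

theorem classOf_eq_zero_iff (n : ℕ) (z : LinearMap.ker (K.d n (n + 1)).hom) :
    classOf K n z = 0 ↔ (z : K.X n) = 0 ∨ ∃ (p : ℕ) (_ : p + 1 = n) (y : K.X p),
      (K.d p n).hom y = z := by
  have hex : (ShortComplex.mk (K.toCycles ((ComplexShape.up ℕ).prev n) n) (K.homologyπ n)
      (K.toCycles_comp_homologyπ _ n)).Exact :=
    ShortComplex.exact_of_g_is_cokernel _ (K.homologyIsCokernel _ n rfl)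
  rw [ShortComplex.moduleCat_exact_iff] at hex
  constructor
  · intro h
    have h1 : ∃ y, (K.d ((ComplexShape.up ℕ).prev n) n).hom y = z := by
      obtain ⟨y, hy⟩ := hex _ h
      refine ⟨y, Eq.trans ?_ (iCycles_cocycleLift K n z)⟩
      refine Eq.trans (LinearMap.congr_fun (congrArg ModuleCat.Hom.hom
        (K.toCycles_i ((ComplexShape.up ℕ).prev n) n)) y).symm ?_
      exact congrArg (K.iCycles n).hom hy
    cases n with
    | zero =>
      obtain ⟨y, h1⟩ := h1
      refine Or.inl (h1.symm.trans ?_)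
      -- Degree 0 has no predecessor, so the differential attached to the default value of `prev` is
      -- zero.
      rw [K.shape _ _ (by simp)]
      rfl
    | succ n =>
      rw [CochainComplex.prev_nat_succ] at h1
      exact Or.inr ⟨n, rfl, h1⟩
  · rintro (h | ⟨p, hp, y, hy⟩)
    · rw [show z = 0 from Subtype.ext h, map_zero]
    · have h1 : (K.toCycles p n).hom y = (cocycleLift K n).hom z := by
        refine iCycles_injective K n (Eq.trans ?_ (hy.trans (iCycles_cocycleLift K n z).symm))
        exact LinearMap.congr_fun (congrArg ModuleCat.Hom.hom (K.toCycles_i p n)) y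
      refine (congrArg (K.homologyπ n).hom h1.symm).trans ?_
      exact LinearMap.congr_fun (congrArg ModuleCat.Hom.hom (K.toCycles_comp_homologyπ p n)) y

theorem homologyMap_classOf {K L : CochainComplex (ModuleCat.{u} k) ℕ} (f : K ⟶ L) (n : ℕ)
    (z : LinearMap.ker (K.d n (n + 1)).hom) (z' : LinearMap.ker (L.d n (n + 1)).hom)
    (h : (f.f n).hom z = z') :
    (HomologicalComplex.homologyMap f n).hom (classOf K n z) = classOf L n z' := by
  have h1 := LinearMap.congr_fun (congrArg ModuleCat.Hom.hom
    (HomologicalComplex.homologyπ_naturality f n)) ((cocycleLift K n).hom z)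
  refine Eq.trans h1 (congrArg (L.homologyπ n).hom (iCycles_injective L n ?_))
  refine Eq.trans (LinearMap.congr_fun (congrArg ModuleCat.Hom.hom
    (HomologicalComplex.cyclesMap_i f n)) _) ?_
  refine Eq.trans ?_ (h.trans (iCycles_cocycleLift L n z').symm)
  exact congrArg (f.f n).hom (iCycles_cocycleLift K n z)

end HomologyClass
end BivariantHopf

/-! ### The free and cofree resolutions of the constant cocyclic module. -/

namespace BivariantHopf
open CategoryTheory Opposite

open CategoryTheory.Limits

section Resolutions

variable {C : Type v} [Category.{w} C] [Abelian C]

/-- A projective resolution from an exact sequence of projective objects. -/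
noncomputable def projectiveResolutionOf (X : ℕ → C) (d : ∀ n, X (n + 1) ⟶ X n)
    (hd : ∀ n, d (n + 1) ≫ d n = 0) (hX : ∀ n, Projective (X n))
    (hex : ∀ n, (ShortComplex.mk (d (n + 1)) (d n) (hd n)).Exact) {Z : C} (ε : X 0 ⟶ Z)
    [Epi ε] (hε : d 0 ≫ ε = 0) (hexε : (ShortComplex.mk (d 0) ε hε).Exact) :
    ProjectiveResolution Z where
  complex := ChainComplex.of X d hd
  projective := hX
  π := (ChainComplex.toSingle₀Equiv _ _).symm ⟨ε,
    (congrArg (· ≫ ε) (ChainComplex.of_d X d 0)).trans hε⟩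
  quasiIso := ⟨fun n => by
    cases n
    -- In degree 0 being a quasi-isomorphism means that the augmentation is a cokernel of the first
    -- differential: exactness at the zeroth term and surjectivity of ε. In higher degrees the
    -- target is zero and exactness of the complex is enough.
    · rw [ChainComplex.quasiIsoAt₀_iff, ShortComplex.quasiIso_iff_of_zeros']
      · refine (ShortComplex.exact_and_epi_g_iff_of_iso (S₂ := ShortComplex.mk (d 0) ε hε) ?_).2
          ⟨hexε, inferInstance⟩
        exact ShortComplex.isoMk (Iso.refl _) (Iso.refl _) (Iso.refl _)
          ((Category.id_comp _).trans ((ChainComplex.of_d X d 0).symm.trans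
            (Category.comp_id _).symm))
          ((Category.id_comp _).trans ((ChainComplex.toSingle₀Equiv_symm_apply_f_zero
            (C := ChainComplex.of X d hd) ε
            ((congrArg (· ≫ ε) (ChainComplex.of_d X d 0)).trans hε)).symm.trans
              (Category.comp_id _).symm))
      all_goals rfl
    · rename_i n
      rw [quasiIsoAt_iff_exactAt']
      · rw [HomologicalComplex.exactAt_iff' _ (n + 1 + 1) (n + 1) n (by simp) (by simp)]
        refine (ShortComplex.exact_iff_of_iso ?_).1 (hex n)
        exact ShortComplex.isoMk (Iso.refl _) (Iso.refl _) (Iso.refl _)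
          (by simp [HomologicalComplex.sc', HomologicalComplex.shortComplexFunctor',
            ChainComplex.of_d])
          (by simp [HomologicalComplex.sc', HomologicalComplex.shortComplexFunctor',
            ChainComplex.of_d])
      · apply ChainComplex.exactAt_succ_single_obj⟩

/-- An injective resolution from an exact sequence of injective objects. -/
noncomputable def injectiveResolutionOf (X : ℕ → C) (d : ∀ n, X n ⟶ X (n + 1))
    (hd : ∀ n, d n ≫ d (n + 1) = 0) (hX : ∀ n, Injective (X n))
    (hex : ∀ n, (ShortComplex.mk (d n) (d (n + 1)) (hd n)).Exact) {Z : C} (η : Z ⟶ X 0)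
    [Mono η] (hη : η ≫ d 0 = 0) (hexη : (ShortComplex.mk η (d 0) hη).Exact) :
    InjectiveResolution Z where
  cocomplex := CochainComplex.of X d hd
  injective := hX
  ι := (CochainComplex.fromSingle₀Equiv _ _).symm ⟨η,
    (congrArg (η ≫ ·) (CochainComplex.of_d X d 0)).trans hη⟩
  quasiIso := ⟨fun n => by
    cases n
    · rw [CochainComplex.quasiIsoAt₀_iff, ShortComplex.quasiIso_iff_of_zeros]
      · refine (ShortComplex.exact_and_mono_f_iff_of_iso (S₂ := ShortComplex.mk η (d 0) hη) ?_).2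
          ⟨hexη, inferInstance⟩
        exact ShortComplex.isoMk (Iso.refl _) (Iso.refl _) (Iso.refl _)
          ((Category.id_comp _).trans
            ((CochainComplex.fromSingle₀Equiv_symm_apply_f_zero (C := CochainComplex.of X d hd) η
              ((congrArg (η ≫ ·) (CochainComplex.of_d X d 0)).trans hη)).symm.trans
              (Category.comp_id _).symm))
          ((Category.id_comp _).trans ((CochainComplex.of_d X d 0).symm.trans
            (Category.comp_id _).symm))
      all_goals rfl
    · rename_i n
      rw [quasiIsoAt_iff_exactAt]
      · rw [HomologicalComplex.exactAt_iff' _ n (n + 1) (n + 1 + 1) (by simp) (by simp)]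
        refine (ShortComplex.exact_iff_of_iso ?_).1 (hex n)
        exact ShortComplex.isoMk (Iso.refl _) (Iso.refl _) (Iso.refl _)
          (by simp [HomologicalComplex.sc', HomologicalComplex.shortComplexFunctor',
            CochainComplex.of_d])
          (by simp [HomologicalComplex.sc', HomologicalComplex.shortComplexFunctor',
            CochainComplex.of_d])
      · apply CochainComplex.exactAt_succ_single_obj⟩

end Resolutions

section Constant

variable (k : Type u) [Field k]

/-- The constant cocyclic `k`-module with value `k`. -/
def constMod : CocyclicMod k := (Functor.const Lam).obj (ModuleCat.of k k)

variable {k}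

/-- The total differential of a cochain of degree `0` that is invariant and equalizes the two
cofaces. -/
theorem totD_zero_eq_zero {A : CocyclicObject (ModuleCat.{u} k)} (y : Tot A 0)
    (h : (A.τ 0).hom (y 0) = y 0) (h' : (A.δ 0 0).hom (y 0) = (A.δ 0 1).hom (y 0)) :
    totD A 0 y = 0 := by
  refine funext fun q => ?_
  obtain ⟨q, hq⟩ := q
  obtain rfl | rfl : q = 0 ∨ q = 1 := by omega
  · refine (totD_zero A 0 y).trans ?_
    rw [horiz, if_pos Even.zero, LinearMap.sub_apply, lamMap, pow_zero, one_smul, h]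
    exact sub_self _
  · refine (totD_last A 0 y).trans ?_
    rw [vert, if_pos Even.zero, bMap, Fin.sum_univ_two, LinearMap.add_apply, LinearMap.smul_apply,
      LinearMap.smul_apply]
    change (-1 : k) ^ 0 • (A.δ 0 0).hom (y 0) + (-1 : k) ^ 1 • (A.δ 0 1).hom (y 0) = 0
    rw [h', pow_zero, one_smul, pow_one, neg_smul, one_smul, add_neg_cancel]

variable (k) in
/-- The augmentation of the free resolution of the constant cocyclic module. -/
noncomputable def freeAug : freeOn k 0 ⟶ constMod k := freeDesc (Y := constMod k) fun _ => (1 : k)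

theorem freeAug_single {a : Lam} (s : Σ q : Fin 1, Lam.ob q ⟶ a) :
    ((freeAug k).app a).hom (Finsupp.single s (1 : k)) = (1 : k) :=
  freeDesc_single _ s

/-- Every [m] receives a morphism from [0], for instance the vertex 0, and the augmentation takes
the value 1 on it. -/
instance epi_freeAug : Epi (freeAug k) := by
  rw [NatTrans.epi_iff_epi_app]
  intro a
  obtain ⟨m, rfl⟩ := exists_ob_eq a
  rw [ModuleCat.epi_iff_surjective]
  intro c
  have h := freeAug_single (k := k) ⟨0, Lam.emb (Simp.vertex m)⟩
  let c' : k := c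
  let x : (freeOn k 0).obj (Lam.ob m) :=
    (Finsupp.single ⟨0, Lam.emb (Simp.vertex m)⟩ (1 : k) : (Σ q : Fin 1, Lam.ob q ⟶ Lam.ob m) →₀ k)
  refine ⟨c' • x, (map_smul ((freeAug k).app (Lam.ob m)).hom c' x).trans ?_⟩
  exact (congrArg (c' • ·) h).trans (mul_one c')

theorem freeD_freeAug : freeD k 0 ≫ freeAug k = 0 := by
  apply (freeHomEquiv _ _).injective
  rw [freeHomEquiv_d, map_zero]
  -- All operators of the constant module are identities, so both conditions hold by definition.
  exact totD_zero_eq_zero _ rfl rfl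

theorem functionsTo.eq_const_of_totD {m : ℕ} (y : Tot (functionsTo k (Lam.ob m)).operators 0)
    (hy : totD (functionsTo k (Lam.ob m)).operators 0 y = 0) :
    ∃ c : k, ∀ f, functionsTo.val (y 0) f = c :=
  functionsTo.eq_const (y 0) ((totD_last _ 0 y).symm.trans (congrFun hy ⟨1, by omega⟩))

/-- A test morphism that kills the first differential is a degree 0 cocycle of `functionsTo`, hence
a constant c. It factors through the augmentation by way of the linear form given by multiplication
with c. -/
theorem exact_freeAug : (ShortComplex.mk (freeD k 0) (freeAug k) freeD_freeAug).Exact := by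
  refine exact_of_functionsTo _ fun m g hg => ?_
  have h1 := freeHomEquiv_d g
  rw [show freeD k 0 ≫ g = 0 from hg, map_zero] at h1
  obtain ⟨c, hc⟩ := functionsTo.eq_const_of_totD _ h1.symm
  let g' : constMod k ⟶ functionsTo k (Lam.ob m) :=
    toFunctionsTo (Y := constMod k) (LinearMap.mulLeft k c)
  refine ⟨g', (freeHomEquiv _ _).injective (funext fun q => ?_)⟩
  obtain rfl : q = 0 := Fin.fin_one_eq_zero q
  refine functionsTo.ext_val fun f => ?_
  refine Eq.trans ?_ (hc f).symm
  exact (congrArg (fun x : k => c * x) (freeAug_single (k := k) ⟨0, 𝟙 (Lam.ob 0)⟩)).trans (mul_one c)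

variable (k) in
/-- The coaugmentation of the cofree resolution of the constant cocyclic module. -/
noncomputable def cofreeAug : constMod k ⟶ cofreeOn k 0 :=
  cofreeLift (Y := constMod k) fun _ => (𝟙 (ModuleCat.of k k) : ModuleCat.of k k ⟶ _)

instance mono_cofreeAug : Mono (cofreeAug k) := by
  rw [NatTrans.mono_iff_mono_app]
  intro a
  obtain ⟨m, rfl⟩ := exists_ob_eq a
  rw [ModuleCat.mono_iff_injective]
  intro c c' h
  -- The dual of the vertex 0 is a morphism [m] → [0], and evaluation at it recovers the constant.
  exact congrFun h ⟨0, Lam.dualMap (Lam.emb (Simp.vertex m))⟩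

theorem cofreeAug_cofreeD : cofreeAug k ≫ cofreeD k 0 = 0 := by
  apply (cofreeHomEquiv _ _).injective
  rw [cofreeHomEquiv_d, map_zero]
  exact totD_zero_eq_zero _ rfl rfl

/-- Under `dualFreeAt` a test morphism becomes a degree 0 cocycle of `functionsTo`. Its constant
value c is the image of the generator under the required lift. -/
theorem exact_cofreeAug : (ShortComplex.mk (cofreeAug k) (cofreeD k 0) cofreeAug_cofreeD).Exact := by
  refine exact_of_freeAt _ fun m g hg => ?_
  have h1 := cofreeHomEquiv_d g
  rw [show g ≫ cofreeD k 0 = 0 from hg, map_zero] at h1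
  have h2 := LinearMap.congr_fun (totMap_totD (dualFreeAt (k := k) m) 0) (cofreeHomEquiv _ 0 g)
  rw [LinearMap.comp_apply, LinearMap.comp_apply, ← h1, map_zero] at h2
  obtain ⟨c, hc⟩ := functionsTo.eq_const_of_totD _ h2
  let g' : freeAt k (Lam.ob m) ⟶ constMod k := ofFreeAt (Y := constMod k) c
  refine ⟨g', (cofreeHomEquiv _ _).injective (funext fun q => ?_)⟩
  obtain rfl : q = 0 := Fin.fin_one_eq_zero q
  refine component_dualFreeAt_injective m 0 (functionsTo.ext_val fun f => ?_)
  refine Eq.trans ?_ (hc f).symm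
  exact ofFreeAt_single (Y := constMod k) c (Lam.dualMap f)

/-- The free resolution of a cocyclic module isomorphic to the constant one. -/
noncomputable def freeResolution {Z : CocyclicMod k} (e : constMod k ≅ Z) :
    ProjectiveResolution Z :=
  have h : freeD k 0 ≫ freeAug k ≫ e.hom = 0 := by
    rw [← Category.assoc, freeD_freeAug, zero_comp]
  projectiveResolutionOf (freeOn k) (freeD k) freeD_freeD projective_freeOn exact_freeD
    (freeAug k ≫ e.hom) h
    ((ShortComplex.exact_iff_of_iso (S₁ := ShortComplex.mk (freeD k 0) (freeAug k) freeD_freeAug)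
      (S₂ := ShortComplex.mk (freeD k 0) (freeAug k ≫ e.hom) h)
      (ShortComplex.isoMk (Iso.refl _) (Iso.refl _) e (by simp) (by simp))).1 exact_freeAug)

/-- The cofree resolution of a cocyclic module isomorphic to the constant one. -/
noncomputable def cofreeResolution {Z : CocyclicMod k} (e : constMod k ≅ Z) :
    InjectiveResolution Z :=
  have h : (e.inv ≫ cofreeAug k) ≫ cofreeD k 0 = 0 := by
    rw [Category.assoc, cofreeAug_cofreeD, comp_zero]
  injectiveResolutionOf (cofreeOn k) (cofreeD k) cofreeD_cofreeD injective_cofreeOn exact_cofreeD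
    (e.inv ≫ cofreeAug k) h
    ((ShortComplex.exact_iff_of_iso
      (S₁ := ShortComplex.mk (cofreeAug k) (cofreeD k 0) cofreeAug_cofreeD)
      (S₂ := ShortComplex.mk (e.inv ≫ cofreeAug k) (cofreeD k 0) h)
      (ShortComplex.isoMk e (Iso.refl _) (Iso.refl _) (by simp) (by simp))).1 exact_cofreeAug)

theorem freeResolution_d {Z : CocyclicMod k} (e : constMod k ≅ Z) (n : ℕ) :
    (freeResolution e).complex.d (n + 1) n = freeD k n := ChainComplex.of_d _ _ n

theorem cofreeResolution_d {Z : CocyclicMod k} (e : constMod k ≅ Z) (n : ℕ) :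
    (cofreeResolution e).cocomplex.d n (n + 1) = cofreeD k n := CochainComplex.of_d _ _ n

end Constant
end BivariantHopf

/-! ### Comparison of Ext with cyclic cohomology. -/

namespace BivariantHopf
open CategoryTheory Opposite

open CategoryTheory.Limits

section Comparison

/-- Two quotients of a module with the same kernel are isomorphic. -/
noncomputable def equivOfSurjective {k M N P : Type*} [Ring k] [AddCommGroup M] [AddCommGroup N]
    [AddCommGroup P] [Module k M] [Module k N] [Module k P] (f : M →ₗ[k] N) (g : M →ₗ[k] P)
    (hf : Function.Surjective f) (hg : Function.Surjective g) (h : ∀ x, f x = 0 ↔ g x = 0) :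
    N ≃ₗ[k] P :=
  (f.quotKerEquivOfSurjective hf).symm ≪≫ₗ
    Submodule.quotEquivOfEq (LinearMap.ker f) (LinearMap.ker g) (Submodule.ext h) ≪≫ₗ
    g.quotKerEquivOfSurjective hg

theorem equivOfSurjective_apply {k M N P : Type*} [Ring k] [AddCommGroup M] [AddCommGroup N]
    [AddCommGroup P] [Module k M] [Module k N] [Module k P] (f : M →ₗ[k] N) (g : M →ₗ[k] P)
    (hf : Function.Surjective f) (hg : Function.Surjective g) (h : ∀ x, f x = 0 ↔ g x = 0)
    (x : M) : equivOfSurjective f g hf hg h (f x) = g x := by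
  have h1 : (f.quotKerEquivOfSurjective hf).symm (f x) = Submodule.Quotient.mk x := by
    rw [LinearEquiv.symm_apply_eq]
    rfl
  rw [equivOfSurjective, LinearEquiv.trans_apply, LinearEquiv.trans_apply, h1]
  rfl

variable {k : Type u} [Field k]

theorem totComplex_d (Y : CocyclicMod k) (n : ℕ) :
    (totComplex Y).d n (n + 1) = ModuleCat.ofHom (totD Y.operators n) := by
  simp only [totComplex, CochainComplex.of_d]

theorem totComplex_d_apply (Y : CocyclicMod k) (n : ℕ) (y : Tot Y.operators n) :
    ((totComplex Y).d n (n + 1)).hom y = totD Y.operators n y :=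
  congrArg (fun f => f.hom y) (totComplex_d Y n)

/-- The cocycles of the total complex. -/
abbrev Cocycles (Y : CocyclicMod k) (n : ℕ) : Type u :=
  LinearMap.ker ((totComplex Y).d n (n + 1)).hom

theorem Cocycles.totD_eq_zero {Y : CocyclicMod k} {n : ℕ} (z : Cocycles Y n) :
    totD Y.operators n z.1 = 0 := (totComplex_d_apply Y n z.1).symm.trans z.2

/-- The cyclic cohomology class of a cocycle. -/
noncomputable def cyclicClass (Y : CocyclicMod k) (n : ℕ) : Cocycles Y n →ₗ[k] (HC k n).obj Y :=
  classOf (totComplex Y) n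

theorem cyclicClass_surjective (Y : CocyclicMod k) (n : ℕ) :
    Function.Surjective (cyclicClass Y n) := classOf_surjective _ n

theorem cyclicClass_eq_zero_iff (Y : CocyclicMod k) (n : ℕ) (z : Cocycles Y n) :
    cyclicClass Y n z = 0 ↔ z.1 = 0 ∨ ∃ (p : ℕ) (_ : p + 1 = n) (y : (totComplex Y).X p),
      ((totComplex Y).d p n).hom y = z.1 := classOf_eq_zero_iff _ n z

theorem HC_map_cyclicClass {Y Y' : CocyclicMod k} (g : Y ⟶ Y') (n : ℕ) (z : Cocycles Y n)
    (z' : Cocycles Y' n) (h : totMap g n z.1 = z'.1) :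
    ((HC k n).map g).hom (cyclicClass Y n z) = cyclicClass Y' n z' :=
  homologyMap_classOf ((totFunctor k).map g) n z z' h

/-- The image of a cocycle under a morphism of cocyclic modules. -/
def Cocycles.map {Y Y' : CocyclicMod k} (g : Y ⟶ Y') {n : ℕ} (z : Cocycles Y n) :
    Cocycles Y' n :=
  ⟨totMap g n z.1, (totComplex_d_apply Y' n _).trans
    ((LinearMap.congr_fun (totMap_totD g n) z.1).trans
      ((congrArg (totMap g (n + 1)) z.totD_eq_zero).trans (map_zero _)))⟩

section Projective

variable {Z : CocyclicMod k} (e : constMod k ≅ Z) (Y : CocyclicMod k) (n : ℕ)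

theorem freeResolution_d_comp (f : freeOn k n ⟶ Y) :
    (freeResolution e).complex.d (n + 1) n ≫ f = 0 ↔
      totD Y.operators n (freeHomEquiv Y n f) = 0 := by
  rw [freeResolution_d]
  rw [← freeHomEquiv_d]
  exact (LinearEquiv.map_eq_zero_iff (freeHomEquiv Y (n + 1))).symm

/-- The class in `Ext` of a cocycle of the total complex, by the free resolution. -/
noncomputable def freeClass : Cocycles Y n →ₗ[k] Abelian.Ext Z Y n :=
  extOfProjective (freeResolution e) Y n ∘ₗ
    LinearMap.codRestrict _ ((freeHomEquiv Y n).symm.toLinearMap ∘ₗ Submodule.subtype _)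
      fun z => (freeResolution_d_comp e Y n _).2
        ((congrArg _ ((freeHomEquiv Y n).apply_symm_apply z.1)).trans z.totD_eq_zero)

/-- Any morphism that represents the cocycle may be used, not only the chosen preimage. This makes
composites available as representatives in the naturality argument. -/
theorem freeClass_eq (z : Cocycles Y n) (f : freeOn k n ⟶ Y) (hf : freeHomEquiv Y n f = z.1) :
    freeClass e Y n z = (freeResolution e).extMk f (n + 1) rfl
      ((freeResolution_d_comp e Y n f).2 ((congrArg _ hf).trans z.totD_eq_zero)) := by
  obtain rfl : (freeHomEquiv Y n).symm z.1 = f := (LinearEquiv.symm_apply_eq _).2 hf.symm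
  rfl

theorem freeClass_surjective : Function.Surjective (freeClass e Y n) := by
  intro x
  obtain ⟨f, hf, rfl⟩ := (freeResolution e).extMk_surjective x (n + 1) rfl
  exact ⟨⟨freeHomEquiv Y n f, (totComplex_d_apply Y n _).trans
    ((freeResolution_d_comp e Y n f).1 hf)⟩, freeClass_eq e Y n _ f rfl⟩

/-- Ext and cyclic cohomology are both quotients of the same space of cocycles. The equality of
kernels holds because Yoneda carries precomposition with the differential of the resolution to the
total differential, hence coboundaries to coboundaries. -/
theorem freeClass_eq_zero_iff (z : Cocycles Y n) :
    freeClass e Y n z = 0 ↔ cyclicClass Y n z = 0 := by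
  have h := freeClass_eq e Y n z ((freeHomEquiv Y n).symm z.1) (LinearEquiv.apply_symm_apply _ _)
  rw [cyclicClass_eq_zero_iff, h]
  refine (extMk_eq_zero_of_projective_iff (freeResolution e) Y n _ _).trans
    (or_congr (LinearEquiv.map_eq_zero_iff (freeHomEquiv Y n).symm) ?_)
  refine exists_congr fun p => exists_congr fun hp => ?_
  subst hp
  constructor
  · rintro ⟨g, hg⟩
    refine ⟨freeHomEquiv Y p g, (totComplex_d_apply Y p _).trans ?_⟩
    rw [freeResolution_d] at hg
    exact (freeHomEquiv_d (Y := Y) g).symm.trans ((LinearEquiv.symm_apply_eq _).1 hg.symm).symm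
  · rintro ⟨y, hy⟩
    refine ⟨(freeHomEquiv Y p).symm y, ?_⟩
    rw [freeResolution_d]
    refine ((LinearEquiv.symm_apply_eq (freeHomEquiv Y (p + 1))).2 ?_).symm
    refine hy.symm.trans ((totComplex_d_apply Y p y).trans ((freeHomEquiv_d _).trans ?_).symm)
    exact congrArg _ ((freeHomEquiv Y p).apply_symm_apply y)

/-- `Ext` from the constant cocyclic module is cyclic cohomology. -/
noncomputable def extEquivHC : Abelian.Ext Z Y n ≃ₗ[k] (HC k n).obj Y :=
  equivOfSurjective (freeClass e Y n) (cyclicClass Y n) (freeClass_surjective e Y n)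
    (cyclicClass_surjective Y n) (freeClass_eq_zero_iff e Y n)

/-- On cocycles both sides are composition with g: on the Ext side on the free resolution, on the
other side by functoriality of the total complex. -/
theorem extEquivHC_comp {Y Y' : CocyclicMod k} (g : Y ⟶ Y') (x : Abelian.Ext Z Y n) :
    extEquivHC e Y' n (x.comp (Abelian.Ext.mk₀ g) (add_zero n)) =
      ((HC k n).map g).hom (extEquivHC e Y n x) := by
  obtain ⟨z, rfl⟩ := freeClass_surjective e Y n x
  have hz := (freeHomEquiv Y n).apply_symm_apply z.1
  have h1 : (freeClass e Y n z).comp (Abelian.Ext.mk₀ g) (add_zero n) =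
      freeClass e Y' n (z.map g) := by
    rw [freeClass_eq e Y n z _ hz, freeClass_eq e Y' n (z.map g)
      ((freeHomEquiv Y n).symm z.1 ≫ g) ((freeHomEquiv_comp _ g).trans (congrArg _ hz))]
    exact (freeResolution e).extMk_comp_mk₀ _ _ _ _ g
  rw [h1, extEquivHC, extEquivHC, equivOfSurjective_apply, equivOfSurjective_apply]
  exact (HC_map_cyclicClass g n z (z.map g) rfl).symm

end Projective

section Injective

variable {Z : CocyclicMod k} (e : constMod k ≅ Z) (Y : CocyclicMod k) (n : ℕ)

theorem cofreeResolution_comp_d (f : Y ⟶ cofreeOn k n) :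
    f ≫ (cofreeResolution e).cocomplex.d n (n + 1) = 0 ↔
      totD ((dualMod k).obj (op Y)).operators n (cofreeHomEquiv Y n f) = 0 := by
  rw [cofreeResolution_d]
  rw [← cofreeHomEquiv_d]
  exact (LinearEquiv.map_eq_zero_iff (cofreeHomEquiv Y (n + 1))).symm

/-- The class in `Ext` of a cocycle of the total complex of the dual, by the cofree resolution. -/
noncomputable def cofreeClass : Cocycles ((dualMod k).obj (op Y)) n →ₗ[k] Abelian.Ext Y Z n :=
  extOfInjective (cofreeResolution e) Y n ∘ₗ
    LinearMap.codRestrict _ ((cofreeHomEquiv Y n).symm.toLinearMap ∘ₗ Submodule.subtype _)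
      fun z => (cofreeResolution_comp_d e Y n _).2
        ((congrArg _ ((cofreeHomEquiv Y n).apply_symm_apply z.1)).trans z.totD_eq_zero)

theorem cofreeClass_eq (z : Cocycles ((dualMod k).obj (op Y)) n) (f : Y ⟶ cofreeOn k n)
    (hf : cofreeHomEquiv Y n f = z.1) :
    cofreeClass e Y n z = (cofreeResolution e).extMk f (n + 1) rfl
      ((cofreeResolution_comp_d e Y n f).2 ((congrArg _ hf).trans z.totD_eq_zero)) := by
  obtain rfl : (cofreeHomEquiv Y n).symm z.1 = f := (LinearEquiv.symm_apply_eq _).2 hf.symm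
  rfl

theorem cofreeClass_surjective : Function.Surjective (cofreeClass e Y n) := by
  intro x
  obtain ⟨f, hf, rfl⟩ := (cofreeResolution e).extMk_surjective x (n + 1) rfl
  exact ⟨⟨cofreeHomEquiv Y n f, (totComplex_d_apply _ n _).trans
    ((cofreeResolution_comp_d e Y n f).1 hf)⟩, cofreeClass_eq e Y n _ f rfl⟩

/-- Coboundaries correspond again, now through `cofreeHomEquiv`, so that Ext and the cohomology of
the dual are the same quotient of cocycles. -/
theorem cofreeClass_eq_zero_iff (z : Cocycles ((dualMod k).obj (op Y)) n) :
    cofreeClass e Y n z = 0 ↔ cyclicClass ((dualMod k).obj (op Y)) n z = 0 := by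
  have h := cofreeClass_eq e Y n z ((cofreeHomEquiv Y n).symm z.1)
    (LinearEquiv.apply_symm_apply _ _)
  rw [cyclicClass_eq_zero_iff, h]
  refine (extMk_eq_zero_of_injective_iff (cofreeResolution e) Y n _ _).trans
    (or_congr (LinearEquiv.map_eq_zero_iff (cofreeHomEquiv Y n).symm) ?_)
  refine exists_congr fun p => exists_congr fun hp => ?_
  subst hp
  constructor
  · rintro ⟨g, hg⟩
    refine ⟨cofreeHomEquiv Y p g, (totComplex_d_apply _ p _).trans ?_⟩
    rw [cofreeResolution_d] at hg
    exact (cofreeHomEquiv_d (Y := Y) g).symm.trans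
      ((LinearEquiv.symm_apply_eq _).1 hg.symm).symm
  · rintro ⟨y, hy⟩
    refine ⟨(cofreeHomEquiv Y p).symm y, ?_⟩
    rw [cofreeResolution_d]
    refine ((LinearEquiv.symm_apply_eq (cofreeHomEquiv Y (p + 1))).2 ?_).symm
    refine hy.symm.trans ((totComplex_d_apply _ p y).trans ((cofreeHomEquiv_d _).trans ?_).symm)
    exact congrArg _ ((cofreeHomEquiv Y p).apply_symm_apply y)

/-- `Ext` to the constant cocyclic module is the cyclic cohomology of the cyclic dual. -/
noncomputable def extEquivHCcyc :
    Abelian.Ext Y Z n ≃ₗ[k] (HCcyc k n).obj (op ((cyclicDual k).obj Y)) :=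
  equivOfSurjective (cofreeClass e Y n) (cyclicClass ((dualMod k).obj (op Y)) n)
    (cofreeClass_surjective e Y n) (cyclicClass_surjective _ n) (cofreeClass_eq_zero_iff e Y n)

theorem extEquivHCcyc_cofreeClass (z : Cocycles ((dualMod k).obj (op Y)) n) :
    extEquivHCcyc e Y n (cofreeClass e Y n z) =
      (show (HCcyc k n).obj (op ((cyclicDual k).obj Y)) from
        cyclicClass ((dualMod k).obj (op Y)) n z) :=
  equivOfSurjective_apply (cofreeClass e Y n) (cyclicClass ((dualMod k).obj (op Y)) n)
    (cofreeClass_surjective e Y n) (cyclicClass_surjective _ n) (cofreeClass_eq_zero_iff e Y n) z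

/-- Precomposition with g of a morphism to a cofree module corresponds to the map of dual total
complexes that g induces, so the claim is again an identity of cocycles. -/
theorem extEquivHCcyc_comp {Y Y' : CocyclicMod k} (g : Y ⟶ Y') (x : Abelian.Ext Y' Z n) :
    extEquivHCcyc e Y n ((Abelian.Ext.mk₀ g).comp x (zero_add n)) =
      ((HCcyc k n).map ((cyclicDual k).map g).op).hom (extEquivHCcyc e Y' n x) := by
  obtain ⟨z, rfl⟩ := cofreeClass_surjective e Y' n x
  have hz := (cofreeHomEquiv Y' n).apply_symm_apply z.1
  have h1 : (Abelian.Ext.mk₀ g).comp (cofreeClass e Y' n z) (zero_add n) =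
      cofreeClass e Y n (z.map ((dualMod k).map g.op)) := by
    rw [cofreeClass_eq e Y' n z _ hz, cofreeClass_eq e Y n (z.map ((dualMod k).map g.op))
      (g ≫ (cofreeHomEquiv Y' n).symm z.1) ((cofreeHomEquiv_comp g _).trans (congrArg _ hz))]
    exact (cofreeResolution e).mk₀_comp_extMk _ _ _ _ g
  rw [h1, extEquivHCcyc_cofreeClass, extEquivHCcyc_cofreeClass]
  exact (HC_map_cyclicClass ((dualMod k).map g.op) n z (z.map ((dualMod k).map g.op)) rfl).symm

end Injective

end Comparison
end BivariantHopf

/-! ### The two quotients of T(C, M) for a stable pair. -/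

namespace BivariantHopf
open CategoryTheory Opposite

section Quotients

variable {k : Type u} [Field k] {H : Type v} [Ring H] [Bialgebra k H]

namespace PPCModule

theorem Hom.eq_zero_of_generated {X Y : PPCModule k H} (f : Hom X Y) {R : ∀ n, X.X n → Prop}
    (hR : ∀ n x, R n x → f.f n x = 0) {n : ℕ} {x : X.X n} (hx : Generated X R n x) :
    f.f n x = 0 := by
  induction hx with
  | of n x h => exact hR n x h
  | zero n => exact map_zero _
  | add n x y _ _ hx hy => rw [map_add, hx, hy, add_zero]
  | smul n a x _ hx => rw [map_smul, hx, smul_zero]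
  | act n h x _ hx => rw [f.act, hx, map_zero]
  | δ n i x _ hx => rw [f.δ, hx, map_zero]
  | σ n j x _ hx => rw [f.σ, hx, map_zero]
  | τ n x _ hx => rw [f.τ, hx, map_zero]

/-- A morphism that vanishes on `R` descends to the quotient by `R`. -/
def quotLift {X Y : PPCModule k H} (f : Hom X Y) (R : ∀ n, X.X n → Prop)
    (hR : ∀ n x, R n x → f.f n x = 0) : Hom (X.quot R) Y where
  f n := (X.generated R n).liftQ (f.f n) fun _ hx => f.eq_zero_of_generated hR hx
  act n h := by
    rintro ⟨x⟩
    exact f.act n h x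
  δ n i := by
    rintro ⟨x⟩
    exact f.δ n i x
  σ n j := by
    rintro ⟨x⟩
    exact f.σ n j x
  τ n := by
    rintro ⟨x⟩
    exact f.τ n x

/-- The projection to a quotient. -/
def quotProj (X : PPCModule k H) (R : ∀ n, X.X n → Prop) : Hom X (X.quot R) where
  f n := (X.generated R n).mkQ
  act _ _ _ := rfl
  δ _ _ _ := rfl
  σ _ _ _ := rfl
  τ _ _ := rfl

theorem quotProj_eq_zero (X : PPCModule k H) {R : ∀ n, X.X n → Prop} {n : ℕ} {x : X.X n}
    (h : R n x) : (X.quotProj R).f n x = 0 :=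
  (Submodule.Quotient.mk_eq_zero _).2 (Generated.of n x h)

/-- The composite of two morphisms. -/
def Hom.comp {X Y Z : PPCModule k H} (f : Hom X Y) (g : Hom Y Z) : Hom X Z where
  f n := g.f n ∘ₗ f.f n
  act n h x := (congrArg (g.f n) (f.act n h x)).trans (g.act n h _)
  δ n i x := (congrArg (g.f (n + 1)) (f.δ n i x)).trans (g.δ n i _)
  σ n j x := (congrArg (g.f n) (f.σ n j x)).trans (g.σ n j _)
  τ n x := (congrArg (g.f n) (f.τ n x)).trans (g.τ n _)

/-- A degreewise bijective morphism gives an isomorphism of cocyclic `k`-modules. -/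
noncomputable def isoOfBijective {X Y : PPCModule k H} (hX : X.IsPeriodic) (hY : Y.IsPeriodic)
    (f : Hom X Y) (hf : ∀ n, Function.Bijective (f.f n)) : X.toCocyclicMod hX ≅ Y.toCocyclicMod hY :=
  haveI : ∀ a, IsIso ((toCocyclicModMap hX hY f).app a) := fun a => by
    rw [ConcreteCategory.isIso_iff_bijective]
    exact hf a.as.len
  haveI : IsIso (toCocyclicModMap hX hY f) := NatIso.isIso_of_isIso_app _
  asIso (toCocyclicModMap hX hY f)

end PPCModule

open PPCModule

/-- The comparison of the largest para-cocyclic with the largest cocyclic quotient. -/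
def paraToCyc (P : HopfPair k H) :
    Hom (tensorModule P).paraQuot.coinv (tensorModule P).cycQuot.coinv :=
  coinvMap (quotLift ((tensorModule P).quotProj _) _ fun _ _ h => quotProj_eq_zero _ (Or.inl h))

/-- For a stable pair, the comparison has an inverse. -/
def cycToPara (P : HopfPair k H) (hP : P.Stable) :
    Hom (tensorModule P).cycQuot.coinv (tensorModule P).paraQuot.coinv :=
  quotLift
    (quotLift (((tensorModule P).quotProj (tensorModule P).ParaRel).comp
      ((tensorModule P).paraQuot.quotProj (tensorModule P).paraQuot.CoinvRel)) _ (by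
        rintro n x (h | ⟨y, rfl⟩)
        · exact (congrArg (((tensorModule P).paraQuot.quotProj _).f n) (quotProj_eq_zero _ h)).trans
            (map_zero _)
        -- Stability enters here: the relation τⁿ⁺¹ = id, which the cocyclic quotient imposes in
        -- addition, already holds on the coinvariants of the para-cocyclic quotient.
        · rw [map_sub, Hom.iterate_τ, sub_eq_zero]
          exact coinv_paraQuot_isPeriodic P hP n _)) _ (by
    rintro n _ ⟨h, y, rfl⟩
    obtain ⟨y, rfl⟩ := Submodule.Quotient.mk_surjective _ y
    exact quotProj_eq_zero (tensorModule P).paraQuot ⟨h, (tensorModule P).cls _ n y, rfl⟩)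

/-- Both maps are induced by the identity of T(C, M), so the composites fix the class of every
element. -/
theorem paraToCyc_bijective (P : HopfPair k H) (hP : P.Stable) (n : ℕ) :
    Function.Bijective ((paraToCyc P).f n) := by
  refine Function.bijective_iff_has_inverse.2 ⟨(cycToPara P hP).f n, ?_, ?_⟩
  · rintro ⟨⟨x⟩⟩
    rfl
  · rintro ⟨⟨x⟩⟩
    rfl

/-- For a stable pair, the cocyclic module of the triple is the cocyclic module of the pair. -/
noncomputable def tripleIso (P : HopfPair k H) (hP : P.Stable) : tripleModule P hP ≅ cocyclicHopf P :=
  isoOfBijective _ _ (paraToCyc P) (paraToCyc_bijective P hP)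

theorem tripleIso_natural {P Q : HopfPair k H} (hP : P.Stable) (hQ : Q.Stable) (f : P.Hom Q) :
    tripleModuleMap hP hQ f ≫ (tripleIso Q hQ).hom = (tripleIso P hP).hom ≫ cocyclicHopfMap f := by
  ext a x
  obtain ⟨m, rfl⟩ := exists_ob_eq a
  obtain ⟨x, rfl⟩ := Submodule.Quotient.mk_surjective _ x
  obtain ⟨x, rfl⟩ := Submodule.Quotient.mk_surjective _ x
  rfl

end Quotients

/-! ### The cocyclic module of the trivial pair is constant. -/

section TrivialPair

open PPCModule
open scoped TensorProduct

variable {k : Type u} [Field k] {H : Type v} [Ring H] [Bialgebra k H]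

variable (k) in
/-- The map `c⁰ ⊗ ⋯ ⊗ m ↦ ε(c⁰) ⋯ ε(cⁿ) m`. -/
def counitTW (C : Type u) [AddCommGroup C] [Module k C] [Coalgebra k C] (M : Type u)
    [AddCommGroup M] [Module k M] : ∀ n, TW k C M n →ₗ[k] M
  | 0 => LinearMap.id
  | n + 1 => counitTW C M n ∘ₗ deleteAt k C M 0 n

section

variable {C : Type u} [AddCommGroup C] [Module k C] [Coalgebra k C] {M : Type u}
    [AddCommGroup M] [Module k M]

theorem counitTW_cons {n : ℕ} (c : C) (w : TW k C M n) :
    counitTW k C M (n + 1) (cons c w) = Coalgebra.counit (R := k) c • counitTW k C M n w :=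
  map_smul (counitTW k C M n) _ w

theorem counitTW_deleteAt (j n : ℕ) (hj : j ≤ n) (x : TW k C M (n + 1)) :
    counitTW k C M n (deleteAt k C M j n x) = counitTW k C M (n + 1) x := by
  induction j generalizing n with
  | zero => rfl
  | succ j ih =>
    obtain ⟨m, rfl⟩ : ∃ m, n = m + 1 := ⟨n - 1, by omega⟩
    refine tw_induction x (by simp only [map_zero]) (fun c w => ?_)
        (fun x y hx hy => by simp only [map_add, hx, hy])
    rw [deleteAt_succ_cons, counitTW_cons, counitTW_cons, ih m (by omega)]

/-- Comultiplication followed by the counit in one of the new factors is the identity, so the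
invariance follows from the one under deletion of factors. -/
theorem counitTW_splitAt (j n : ℕ) (hj : j ≤ n) (x : TW k C M (n + 1)) :
    counitTW k C M (n + 2) (splitAt k C M j n x) = counitTW k C M (n + 1) x := by
  rw [← counitTW_deleteAt j (n + 1) (by omega), deleteAt_splitAt_self j n hj]

variable [Module H C] [IsScalarTower k H C] [Module H M] [IsScalarTower k H M]
  [ModuleCoalgebra k H C]

theorem counitTW_act (n : ℕ) (h : H) (x : TW k C M n) :
    counitTW k C M n (actTW k H C M n h x) = rep k H M h (counitTW k C M n x) := by
  induction n with
  | zero => rfl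
  | succ n ih => exact (congrArg _ (act_deleteAt 0 n h x)).trans (ih _)

variable [LeftComodule k H M]

/-- Rotation only moves the first factor to the end and lets m₍₋₁₎ act on it. The counit is
multiplicative for this action, and ε(m₍₋₁₎) m₍₀₎ = m. -/
theorem counitTW_rotate (n : ℕ) (x : TW k C M (n + 1)) :
    counitTW k C M (n + 1) (rotate k H C M n x) = counitTW k C M (n + 1) x := by
  induction n with
  | zero =>
    refine tw_induction x (by simp only [map_zero]) (fun c w => ?_)
        (fun x y hx hy => by simp only [map_add, hx, hy])
    exact deleteAt_rotate_zero (H := H) (M := M) c w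
  | succ n ih =>
    refine tw_induction₂ x (by simp only [map_zero]) (fun c c' w => ?_)
        (fun x y hx hy => by simp only [map_add, hx, hy])
    rw [rotate_succ_cons, counitTW_cons, ih, counitTW_cons, counitTW_cons, counitTW_cons, smul_comm]

end

/-- If the counit of C is an isomorphism, as for C = k, each factor C can be cancelled. -/
theorem counitTW_bijective (C : Type u) [AddCommGroup C] [Module k C] [Coalgebra k C] (M : Type u)
    [AddCommGroup M] [Module k M]
    (hC : Function.Bijective (Coalgebra.counit (R := k) (A := C))) (n : ℕ) :
    Function.Bijective (counitTW k C M n) := by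
  induction n with
  | zero => exact Function.bijective_id
  | succ n ih =>
    refine ih.comp ?_
    exact (((LinearEquiv.ofBijective _ hC).rTensor (TW k C M n)).trans
      (TensorProduct.lid k (TW k C M n))).bijective

/-- The constant pseudo-para-cocyclic `H`-module. -/
def constantModule (V : Type u) [AddCommGroup V] [Module k V] (ρ : H →ₐ[k] Module.End k V) :
    PPCModule k H where
  X _ := V
  act _ := ρ
  δ _ _ := LinearMap.id
  σ _ _ := LinearMap.id
  τ _ := LinearMap.id
  δ_δ _ _ _ _ _ := rfl
  σ_σ _ _ _ _ _ := rfl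
  δ_σ_self _ _ _ := rfl
  δ_σ_succ _ _ _ := rfl
  σ_δ_le _ _ _ _ _ := rfl
  σ_δ_gt _ _ _ _ _ := rfl
  τ_δ _ _ _ := rfl
  δ_last _ _ := rfl
  σ_τ _ _ _ := rfl
  σ_τ_zero _ _ := rfl
  act_δ _ _ _ _ := rfl
  act_σ _ _ _ _ := rfl

theorem constantModule_isPeriodic (V : Type u) [AddCommGroup V] [Module k V]
    (ρ : H →ₐ[k] Module.End k V) : (constantModule V ρ).IsPeriodic := fun n x =>
  congrFun (Function.iterate_id (n + 1)) x

/-- The constant cocyclic `k`-module of a constant pseudo-para-cocyclic module. -/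
def constModIso (ρ : H →ₐ[k] Module.End k k) :
    (constantModule k ρ).toCocyclicMod (constantModule_isPeriodic k ρ) ≅ constMod k :=
  NatIso.ofComponents (fun a => Iso.refl (ModuleCat.of k k)) (by
    intro a b f
    obtain ⟨q, rfl⟩ := exists_ob_eq a
    obtain ⟨m, rfl⟩ := exists_ob_eq b
    let F := (constantModule k ρ).toCocyclicMod (constantModule_isPeriodic k ρ)
    -- Each generator of Λ acts as the identity, hence so does every morphism.
    have key : (F.map f : ModuleCat.of k k ⟶ ModuleCat.of k k) = 𝟙 (ModuleCat.of k k) := by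
      induction f using Lam.hom_induction with
      | id q => exact F.map_id _
      | comp_δ f i h => exact (F.map_comp f _).trans ((congrArg₂ (· ≫ ·) h
          (CocyclicObject.wordFunctor_δ _ _ i)).trans (Category.id_comp _))
      | comp_σ f i h => exact (F.map_comp f _).trans ((congrArg₂ (· ≫ ·) h
          (CocyclicObject.wordFunctor_σ _ _ i)).trans (Category.id_comp _))
      | comp_τ f h => exact (F.map_comp f _).trans ((congrArg₂ (· ≫ ·) h
          (CocyclicObject.wordFunctor_τ _ _)).trans (Category.id_comp _))
    exact congrArg (fun g : ModuleCat.of k k ⟶ ModuleCat.of k k => g ≫ 𝟙 _) key)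

/-- The projection of `T(C, M)` to the coefficients. -/
def counitHom (P : HopfPair k H) : Hom (tensorModule P) (constantModule P.M (rep k H P.M)) where
  f n := counitTW k P.C P.M (n + 1)
  act n h x := counitTW_act (n + 1) h x
  δ n i x := by
    rcases Nat.lt_or_ge n i with hi | hi
    · exact (congrArg (counitTW k P.C P.M (n + 2)) (coface_last (by omega) x)).trans
        ((counitTW_rotate _ _).trans (counitTW_splitAt 0 n (by omega) x))
    · exact (congrArg (counitTW k P.C P.M (n + 2)) (coface_le hi x)).trans
        (counitTW_splitAt i n hi x)
  σ n j x := counitTW_deleteAt _ _ (by omega) x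
  τ n x := counitTW_rotate n x

variable (k H)

/-- The projection of the cocyclic module of the trivial pair to the ground field. -/
def trivialPairHom : Hom (tensorModule (trivialPair k H)).cycQuot.coinv
    (constantModule (trivialPair k H).M (rep k H (trivialPair k H).M)) :=
  quotLift (quotLift (counitHom (trivialPair k H)) _ (by
      rintro n _ (⟨h, y, rfl⟩ | ⟨y, rfl⟩)
      · rw [map_sub, Hom.act, Hom.τ, Hom.τ, Hom.act, sub_eq_zero]
        rfl
      · rw [map_sub, Hom.iterate_τ, sub_eq_zero]
        exact constantModule_isPeriodic _ _ n _)) _ (by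
    rintro n _ ⟨h, y, rfl⟩
    obtain ⟨y, rfl⟩ := Submodule.Quotient.mk_surjective _ y
    refine ((counitHom (trivialPair k H)).f n).map_sub _ _ |>.trans (sub_eq_zero.2 ?_)
    -- On the trivial module h acts as the scalar ε(h), so the relations of the coinvariants are
    -- already satisfied in the target.
    exact ((counitHom (trivialPair k H)).act n h y).trans
      (((counitHom (trivialPair k H)).f n).map_smul _ y).symm)

/-- The map from T(k, k) to k is bijective before any quotient is taken, and it factors through the
quotients. Hence these do not identify anything further. -/
theorem trivialPairHom_bijective (n : ℕ) : Function.Bijective ((trivialPairHom k H).f n) := by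
  have h : Function.Bijective (counitTW k (trivialPair k H).C (trivialPair k H).M (n + 1)) :=
    counitTW_bijective _ _ Function.bijective_id _
  constructor
  · refine (injective_iff_map_eq_zero _).2 ?_
    rintro ⟨⟨x⟩⟩ hx
    have h0 : x = 0 := h.1 (Eq.trans (b := 0) hx (map_zero _).symm)
    rw [h0]
    rfl
  · intro y
    obtain ⟨x, hx⟩ := h.2 y
    exact ⟨Submodule.Quotient.mk (Submodule.Quotient.mk x), hx⟩

/-- The cocyclic module of the trivial pair is constant. -/
noncomputable def trivialPairIso : constMod k ≅ cocyclicHopf (trivialPair k H) :=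
  (constModIso _).symm ≪≫
    (isoOfBijective _ _ (trivialPairHom k H) (trivialPairHom_bijective k H)).symm

end TrivialPair

end BivariantHopf

open BivariantHopf CategoryTheory Opposite in
theorem mainTheorem1 (k : Type u) [Field k] (H : Type v) [Ring H] [Bialgebra k H] (n : ℕ) :
    (∃ Φ : ∀ (P : HopfPair k H) (hP : P.Stable),
        HCHopf (trivialPair k H) P n ≃ₗ[k] hopfCyclic P hP n,
      ∀ (P Q : HopfPair k H) (hP : P.Stable) (hQ : Q.Stable) (f : P.Hom Q)
        (x : HCHopf (trivialPair k H) P n),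
        Φ Q hQ (x.comp (Abelian.Ext.mk₀ (cocyclicHopfMap f)) (add_zero n)) =
          ((HC k n).map (tripleModuleMap hP hQ f)).hom (Φ P hP x)) ∧
    (∃ Ψ : ∀ P : HopfPair k H, P.Stable →
        (HCHopf P (trivialPair k H) n ≃ₗ[k]
          (HCcyc k n).obj (op ((cyclicDual k).obj (cocyclicHopf P)))),
      ∀ (P Q : HopfPair k H) (hP : P.Stable) (hQ : Q.Stable) (f : P.Hom Q)
        (x : HCHopf Q (trivialPair k H) n),
        Ψ P hP ((Abelian.Ext.mk₀ (cocyclicHopfMap f)).comp x (zero_add n)) =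
          ((HCcyc k n).map ((cyclicDual k).map (cocyclicHopfMap f)).op).hom (Ψ Q hQ x)) := by
  let e := trivialPairIso k H
  constructor
  -- The comparison for C_•(C, M) lands in the cyclic cohomology of C_•(C, M) and is carried to that
  -- of the triple by the inverse of `tripleIso`.
  · refine ⟨fun P hP => extEquivHC e (cocyclicHopf P) n ≪≫ₗ
      ((HC k n).mapIso (tripleIso P hP).symm).toLinearEquiv, fun P Q hP hQ f x => ?_⟩
    have h1 := extEquivHC_comp e n (cocyclicHopfMap f) x
    -- This is the naturality square of `tripleIso` with both vertical isomorphisms inverted, after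
    -- applying HCⁿ.
    have h2 : (HC k n).map (cocyclicHopfMap f) ≫ (HC k n).map (tripleIso Q hQ).inv =
        (HC k n).map (tripleIso P hP).inv ≫ (HC k n).map (tripleModuleMap hP hQ f) := by
      rw [← (HC k n).map_comp, ← (HC k n).map_comp]
      refine congrArg (HC k n).map ((Iso.comp_inv_eq _).2 ?_)
      rw [Category.assoc, tripleIso_natural, Iso.inv_hom_id_assoc]
    exact (congrArg ((HC k n).map (tripleIso Q hQ).inv).hom h1).trans
      (congrArg (fun g => g.hom (extEquivHC e (cocyclicHopf P) n x)) h2)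
  · exact ⟨fun P _ => extEquivHCcyc e (cocyclicHopf P) n,
      fun P Q _ _ f x => extEquivHCcyc_comp e n (cocyclicHopfMap f) x⟩
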